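/- **Conventions.** A polynomial in $\mathbb Z[x_1,\dots,x_n]$ is given as an explicit sum of monomials, each an integer coefficient times a product of powers of variables; coefficients and exponents are written in binary, and the variables are listed explicitly (so $n$ counts in unary). Rational numbers are given as fractions of integers in binary. All reductions are polynomial-time many-one reductions (Turing machines, time measured in the length of the encoding). $\mathrm{ETR}$ is the problem of deciding whether a given sentence $\exists x_1\cdots\exists x_n\,\Phi(x_1,\dots,x_n)$ is true in $\mathbb R$, where $\Phi$ is a quantifier-free Boolean combination of polynomial equations and inequalities with integer coefficients. The class $\exists\mathbb R$ consists of all decision problems that reduce to $\mathrm{ETR}$. A problem is $\exists\mathbb R$-hard if every problem in $\exists\mathbb R$ reduces to it, and $\exists\mathbb R$-complete if it is $\exists\mathbb R$-hard and lies in $\exists\mathbb R$. $\textsc{Feas}$ is the problem: given $r\in\mathbb Z[y_1,\dots,y_m]$, is there $y\in\mathbb R^m$ with $r(y)=0$? Continuous Multi-Region Clustering (CMRC) is the following problem. *Instance:* a polynomial $f\in\mathbb Z[x_1,\dots,x_d]$, rational numbers $\theta>0$ and $\delta>0$, and an integer $k\ge 1$ written in unary. *Question:* are there points $p_1,\dots,p_k\in\mathbb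 R^d$ with $f(p_i)\ge\theta$ for all $i$ and $\|p_i-p_j\|\ge\delta$ (Euclidean norm) for all $i\ne j$? **Theorem.** CMRC is $\exists\mathbb R$-complete, that is: 1. CMRC lies in $\exists\mathbb R$; 2. CMRC is $\exists\mathbb R$-hard. Moreover, hardness holds already for $k=2$, $\theta=1$, $\delta=1$: $\textsc{Feas}$ reduces in polynomial time to the restriction of CMRC to the instances with $k=2$, $\theta=1$, $\delta=1$, and this restriction is $\exists\mathbb R$-hard. -/

import Mathlib

namespace RealComplexity

/-! ### Decision problems and polynomial-time many-one reductions -/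

/-- A decision problem: a type of instances, an injective encoding of the instances as words over
a finite alphabet, and the set of yes-instances.  Languages over a finite alphabet are the special
case in which every word is an instance and `encode` is the identity. -/
structure DecisionProblem where
  /-- the instances -/
  Instance : Type
  /-- the input alphabet -/
  Alphabet : Type
  /-- the alphabet is finite -/
  alphabetFintype : Fintype Alphabet
  /-- the encoding of instances as words -/
  encode : Instance → List Alphabet
  /-- different instances have different encodings -/
  encode_injective : Function.Injective encode
  /-- the yes-instances -/
  Yes : Instance → Prop

/-- Polynomial-time many-one reducibility: a map of instances that preserves and reflects
yes-instances, computed on the encodings by a Turing machine in polynomially many steps. -/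
def PolyReducible (P Q : DecisionProblem) : Prop :=
  ∃ f : P.Instance → Q.Instance,
    Nonempty (Turing.TM2ComputableInPolyTime P.encode Q.encode f) ∧
      ∀ x, P.Yes x ↔ Q.Yes (f x)

/-- The restriction of a problem to the instances that satisfy `S`, with the same encoding. -/
def DecisionProblem.restrict (P : DecisionProblem) (S : P.Instance → Prop) : DecisionProblem where
  Instance := {x : P.Instance // S x}
  Alphabet := P.Alphabet
  alphabetFintype := P.alphabetFintype
  encode x := P.encode x.1
  encode_injective _ _ h := Subtype.ext (P.encode_injective h)
  Yes x := P.Yes x.1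

/-! ### Words over a fixed finite alphabet -/

/-- The alphabet in which polynomials, formulas and parameters are written. -/
inductive Symbol
  | bit (b : Bool)
  | tally
  | plus
  | minus
  | item
  | close
  | eqZero
  | gtZero
  | geZero
  | neg
  | conj
  | disj
  deriving DecidableEq, Fintype

/-- Unary notation, terminated by `close`. -/
def encodeUnary (n : ℕ) : List Symbol :=
  List.replicate n Symbol.tally ++ [Symbol.close]

/-- Binary notation (least significant digit first, no superfluous digits), terminated by
`close`. -/
def encodeBinary (n : ℕ) : List Symbol :=
  (Computability.encodeNat n).map Symbol.bit ++ [Symbol.close]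

/-- Integers: a sign followed by the absolute value in binary. -/
def encodeInt (c : ℤ) : List Symbol :=
  (if c < 0 then Symbol.minus else Symbol.plus) :: encodeBinary c.natAbs

/-- Rational numbers: numerator and denominator in binary. -/
def encodeRat (q : ℚ) : List Symbol :=
  encodeInt q.num ++ encodeBinary q.den

/-- Lists: each entry is preceded by `item`, the list is terminated by `close`. -/
def encodeList {α : Type} (e : α → List Symbol) : List α → List Symbol
  | [] => [Symbol.close]
  | a :: l => Symbol.item :: (e a ++ encodeList e l)

/-! ### Polynomials, written as sums of monomials -/

/-- A written monomial in `n` variables: an integer coefficient and a list of powers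
`x_i ^ e`, given as pairs `(i, e)`. -/
abbrev Mono (n : ℕ) : Type := ℤ × List (Fin n × ℕ)

/-- A written polynomial in `n` variables: a sum of monomials. -/
abbrev Poly (n : ℕ) : Type := List (Mono n)

/-- The element of `ℤ[x_1, …, x_n]` denoted by a written monomial. -/
noncomputable def Mono.toMvPolynomial {n : ℕ} (a : Mono n) : MvPolynomial (Fin n) ℤ :=
  MvPolynomial.C a.1 * (a.2.map fun q => MvPolynomial.X q.1 ^ q.2).prod

/-- The element of `ℤ[x_1, …, x_n]` denoted by a written polynomial. -/
noncomputable def Poly.toMvPolynomial {n : ℕ} (p : Poly n) : MvPolynomial (Fin n) ℤ :=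
  (p.map Mono.toMvPolynomial).sum

/-- The value of a written polynomial at a real point. -/
noncomputable def Poly.eval {n : ℕ} (p : Poly n) (x : Fin n → ℝ) : ℝ :=
  MvPolynomial.aeval x p.toMvPolynomial

/-- Monomials: coefficients and exponents in binary, indices of variables in unary. -/
def encodeMono {n : ℕ} (a : Mono n) : List Symbol :=
  encodeInt a.1 ++ encodeList (fun q => encodeUnary q.1.val ++ encodeBinary q.2) a.2

/-- Polynomials are encoded monomial by monomial. -/
def encodePoly {n : ℕ} (p : Poly n) : List Symbol :=
  encodeList encodeMono p

/-! ### Quantifier-free formulas -/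

/-- Quantifier-free Boolean combinations of polynomial equations and inequalities with integer
coefficients in `n` variables. -/
inductive Formula (n : ℕ) : Type
  | eqZero (p : Poly n)
  | gtZero (p : Poly n)
  | geZero (p : Poly n)
  | neg (φ : Formula n)
  | conj (φ ψ : Formula n)
  | disj (φ ψ : Formula n)

/-- Truth of a formula at a real point. -/
def Formula.Holds {n : ℕ} (x : Fin n → ℝ) : Formula n → Prop
  | .eqZero p => p.eval x = 0
  | .gtZero p => 0 < p.eval x
  | .geZero p => 0 ≤ p.eval x
  | .neg φ => ¬ φ.Holds x
  | .conj φ ψ => φ.Holds x ∧ ψ.Holds x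
  | .disj φ ψ => φ.Holds x ∨ ψ.Holds x

/-- Formulas in prefix notation. -/
def encodeFormula {n : ℕ} : Formula n → List Symbol
  | .eqZero p => Symbol.eqZero :: encodePoly p
  | .gtZero p => Symbol.gtZero :: encodePoly p
  | .geZero p => Symbol.geZero :: encodePoly p
  | .neg φ => Symbol.neg :: encodeFormula φ
  | .conj φ ψ => Symbol.conj :: (encodeFormula φ ++ encodeFormula ψ)
  | .disj φ ψ => Symbol.disj :: (encodeFormula φ ++ encodeFormula ψ)

/-! ### The encodings are injective -/

/-- A map to words whose values can be recognized as initial segments of words. -/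
def PrefixInjective {α : Type} (e : α → List Symbol) : Prop :=
  ∀ ⦃a b : α⦄ ⦃s t : List Symbol⦄, e a ++ s = e b ++ t → a = b ∧ s = t

theorem PrefixInjective.injective {α : Type} {e : α → List Symbol} (h : PrefixInjective e) :
    Function.Injective e := fun a b hab =>
  (h (a := a) (b := b) (s := []) (t := []) (by rw [hab])).1

theorem append_close_inj {l m s t : List Symbol} (hl : Symbol.close ∉ l) (hm : Symbol.close ∉ m)
    (h : l ++ Symbol.close :: s = m ++ Symbol.close :: t) : l = m ∧ s = t := by
  induction l generalizing m with
  | nil =>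
    cases m with
    | nil => simpa using h
    | cons y m => simp at h hm; exact absurd h.1 hm.1
  | cons x l ih =>
    cases m with
    | nil => simp at h hl; exact absurd h.1.symm hl.1
    | cons y m =>
      simp only [List.cons_append, List.cons.injEq, List.mem_cons, not_or] at h hl hm
      obtain ⟨h1, h2⟩ := ih hl.2 hm.2 h.2
      exact ⟨by rw [h.1, h1], h2⟩

theorem prefixInjective_encodeUnary : PrefixInjective encodeUnary := by
  intro a b s t h
  simp only [encodeUnary, List.append_assoc, List.singleton_append] at h
  obtain ⟨h1, h2⟩ := append_close_inj (by simp [List.mem_replicate]) (by simp [List.mem_replicate]) h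
  exact ⟨by simpa using congrArg List.length h1, h2⟩

theorem prefixInjective_encodeBinary : PrefixInjective encodeBinary := by
  intro a b s t h
  simp only [encodeBinary, List.append_assoc, List.singleton_append] at h
  obtain ⟨h1, h2⟩ := append_close_inj (by simp) (by simp) h
  have hb : Function.Injective Symbol.bit := fun _ _ h => by simpa using h
  exact ⟨Computability.encodingNatBool.encode_injective (hb.list_map h1), h2⟩

theorem prefixInjective_encodeInt : PrefixInjective encodeInt := by
  intro a b s t h
  simp only [encodeInt, List.cons_append, List.cons.injEq] at h
  obtain ⟨h1, h2⟩ := prefixInjective_encodeBinary h.2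
  refine ⟨?_, h2⟩
  have h3 := h.1
  split_ifs at h3 <;> omega

theorem PrefixInjective.pair {α β γ : Type} {e : α → List Symbol} {e' : β → List Symbol}
    (h : PrefixInjective e) (h' : PrefixInjective e') {f : γ → α} {g : γ → β}
    (hfg : ∀ x y, f x = f y → g x = g y → x = y) :
    PrefixInjective fun x => e (f x) ++ e' (g x) := by
  intro x y s t hxy
  simp only [List.append_assoc] at hxy
  obtain ⟨h1, h2⟩ := h hxy
  obtain ⟨h3, h4⟩ := h' h2
  exact ⟨hfg x y h1 h3, h4⟩

theorem prefixInjective_encodeRat : PrefixInjective encodeRat :=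
  prefixInjective_encodeInt.pair prefixInjective_encodeBinary fun _ _ => Rat.ext

theorem PrefixInjective.list {α : Type} {e : α → List Symbol} (h : PrefixInjective e) :
    PrefixInjective (encodeList e) := by
  intro l
  induction l with
  | nil =>
    intro m s t hlm
    cases m with
    | nil => simpa [encodeList] using hlm
    | cons b m => simp [encodeList] at hlm
  | cons a l ih =>
    intro m s t hlm
    cases m with
    | nil => simp [encodeList] at hlm
    | cons b m =>
      simp only [encodeList, List.cons_append, List.cons.injEq, List.append_assoc,
        true_and] at hlm
      obtain ⟨h1, h2⟩ := h hlm
      obtain ⟨h3, h4⟩ := ih h2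
      exact ⟨by rw [h1, h3], h4⟩

theorem prefixInjective_encodeMono {n : ℕ} : PrefixInjective (encodeMono (n := n)) := by
  refine prefixInjective_encodeInt.pair (PrefixInjective.list ?_) fun _ _ => Prod.ext
  refine prefixInjective_encodeUnary.pair prefixInjective_encodeBinary
    (f := fun q : Fin n × ℕ => q.1.val) (g := Prod.snd) fun x y h1 h2 => ?_
  exact Prod.ext (Fin.ext h1) h2

theorem prefixInjective_encodePoly {n : ℕ} : PrefixInjective (encodePoly (n := n)) :=
  prefixInjective_encodeMono.list

theorem prefixInjective_encodeFormula {n : ℕ} : PrefixInjective (encodeFormula (n := n)) := by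
  intro φ
  induction φ with
  | eqZero p | gtZero p | geZero p =>
    intro ψ s t h
    cases ψ <;> simp only [encodeFormula, List.cons_append, List.cons.injEq, reduceCtorEq,
      false_and, true_and] at h
    obtain ⟨h1, h2⟩ := prefixInjective_encodePoly h
    exact ⟨by rw [h1], h2⟩
  | neg φ ih =>
    intro ψ s t h
    cases ψ <;> simp only [encodeFormula, List.cons_append, List.cons.injEq, reduceCtorEq,
      false_and, true_and] at h
    obtain ⟨h1, h2⟩ := ih h
    exact ⟨by rw [h1], h2⟩
  | conj φ φ' ih ih' | disj φ φ' ih ih' =>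
    intro ψ s t h
    cases ψ <;> simp only [encodeFormula, List.cons_append, List.cons.injEq, reduceCtorEq,
      false_and, true_and, List.append_assoc] at h
    obtain ⟨h1, h2⟩ := ih h
    obtain ⟨h3, h4⟩ := ih' h2
    exact ⟨by rw [h1, h3], h4⟩

/-! ### The existential theory of the reals -/

/-- An existential sentence `∃ x_1 … ∃ x_n, Φ(x_1, …, x_n)`: the number `n` of quantified
variables and the quantifier-free formula `Φ`. -/
structure ExistentialSentence where
  n : ℕ
  formula : Formula n

/-- The list of quantified variables (in unary), followed by the formula. -/
def encodeSentence (S : ExistentialSentence) : List Symbol :=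
  encodeUnary S.n ++ encodeFormula S.formula

theorem encodeSentence_injective : Function.Injective encodeSentence := by
  rintro ⟨n, φ⟩ ⟨m, ψ⟩ h
  obtain ⟨h1, h2⟩ := prefixInjective_encodeUnary h
  dsimp only at h1
  subst h1
  obtain rfl := prefixInjective_encodeFormula.injective h2
  rfl

/-- The existential theory of the reals: is a given existential sentence true in `ℝ`? -/
def ETR : DecisionProblem where
  Instance := ExistentialSentence
  Alphabet := Symbol
  alphabetFintype := inferInstance
  encode := encodeSentence
  encode_injective := encodeSentence_injective
  Yes S := ∃ x : Fin S.n → ℝ, S.formula.Holds x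

/-- The class `∃ℝ`: the problems that reduce to the existential theory of the reals. -/
def ExistsReal : Set DecisionProblem := {P | PolyReducible P ETR}

/-- Hardness for `∃ℝ` under polynomial-time many-one reductions. -/
def ExistsRealHard (P : DecisionProblem) : Prop := ∀ Q ∈ ExistsReal, PolyReducible Q P

/-- Completeness for `∃ℝ`. -/
def ExistsRealComplete (P : DecisionProblem) : Prop := P ∈ ExistsReal ∧ ExistsRealHard P

/-! ### The problem Feas -/

/-- An instance of Feas: a polynomial in `ℤ[y_1, …, y_m]`. -/
structure FeasInstance where
  m : ℕ
  r : Poly m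

/-- The list of variables (in unary), followed by the polynomial. -/
def encodeFeas (I : FeasInstance) : List Symbol :=
  encodeUnary I.m ++ encodePoly I.r

theorem encodeFeas_injective : Function.Injective encodeFeas := by
  rintro ⟨n, p⟩ ⟨m, q⟩ h
  obtain ⟨h1, h2⟩ := prefixInjective_encodeUnary h
  dsimp only at h1
  subst h1
  obtain rfl := prefixInjective_encodePoly.injective h2
  rfl

/-- Feas: does a given integer polynomial have a real zero? -/
def Feas : DecisionProblem where
  Instance := FeasInstance
  Alphabet := Symbol
  alphabetFintype := inferInstance
  encode := encodeFeas
  encode_injective := encodeFeas_injective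
  Yes I := ∃ y : Fin I.m → ℝ, I.r.eval y = 0

/-! ### Continuous Multi-Region Clustering -/

/-- An instance of Continuous Multi-Region Clustering: a polynomial `f ∈ ℤ[x_1, …, x_d]`,
rational numbers `θ > 0` and `δ > 0`, and an integer `k ≥ 1`. -/
structure CMRCInstance where
  d : ℕ
  k : ℕ
  θ : ℚ
  δ : ℚ
  f : Poly d
  one_le_k : 1 ≤ k
  θ_pos : 0 < θ
  δ_pos : 0 < δ

/-- The list of variables and the number of points in unary, the rational parameters as fractions
in binary, then the polynomial. -/
def encodeCMRC (I : CMRCInstance) : List Symbol :=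
  encodeUnary I.d ++ (encodeUnary I.k ++ (encodeRat I.θ ++ (encodeRat I.δ ++ encodePoly I.f)))

theorem encodeCMRC_injective : Function.Injective encodeCMRC := by
  rintro ⟨d, k, θ, δ, f, _, _, _⟩ ⟨d', k', θ', δ', f', _, _, _⟩ h
  obtain ⟨h1, h⟩ := prefixInjective_encodeUnary h
  obtain ⟨h2, h⟩ := prefixInjective_encodeUnary h
  obtain ⟨h3, h⟩ := prefixInjective_encodeRat h
  obtain ⟨h4, h⟩ := prefixInjective_encodeRat h
  dsimp only at h1 h2 h3 h4
  subst h1 h2 h3 h4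
  obtain rfl := prefixInjective_encodePoly.injective h
  rfl

/-- Continuous Multi-Region Clustering: are there `k` points of `ℝ^d`, pairwise at Euclidean
distance at least `δ`, at each of which `f` is at least `θ`? -/
def CMRC : DecisionProblem where
  Instance := CMRCInstance
  Alphabet := Symbol
  alphabetFintype := inferInstance
  encode := encodeCMRC
  encode_injective := encodeCMRC_injective
  Yes I := ∃ p : Fin I.k → EuclideanSpace ℝ (Fin I.d),
    (∀ i, (I.θ : ℝ) ≤ I.f.eval (p i).ofLp) ∧ ∀ i j, i ≠ j → (I.δ : ℝ) ≤ ‖p i - p j‖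

/-- The restriction of Continuous Multi-Region Clustering to `k = 2`, `θ = 1`, `δ = 1`. -/
def CMRCTwo : DecisionProblem :=
  CMRC.restrict fun I : CMRCInstance => I.k = 2 ∧ I.θ = 1 ∧ I.δ = 1

end RealComplexity

/-!
Membership: an instance of clustering is a conjunction of polynomial inequalities in the coordinates
of the `k` points and two further variables, which equations with cleared denominators force to be
the thresholds.

Hardness: an encoded sentence is evaluated by reading its word from right to left with a finite
automaton and a few real registers, among them the stack of the truth values of the subformulas
read so far, held in a single real whose base-4 digits are 0 and 2. The registers before and
after each symbol become variables. That a step is performed correctly is expressed by boundedly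
many polynomial equations depending only on the symbol and the state, inequalities being replaced
by equations with square witnesses. Hence the sentence is true if and only if the sum `r` of the
squares of all these equations has a real zero, and writing `r` down is a symbol-by-symbol
translation. Since `1 - r ≤ 1`, with equality exactly at the zeros of `r`, the inequality
`1 - r ≥ 1` has a solution if and only if it has two solutions at distance 1, once one coordinate
that does not occur in `r` is added.

Polynomial time: the reductions are programs on stacks. The stacks are ranked so that a loop over a
stack only feeds stacks of higher rank, so by induction on the rank all stacks, and with them the
running time, stay polynomially bounded. Such programs are compiled to Turing machines.
-/

namespace RealComplexity

open Function Turing StateTransition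
open scoped Polynomial

/-! ### Computations of bounded length -/

section Reachability

variable {σ : Type*} {f : σ → Option σ} {m n : ℕ} {a b c : σ}

/-- The configuration `b` is reached from `a` in at most `n` steps: the propositional counterpart
of `StateTransition.EvalsToInTime`. -/
def ReachesIn (f : σ → Option σ) (n : ℕ) (a b : σ) : Prop :=
  Nonempty (EvalsToInTime f a (some b) n)

namespace ReachesIn

theorem refl (f : σ → Option σ) (a : σ) : ReachesIn f 0 a a := ⟨.refl f a⟩

theorem single (h : f a = some b) : ReachesIn f 1 a b := ⟨⟨1, h⟩, le_rfl⟩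

theorem trans (hab : ReachesIn f m a b) (hbc : ReachesIn f n b c) : ReachesIn f (m + n) a c :=
  hab.elim fun h => hbc.elim fun h' => ⟨Nat.add_comm m n ▸ h.trans f m n a b (some c) h'⟩

theorem head (hab : f a = some b) (hbc : ReachesIn f n b c) : ReachesIn f (n + 1) a c :=
  Nat.add_comm 1 n ▸ (single hab).trans hbc

theorem mono (h : ReachesIn f m a b) (hmn : m ≤ n) : ReachesIn f n a b :=
  h.elim fun h => ⟨⟨h.toEvalsTo, h.steps_le_m.trans hmn⟩⟩

theorem head_induction {P : ℕ → σ → Prop} (h : ReachesIn f n a b) (refl : ∀ n, P n b)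
    (head : ∀ n c d, f c = some d → P n d → P (n + 1) c) : P n a := by
  obtain ⟨⟨⟨k, hk⟩, hkn⟩⟩ := h
  induction k generalizing n a with
  | zero =>
    obtain rfl : a = b := Option.some.inj hk
    exact refl n
  | succ k ih =>
    obtain ⟨n, rfl⟩ := Nat.exists_eq_add_of_le' (Nat.one_le_of_lt hkn)
    change (flip bind f)^[k] (f a) = some b at hk
    cases hd : f a with
    | none => rw [hd, iterate_fixed rfl] at hk; cases hk
    | some d =>
      rw [hd] at hk
      exact head n a d hd (ih hk (Nat.le_of_succ_le_succ hkn))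

theorem map {τ : Type*} {g : τ → Option τ} {φ : σ → τ}
    (hφ : ∀ c d, f c = some d → g (φ c) = some (φ d)) (h : ReachesIn f n a b) :
    ReachesIn g n (φ a) (φ b) :=
  h.head_induction (P := fun n c => ReachesIn g n (φ c) (φ b))
    (fun n => (refl g _).mono n.zero_le) fun _ c d hcd ih => head (hφ c d hcd) ih

theorem measure_le {μ : σ → ℕ} {B : ℕ} (hμ : ∀ c d, f c = some d → μ d ≤ μ c + B)
    (h : ReachesIn f n a b) : μ b ≤ μ a + n * B :=
  h.head_induction (P := fun n c => μ b ≤ μ c + n * B)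
    (fun _ => Nat.le_add_right _ _) fun n c d hcd ih => by
    have hstep := hμ c d hcd
    rw [Nat.succ_mul]
    omega

end ReachesIn

end Reachability

section Configurations

theorem step_of_eq {K Λ σ : Type*} [DecidableEq K] {Γ : K → Type*} {M : Λ → TM2.Stmt Γ Λ σ} {l : Λ}
    {q : TM2.Stmt Γ Λ σ} (h : M l = q) (v : σ) (S : ∀ k, List (Γ k)) :
    TM2.step M ⟨some l, v, S⟩ = some (TM2.stepAux q v S) := by
  rw [TM2.step, h]

theorem initList_eq (tm : FinTM2) (s : List (tm.Γ tm.k₀)) :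
    initList tm s = ⟨some tm.main, tm.initialState, update (fun _ => []) tm.k₀ s⟩ := by
  rw [initList]
  congr 1
  funext k
  by_cases hk : k = tm.k₀
  · subst hk
    simp
  · simp [hk]

theorem haltList_eq (tm : FinTM2) (s : List (tm.Γ tm.k₁)) :
    haltList tm s = ⟨none, tm.initialState, update (fun _ => []) tm.k₁ s⟩ := by
  rw [haltList]
  congr 1
  funext k
  by_cases hk : k = tm.k₁
  · subst hk
    simp
  · simp [hk]

end Configurations

section PolynomialBounds

theorem monotone_eval (P : ℕ[X]) : Monotone fun n => P.eval n := by
  intro m n h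
  simp only [Polynomial.eval_eq_sum, Polynomial.sum]
  gcongr

theorem exists_forall_eval_le {ι : Type*} [Finite ι] (P : ι → ℕ[X]) :
    ∃ Q : ℕ[X], ∀ i n, (P i).eval n ≤ Q.eval n := by
  have := Fintype.ofFinite ι
  refine ⟨∑ i, P i, fun i n => ?_⟩
  rw [Polynomial.eval_finsetSum]
  exact Finset.single_le_sum_of_canonicallyOrdered (f := fun i => (P i).eval n) (Finset.mem_univ i)

end PolynomialBounds

/-! ### Programs on stacks -/

/-- The contents of the stacks of a program. -/
abbrev Store (R A : Type) : Type := R → List A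

/-- Programs that manipulate stacks of letters: `copy r s` puts the contents of `r` on top of `s`,
`cases r f` inspects the top of `r`, and `loop r f` empties the stack `r`, letter by letter, and
executes `f a` for every letter `a` that was removed. -/
inductive StackProg (R A : Type) : Type
  | skip
  | push (r : R) (a : A)
  | pop (r : R)
  | copy (r s : R)
  | seq (p q : StackProg R A)
  | cases (r : R) (f : Option A → StackProg R A)
  | loop (r : R) (f : A → StackProg R A)

namespace StackProg

variable {R A : Type}

/-- The program changes only stacks of rank above `m`. -/
def WritesAbove (rank : R → ℕ) (m : ℕ) : StackProg R A → Prop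
  | skip => True
  | push r _ => m < rank r
  | pop r => m < rank r
  | copy _ s => m < rank s
  | seq p q => p.WritesAbove rank m ∧ q.WritesAbove rank m
  | cases _ f => ∀ o, (f o).WritesAbove rank m
  | loop r f => m < rank r ∧ ∀ a, (f a).WritesAbove rank m

/-- Stacks are copied only to stacks of higher rank, and the bodies of loops change only stacks of
higher rank than the counter. This discipline bounds the number of turns of every loop before the
loop starts, and forbids the repeated doubling of a stack. -/
def WellRanked (rank : R → ℕ) : StackProg R A → Prop
  | skip => True
  | push _ _ => True
  | pop _ => True
  | copy r s => rank r < rank s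
  | seq p q => p.WellRanked rank ∧ q.WellRanked rank
  | cases _ f => ∀ o, (f o).WellRanked rank
  | loop r f => ∀ a, (f a).WellRanked rank ∧ (f a).WritesAbove rank (rank r)

section Semantics

variable [DecidableEq R]

/-- One turn of a loop with counter stack `r` and body `f`. -/
def turn (r : R) (f : A → Store R A → Store R A) (ρ : Store R A) : Store R A :=
  (ρ r).head?.elim ρ fun a => f a (update ρ r (ρ r).tail)

/-- The effect of a program on the stacks. The number of turns of a loop is the initial length of
its counter, which is the intended meaning as long as the body leaves the counter alone. -/
def run : StackProg R A → Store R A → Store R A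
  | skip, ρ => ρ
  | push r a, ρ => update ρ r (a :: ρ r)
  | pop r, ρ => update ρ r (ρ r).tail
  | copy r s, ρ => update ρ s (ρ r ++ ρ s)
  | seq p q, ρ => q.run (p.run ρ)
  | cases r f, ρ => (f (ρ r).head?).run ρ
  | loop r f, ρ => (turn r fun a => (f a).run)^[(ρ r).length] ρ

/-- The number of steps taken by one turn of a loop whose body `f a` takes `c a` steps. -/
def turnCost (r : R) (c : A → Store R A → ℕ) (ρ : Store R A) : ℕ :=
  (ρ r).head?.elim 0 fun a => c a (update ρ r (ρ r).tail) + 1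

/-- The number of steps taken by a program. -/
def cost : StackProg R A → Store R A → ℕ
  | skip, _ => 0
  | push _ _, _ => 1
  | pop _, _ => 1
  | copy r _, ρ => 2 * (ρ r).length + 2
  | seq p q, ρ => p.cost ρ + q.cost (p.run ρ)
  | cases r f, ρ => (f (ρ r).head?).cost ρ + 1
  | loop r f, ρ => ∑ t ∈ Finset.range (ρ r).length,
      turnCost r (fun a => (f a).cost) ((turn r fun a => (f a).run)^[t] ρ) + 1

theorem run_seq (p q : StackProg R A) (ρ : Store R A) : (seq p q).run ρ = q.run (p.run ρ) := rfl

variable {r : R} {a : A} {l : List A} {ρ : Store R A}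

theorem turn_of_eq_cons (f : A → Store R A → Store R A) (h : ρ r = a :: l) :
    turn r f ρ = f a (update ρ r l) := by
  simp [turn, h]

theorem turnCost_of_eq_cons (c : A → Store R A → ℕ) (h : ρ r = a :: l) :
    turnCost r c ρ = c a (update ρ r l) + 1 := by
  simp [turnCost, h]

theorem length_turn_le {s : R} {f : A → Store R A → Store R A}
    (hf : ∀ a ρ, f a ρ s = ρ s) (ρ : Store R A) : (turn r f ρ s).length ≤ (ρ s).length := by
  unfold turn
  cases (ρ r).head? with
  | none => exact le_rfl
  | some a =>
    simp only [Option.elim_some, hf]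
    by_cases hs : s = r
    · subst hs; simp
    · simp [hs]

section Loop

variable (f : A → StackProg R A)

theorem run_loop_nil (h : ρ r = []) : (loop r f).run ρ = ρ := by
  simp [run, h]

theorem run_loop_cons (h : ρ r = a :: l) (hf : (f a).run (update ρ r l) r = l) :
    (loop r f).run ρ = (loop r f).run ((f a).run (update ρ r l)) := by
  rw [run, run, hf, h, List.length_cons, iterate_succ_apply, turn_of_eq_cons _ h]

theorem cost_loop_nil (h : ρ r = []) : (loop r f).cost ρ = 1 := by
  simp [cost, h]

theorem cost_loop_cons (h : ρ r = a :: l) (hf : (f a).run (update ρ r l) r = l) :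
    (loop r f).cost ρ =
      (f a).cost (update ρ r l) + (loop r f).cost ((f a).run (update ρ r l)) + 1 := by
  rw [cost, cost, hf, h, List.length_cons, Finset.sum_range_succ', iterate_zero_apply,
    turnCost_of_eq_cons _ h]
  simp only [iterate_succ_apply, turn_of_eq_cons _ h]
  omega

end Loop

theorem run_eq_of_writesAbove {rank : R → ℕ} {m : ℕ} (p : StackProg R A)
    (hp : p.WritesAbove rank m) (ρ : Store R A) (hr : rank r ≤ m) : p.run ρ r = ρ r := by
  induction p generalizing ρ with
  | skip => rfl
  | push s | pop s | copy _ s =>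
    have : r ≠ s := by rintro rfl; exact hr.not_gt hp
    simp [run, this]
  | seq p q ihp ihq => rw [run, ihq hp.2, ihp hp.1]
  | cases s f ih => exact ih _ (hp _) ρ
  | loop s f ih =>
    have hs : r ≠ s := by rintro rfl; exact hr.not_gt hp.1
    have hturn (ρ : Store R A) : turn s (fun a => (f a).run) ρ r = ρ r := by
      unfold turn
      cases (ρ s).head? with
      | none => rfl
      | some a => simp [ih a (hp.2 a), hs]
    rw [run]
    induction (ρ s).length with
    | zero => rfl
    | succ n ihn => rw [iterate_succ_apply', hturn, ihn]

end Semantics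

/-! ### Well-ranked programs run in polynomial time -/

section Growth

variable [Fintype R]

/-- The total length of all stacks. -/
def size (ρ : Store R A) : ℕ := ∑ r, (ρ r).length

variable (rank : R → ℕ)

/-- The total length of the stacks of rank `m`. -/
def tier (m : ℕ) (ρ : Store R A) : ℕ := ∑ r with rank r = m, (ρ r).length

/-- The total length of the stacks of rank below `m`. -/
def lowSize (m : ℕ) (ρ : Store R A) : ℕ := ∑ r with rank r < m, (ρ r).length

theorem lowSize_succ (m : ℕ) (ρ : Store R A) :
    lowSize rank (m + 1) ρ = lowSize rank m ρ + tier rank m ρ := by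
  simp only [lowSize, tier, Finset.sum_filter, ← Finset.sum_add_distrib]
  refine Finset.sum_congr rfl fun r _ => ?_
  split_ifs <;> omega

theorem lowSize_eq_size {m : ℕ} (hm : ∀ r, rank r < m) (ρ : Store R A) :
    lowSize rank m ρ = size ρ := by
  simp [lowSize, size, hm]

theorem length_le_lowSize {m : ℕ} {r : R} (hr : rank r < m) (ρ : Store R A) :
    (ρ r).length ≤ lowSize rank m ρ :=
  Finset.single_le_sum_of_canonicallyOrdered (f := fun r => (ρ r).length) (by simpa using hr)

theorem length_le_size (r : R) (ρ : Store R A) : (ρ r).length ≤ size ρ :=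
  Finset.single_le_sum_of_canonicallyOrdered (f := fun r => (ρ r).length) (Finset.mem_univ r)

theorem size_update_nil [DecidableEq R] (r : R) (l : List A) :
    size (update (fun _ => []) r l) = l.length := by
  rw [size, Finset.sum_eq_single r (fun s _ hs => by simp [hs]) (by simp), update_self]

theorem tier_update_le [DecidableEq R] {ρ : Store R A} {r : R} {l : List A} {c : ℕ}
    (h : l.length ≤ (ρ r).length + c) (m : ℕ) :
    tier rank m (update ρ r l) ≤ tier rank m ρ + if rank r = m then c else 0 := by
  unfold tier
  calc ∑ s with rank s = m, (update ρ r l s).length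
      ≤ ∑ s with rank s = m, ((ρ s).length + if s = r then c else 0) := by
        refine Finset.sum_le_sum fun s _ => ?_
        by_cases hs : s = r
        · subst hs; simpa using h
        · simp [hs]
    _ = _ := by
        rw [Finset.sum_add_distrib, Finset.sum_ite_eq']
        simp

/-- The stacks of any given rank grow at most by a polynomial in the size of the stacks of lower
rank. In contrast to a polynomial bound for the total size, such a bound survives iteration. -/
def TieredGrowth (g : Store R A → Store R A) : Prop :=
  ∀ m, ∃ P : ℕ[X], ∀ ρ, tier rank m (g ρ) ≤ tier rank m ρ + P.eval (lowSize rank m ρ)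

namespace TieredGrowth

variable {rank} {g h : Store R A → Store R A}

theorem id : TieredGrowth rank (id : Store R A → Store R A) := fun _ => ⟨0, fun ρ => by simp⟩

theorem of_update [DecidableEq R] {r : R} {l : Store R A → List A} {P : ℕ[X]}
    (hl : ∀ ρ, (l ρ).length ≤ (ρ r).length + P.eval (lowSize rank (rank r) ρ)) :
    TieredGrowth rank fun ρ => update ρ r (l ρ) := by
  refine fun m => ⟨P, fun ρ => (tier_update_le rank (hl ρ) m).trans ?_⟩
  split_ifs with hm
  · rw [hm]
  · omega

theorem exists_tier_iterate_le {m : ℕ} {P Q : ℕ[X]}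
    (hP : ∀ ρ, tier rank m (g ρ) ≤ tier rank m ρ + P.eval (lowSize rank m ρ))
    (hQ : ∀ ρ n, ∀ t ≤ n, lowSize rank m (g^[t] ρ) ≤ Q.eval (lowSize rank m ρ + n))
    (ρ : Store R A) {n t : ℕ} (ht : t ≤ n) :
    tier rank m (g^[t] ρ) ≤ tier rank m ρ + t * P.eval (Q.eval (lowSize rank m ρ + n)) := by
  induction t with
  | zero => simp
  | succ t ih =>
    have hlow := monotone_eval P (hQ ρ n t (by omega))
    have hstep := hP (g^[t] ρ)
    rw [iterate_succ_apply', Nat.succ_mul]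
    dsimp only at hlow
    linarith [ih (by omega)]

theorem exists_lowSize_iterate_le (hg : TieredGrowth rank g) (m : ℕ) :
    ∃ Q : ℕ[X], ∀ ρ n, ∀ t ≤ n, lowSize rank m (g^[t] ρ) ≤ Q.eval (lowSize rank m ρ + n) := by
  induction m with
  | zero => exact ⟨0, fun ρ n t _ => by simp [lowSize]⟩
  | succ m ih =>
    obtain ⟨Q, hQ⟩ := ih
    obtain ⟨P, hP⟩ := hg m
    refine ⟨Q + Polynomial.X + Polynomial.X * P.comp Q, fun ρ n t ht => ?_⟩
    have hle : lowSize rank m ρ + n ≤ lowSize rank (m + 1) ρ + n := by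
      rw [lowSize_succ]; omega
    have hturns : t ≤ lowSize rank (m + 1) ρ + n := by omega
    simp only [Polynomial.eval_add, Polynomial.eval_mul, Polynomial.eval_X, Polynomial.eval_comp]
    calc lowSize rank (m + 1) (g^[t] ρ)
        ≤ Q.eval (lowSize rank m ρ + n) +
            (tier rank m ρ + t * P.eval (Q.eval (lowSize rank m ρ + n))) := by
          rw [lowSize_succ]
          exact add_le_add (hQ ρ n t ht) (exists_tier_iterate_le hP hQ ρ ht)
      _ ≤ Q.eval (lowSize rank (m + 1) ρ + n) + (lowSize rank (m + 1) ρ + n +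
            (lowSize rank (m + 1) ρ + n) * P.eval (Q.eval (lowSize rank (m + 1) ρ + n))) := by
          gcongr
          · exact monotone_eval Q hle
          · rw [lowSize_succ]; omega
          · exact monotone_eval P (monotone_eval Q hle)
      _ = _ := by ring

theorem exists_size_iterate_le (hg : TieredGrowth rank g) :
    ∃ Q : ℕ[X], ∀ ρ n, ∀ t ≤ n, size (g^[t] ρ) ≤ Q.eval (size ρ + n) := by
  have hrank (r : R) : rank r < Finset.univ.sup rank + 1 :=
    Nat.lt_succ_of_le (Finset.le_sup (Finset.mem_univ r))
  simpa only [lowSize_eq_size rank hrank] using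
    hg.exists_lowSize_iterate_le (Finset.univ.sup rank + 1)

theorem exists_size_le (hg : TieredGrowth rank g) :
    ∃ Q : ℕ[X], ∀ ρ, size (g ρ) ≤ Q.eval (size ρ) := by
  obtain ⟨Q, hQ⟩ := hg.exists_size_iterate_le
  exact ⟨Q.comp (Polynomial.X + 1), fun ρ => by simpa using hQ ρ 1 1 le_rfl⟩

theorem comp (hh : TieredGrowth rank h) (hg : TieredGrowth rank g) :
    TieredGrowth rank (h ∘ g) := by
  intro m
  obtain ⟨P, hP⟩ := hg m
  obtain ⟨P', hP'⟩ := hh m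
  obtain ⟨Q, hQ⟩ := hg.exists_lowSize_iterate_le m
  refine ⟨P + P'.comp (Q.comp (Polynomial.X + 1)), fun ρ => ?_⟩
  have hlow := monotone_eval P' (hQ ρ 1 1 le_rfl)
  simp only [Polynomial.eval_add, Polynomial.eval_comp, Polynomial.eval_X, Polynomial.eval_one,
    iterate_one, comp_apply] at hlow ⊢
  linarith [hP ρ, hP' (g ρ)]

theorem of_finite {ι : Type*} [Finite ι] {g : ι → Store R A → Store R A}
    (hg : ∀ i, TieredGrowth rank (g i)) (c : Store R A → ι) :
    TieredGrowth rank fun ρ => g (c ρ) ρ := by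
  intro m
  choose P hP using fun i => hg i m
  obtain ⟨Q, hQ⟩ := exists_forall_eval_le P
  exact ⟨Q, fun ρ => (hP _ ρ).trans (Nat.add_le_add_left (hQ _ _) _)⟩

variable [DecidableEq R] [Finite A]

theorem turn {f : A → Store R A → Store R A} (hf : ∀ a, TieredGrowth rank (f a)) (r : R) :
    TieredGrowth rank (turn r f) := by
  have htail : TieredGrowth rank fun ρ : Store R A => update ρ r (ρ r).tail :=
    of_update (P := 0) fun ρ => by simp
  have hoption (o : Option A) : TieredGrowth rank fun ρ => o.elim ρ fun a =>
      f a (update ρ r (ρ r).tail) := by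
    cases o with
    | none => exact .id
    | some a => exact (hf a).comp htail
  exact of_finite hoption fun ρ => (ρ r).head?

end TieredGrowth

variable {rank} [DecidableEq R]

theorem tier_iterate_turn_le {r : R} {f : A → StackProg R A}
    (hf : ∀ a, (f a).WritesAbove rank (rank r)) {m : ℕ} (hm : m ≤ rank r) (n : ℕ)
    (ρ : Store R A) : tier rank m ((turn r fun a => (f a).run)^[n] ρ) ≤ tier rank m ρ := by
  induction n with
  | zero => exact le_rfl
  | succ n ih =>
    rw [iterate_succ_apply']
    refine le_trans (Finset.sum_le_sum fun s hs => length_turn_le (fun a ρ => ?_) _) ih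
    exact run_eq_of_writesAbove (f a) (hf a) ρ (by simp at hs; omega)

variable [Finite A]

theorem tieredGrowth_run_loop {r : R} {f : A → StackProg R A}
    (hf : ∀ a, (f a).WritesAbove rank (rank r)) (hg : ∀ a, TieredGrowth rank (f a).run) :
    TieredGrowth rank (loop r f).run := by
  intro m
  rcases le_or_gt m (rank r) with hm | hm
  · exact ⟨0, fun ρ => by simpa [run] using tier_iterate_turn_le hf hm _ ρ⟩
  obtain ⟨P, hP⟩ := TieredGrowth.turn hg r m
  obtain ⟨Q, hQ⟩ := (TieredGrowth.turn hg r).exists_lowSize_iterate_le m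
  refine ⟨Polynomial.X * P.comp (Q.comp (2 * Polynomial.X)), fun ρ => ?_⟩
  have hr := length_le_lowSize rank hm ρ
  refine (TieredGrowth.exists_tier_iterate_le hP hQ ρ hr).trans ?_
  simp only [Polynomial.eval_mul, Polynomial.eval_X, Polynomial.eval_comp, Polynomial.eval_ofNat]
  gcongr
  exact monotone_eval P (monotone_eval Q (two_mul _).ge)

theorem tieredGrowth_run (p : StackProg R A) (hp : p.WellRanked rank) :
    TieredGrowth rank p.run := by
  induction p with
  | skip => exact .id
  | push r a => exact .of_update (P := 1) fun ρ => by simp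
  | pop r => exact .of_update (P := 0) fun ρ => by simp
  | copy r s =>
    refine .of_update (P := Polynomial.X) fun ρ => ?_
    rw [Polynomial.eval_X, List.length_append, Nat.add_comm]
    gcongr
    exact length_le_lowSize rank hp ρ
  | seq p q ihp ihq => exact (ihq hp.2).comp (ihp hp.1)
  | cases r f ih => exact .of_finite (fun o => ih o (hp o)) fun ρ => (ρ r).head?
  | loop r f ih => exact tieredGrowth_run_loop (fun a => (hp a).2) fun a => ih a (hp a).1

theorem exists_cost_loop_le {r : R} {f : A → StackProg R A}
    (hg : ∀ a, TieredGrowth rank (f a).run)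
    (hf : ∀ a, ∃ C : ℕ[X], ∀ ρ, (f a).cost ρ ≤ C.eval (size ρ)) :
    ∃ C : ℕ[X], ∀ ρ, (loop r f).cost ρ ≤ C.eval (size ρ) := by
  choose C hC using hf
  obtain ⟨D, hD⟩ := exists_forall_eval_le C
  obtain ⟨Q, hQ⟩ := (TieredGrowth.turn hg r).exists_size_iterate_le
  have hturn (ρ : Store R A) : turnCost r (fun a => (f a).cost) ρ ≤ D.eval (size ρ) + 1 := by
    unfold turnCost
    cases (ρ r).head? with
    | none => simp
    | some a =>
      have htail : size (update ρ r (ρ r).tail) ≤ size ρ := Finset.sum_le_sum fun s _ => by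
        by_cases hs : s = r
        · subst hs; simp
        · simp [hs]
      exact Nat.succ_le_succ ((hC a _).trans ((hD a _).trans (monotone_eval D htail)))
  refine ⟨Polynomial.X * (D.comp (Q.comp (2 * Polynomial.X)) + 1) + 1, fun ρ => ?_⟩
  have hr := length_le_size r ρ
  have hbound : ∀ t ∈ Finset.range (ρ r).length,
      turnCost r (fun a => (f a).cost) ((turn r fun a => (f a).run)^[t] ρ) ≤
        D.eval (Q.eval (2 * size ρ)) + 1 := fun t ht => by
    have hsize := hQ ρ (size ρ) t ((Finset.mem_range.1 ht).le.trans hr)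
    rw [← two_mul] at hsize
    exact (hturn _).trans (Nat.succ_le_succ (monotone_eval D hsize))
  simp only [Polynomial.eval_add, Polynomial.eval_mul, Polynomial.eval_X, Polynomial.eval_comp,
    Polynomial.eval_ofNat, Polynomial.eval_one, cost]
  refine Nat.succ_le_succ ((Finset.sum_le_card_nsmul _ _ _ hbound).trans ?_)
  rw [Finset.card_range, smul_eq_mul]
  gcongr

theorem exists_cost_le (p : StackProg R A) (hp : p.WellRanked rank) :
    ∃ C : ℕ[X], ∀ ρ, p.cost ρ ≤ C.eval (size ρ) := by
  induction p with
  | skip => exact ⟨0, fun ρ => by simp [cost]⟩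
  | push | pop => exact ⟨1, fun ρ => by simp [cost]⟩
  | copy r s => exact ⟨2 * Polynomial.X + 2, fun ρ => by simp [cost, length_le_size]⟩
  | seq p q ihp ihq =>
    obtain ⟨C, hC⟩ := ihp hp.1
    obtain ⟨D, hD⟩ := ihq hp.2
    obtain ⟨Q, hQ⟩ := (tieredGrowth_run p hp.1).exists_size_le
    refine ⟨C + D.comp Q, fun ρ => ?_⟩
    rw [cost, Polynomial.eval_add, Polynomial.eval_comp]
    exact add_le_add (hC ρ) ((hD _).trans (monotone_eval D (hQ ρ)))
  | cases r f ih =>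
    choose C hC using fun o => ih o (hp o)
    obtain ⟨D, hD⟩ := exists_forall_eval_le C
    refine ⟨D + 1, fun ρ => ?_⟩
    rw [cost, Polynomial.eval_add, Polynomial.eval_one]
    exact Nat.succ_le_succ ((hC _ ρ).trans (hD _ _))
  | loop r f ih =>
    exact exists_cost_loop_le (fun a => tieredGrowth_run (f a) (hp a).1) fun a => ih a (hp a).1

end Growth

/-! ### Compilation of programs to Turing machines -/

/-- The labels of the machine that executes a program. -/
def Label : StackProg R A → Type
  | skip => Empty
  | push _ _ => Unit
  | pop _ => Unit
  | copy _ _ => Bool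
  | seq p q => p.Label ⊕ q.Label
  | cases _ f => Option (Σ o, (f o).Label)
  | loop _ f => Option (Σ a, (f a).Label)

theorem finite_label [Finite A] (p : StackProg R A) : Finite p.Label := by
  induction p with
  | skip => exact inferInstanceAs (Finite Empty)
  | push | pop => exact inferInstanceAs (Finite Unit)
  | copy => exact inferInstanceAs (Finite Bool)
  | seq p q ihp ihq => exact inferInstanceAs (Finite (p.Label ⊕ q.Label))
  | cases r f ih => exact inferInstanceAs (Finite (Option (Σ o, (f o).Label)))
  | loop r f ih => exact inferInstanceAs (Finite (Option (Σ a, (f a).Label)))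

/-- The label at which the execution of a program starts, if its labels are embedded in `Λ` by
`e` and the execution goes on at `next`. -/
def start {Λ : Type} : (p : StackProg R A) → (p.Label → Λ) → Λ → Λ
  | skip, _, next => next
  | push _ _, e, _ => e ()
  | pop _, e, _ => e ()
  | copy _ _, e, _ => e false
  | seq p q, e, next => p.start (fun l => e (.inl l)) (q.start (fun l => e (.inr l)) next)
  | cases _ _, e, _ => e none
  | loop _ _, e, _ => e none

/-- The machine statements that execute a program. The stack `none` is a scratch stack: `copy r s`
first moves `r` to the scratch stack and then moves the letters back, to both `r` and `s`. -/
def code [Inhabited A] {Λ : Type} : (p : StackProg R A) → (p.Label → Λ) → Λ → p.Label →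
    TM2.Stmt (fun _ : Option R => A) Λ (Option A)
  | skip, _, _ => fun l => l.elim
  | push r a, _, next => fun _ => .push (some r) (fun _ => a) (.goto fun _ => next)
  | pop r, _, next => fun _ => .pop (some r) (fun v _ => v) (.goto fun _ => next)
  | copy r s, e, next => fun l =>
    match l with
    | false => .pop (some r) (fun _ o => o) (.branch Option.isSome
        (.push none (fun v => v.getD default) (.goto fun _ => e false))
        (.goto fun _ => e true))
    | true => .pop none (fun _ o => o) (.branch Option.isSome
        (.push (some r) (fun v => v.getD default)
          (.push (some s) (fun v => v.getD default) (.goto fun _ => e true)))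
        (.goto fun _ => next))
  | seq p q, e, next => fun l =>
    match l with
    | .inl l => p.code (fun l => e (.inl l)) (q.start (fun l => e (.inr l)) next) l
    | .inr l => q.code (fun l => e (.inr l)) next l
  | cases r f, e, next => fun l =>
    match l with
    | none => .peek (some r) (fun _ o => o)
        (.goto fun v => (f v).start (fun l => e (some ⟨v, l⟩)) next)
    | some ⟨o, l⟩ => (f o).code (fun l => e (some ⟨o, l⟩)) next l
  | loop r f, e, next => fun l =>
    match l with
    | none => .pop (some r) (fun _ o => o) (.goto fun v =>
        match v with
        | none => next
        | some a => (f a).start (fun l => e (some ⟨a, l⟩)) (e none))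
    | some ⟨a, l⟩ => (f a).code (fun l => e (some ⟨a, l⟩)) (e none) l

/-- The stacks of the machine: the scratch stack and the stacks of the program. -/
def store (t : List A) (ρ : Store R A) : Option R → List A
  | none => t
  | some r => ρ r

/-- The program that empties a list of stacks. -/
def clear (l : List R) : StackProg R A := l.foldr (fun r p => seq (loop r fun _ => skip) p) skip

theorem wellRanked_clear (rank : R → ℕ) (l : List R) :
    (clear l : StackProg R A).WellRanked rank := by
  induction l with
  | nil => trivial
  | cons r l ih => exact ⟨fun _ => ⟨trivial, trivial⟩, ih⟩

variable [DecidableEq R]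

theorem run_loop_skip (r : R) (ρ : Store R A) :
    (loop r fun _ => skip).run ρ = update ρ r [] := by
  induction h : ρ r generalizing ρ with
  | nil => rw [run_loop_nil _ h, ← h, update_eq_self]
  | cons a l ih =>
    rw [run_loop_cons _ h (by simp [run]), run, ih _ (by simp), update_idem]

theorem run_clear (l : List R) (ρ : Store R A) :
    (clear l).run ρ = fun r => if r ∈ l then [] else ρ r := by
  induction l generalizing ρ with
  | nil => simp [clear, run]
  | cons s l ih =>
    rw [clear, List.foldr_cons, run, ← clear, ih, run_loop_skip]
    funext r
    by_cases h : r = s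
    · subst h; simp
    · simp [h]

section Store

variable (t : List A) (ρ : Store R A) (l : List A)

theorem update_store_some (r : R) : update (store t ρ) (some r) l = store t (update ρ r l) := by
  funext k
  cases k with
  | none => simp [store]
  | some s => by_cases h : s = r <;> simp [store, h]

theorem update_store_none : update (store t ρ) none l = store l ρ := by
  funext k
  cases k <;> simp [store]

theorem store_nil_update (r : R) :
    store [] (update (fun _ => []) r l) = update (fun _ => []) (some r) l := by
  rw [← update_store_some]
  congr 1
  funext k
  cases k <;> rfl

end Store

variable [Inhabited A] {Λ : Type} {M : Λ → TM2.Stmt (fun _ : Option R => A) Λ (Option A)}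
  {next : Λ}

section Copy

variable {r s : R} {e : Bool → Λ}

theorem reachesIn_unload (hM : M (e false) = (copy r s).code e next false) {l : List A}
    {ρ : Store R A} (hl : ρ r = l) (t : List A) (v : Option A) :
    ReachesIn (TM2.step M) (l.length + 1) ⟨some (e false), v, store t ρ⟩
      ⟨some (e true), none, store (l.reverse ++ t) (update ρ r [])⟩ := by
  induction l generalizing t v ρ with
  | nil =>
    refine ReachesIn.single ?_
    rw [step_of_eq hM]
    simp [code, TM2.stepAux, store, hl, update_store_some]
  | cons a l ih =>
    refine ReachesIn.head (b := ⟨some (e false), some a, store (a :: t) (update ρ r l)⟩) ?_ ?_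
    · rw [step_of_eq hM]
      simp [code, TM2.stepAux, store, hl, update_store_some, update_store_none]
    · simpa using ih (ρ := update ρ r l) (by simp) (a :: t) (some a)

theorem reachesIn_reload (hrs : r ≠ s) (hM : M (e true) = (copy r s).code e next true)
    (t : List A) (v : Option A) (ρ : Store R A) :
    ReachesIn (TM2.step M) (t.length + 1) ⟨some (e true), v, store t ρ⟩
      ⟨some next, none,
        store [] (update (update ρ r (t.reverse ++ ρ r)) s (t.reverse ++ ρ s))⟩ := by
  induction t generalizing v ρ with
  | nil =>
    refine ReachesIn.single ?_
    rw [step_of_eq hM]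
    simp [code, TM2.stepAux, store, update_store_none]
  | cons a t ih =>
    refine ReachesIn.head (b := ⟨some (e true), some a,
      store t (update (update ρ r (a :: ρ r)) s (a :: ρ s))⟩) ?_ ?_
    · rw [step_of_eq hM]
      simp [code, TM2.stepAux, store, update_store_some, update_store_none, hrs.symm]
    · have h := ih (some a) (update (update ρ r (a :: ρ r)) s (a :: ρ s))
      rw [update_comm hrs.symm, update_idem, update_idem] at h
      simpa [hrs] using h

theorem reachesIn_copy (hrs : r ≠ s) (hM : ∀ l, M (e l) = (copy r s).code e next l)
    (ρ : Store R A) (v : Option A) :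
    ReachesIn (TM2.step M) (2 * (ρ r).length + 2) ⟨some (e false), v, store [] ρ⟩
      ⟨some next, none, store [] (update ρ s (ρ r ++ ρ s))⟩ := by
  have h := (reachesIn_unload (ρ := ρ) (hM false) rfl [] v).trans
    (reachesIn_reload hrs (hM true) _ none _)
  simp only [List.append_nil, List.reverse_reverse, update_self, update_idem,
    update_of_ne hrs.symm, update_eq_self, List.length_reverse] at h
  exact h.mono (by omega)

end Copy

theorem reachesIn_loop {rank : R → ℕ} {r : R} {f : A → StackProg R A}
    {e : (loop r f).Label → Λ}
    (hf : ∀ a, (f a).WritesAbove rank (rank r))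
    (hbody : ∀ a ρ v, ∃ v', ReachesIn (TM2.step M) ((f a).cost ρ)
      ⟨some ((f a).start (fun l => e (some ⟨a, l⟩)) (e none)), v, store [] ρ⟩
      ⟨some (e none), v', store [] ((f a).run ρ)⟩)
    (hM : M (e none) = (loop r f).code e next none) (ρ : Store R A) (v : Option A) :
    ∃ v', ReachesIn (TM2.step M) ((loop r f).cost ρ) ⟨some (e none), v, store [] ρ⟩
      ⟨some next, v', store [] ((loop r f).run ρ)⟩ := by
  induction h : ρ r generalizing ρ v with
  | nil =>
    rw [run_loop_nil _ h, cost_loop_nil _ h]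
    refine ⟨none, ReachesIn.single ?_⟩
    rw [step_of_eq hM]
    simp only [code, TM2.stepAux, store, h, List.head?_nil, List.tail_nil, update_store_some]
    rw [← h, update_eq_self]
  | cons a l ih =>
    have hl : (f a).run (update ρ r l) r = l := by
      rw [run_eq_of_writesAbove (f a) (hf a) _ le_rfl, update_self]
    obtain ⟨v₁, h₁⟩ := hbody a (update ρ r l) (some a)
    obtain ⟨v₂, h₂⟩ := ih ((f a).run (update ρ r l)) v₁ hl
    rw [run_loop_cons _ h hl, cost_loop_cons _ h hl]
    refine ⟨v₂, ReachesIn.head ?_ (h₁.trans h₂)⟩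
    rw [step_of_eq hM]
    simp only [code, TM2.stepAux, store, h, List.head?_cons, List.tail_cons, update_store_some]

theorem reachesIn_code {rank : R → ℕ} (p : StackProg R A) (hp : p.WellRanked rank)
    (e : p.Label → Λ) (hM : ∀ l, M (e l) = p.code e next l) (ρ : Store R A) (v : Option A) :
    ∃ v', ReachesIn (TM2.step M) (p.cost ρ) ⟨some (p.start e next), v, store [] ρ⟩
      ⟨some next, v', store [] (p.run ρ)⟩ := by
  induction p generalizing next ρ v with
  | skip => exact ⟨v, ReachesIn.refl _ _⟩
  | push r a | pop r =>
    refine ⟨v, ReachesIn.single ?_⟩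
    rw [start, step_of_eq (hM ())]
    simp only [code, TM2.stepAux, update_store_some, store, run]
  | copy r s =>
    have hrs : r ≠ s := by rintro rfl; exact lt_irrefl _ hp
    exact ⟨none, reachesIn_copy hrs hM ρ v⟩
  | seq p q ihp ihq =>
    obtain ⟨v₁, h₁⟩ := ihp hp.1 (fun l => e (.inl l)) (fun l => hM (.inl l)) ρ v
    obtain ⟨v₂, h₂⟩ := ihq hp.2 (fun l => e (.inr l)) (fun l => hM (.inr l)) (p.run ρ) v₁
    exact ⟨v₂, h₁.trans h₂⟩
  | cases r f ih =>
    obtain ⟨v₁, h₁⟩ := ih (ρ r).head? (next := next) (hp _) (fun l => e (some ⟨_, l⟩))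
      (fun l => (hM (some ⟨_, l⟩)).trans (by simp only [code])) ρ (ρ r).head?
    refine ⟨v₁, ReachesIn.head ?_ h₁⟩
    rw [start, step_of_eq (hM none)]
    simp only [code, TM2.stepAux, store]
  | loop r f ih =>
    exact reachesIn_loop (fun a => (hp a).2)
      (fun a => ih a (hp a).1 (fun l => e (some ⟨a, l⟩))
        fun l => (hM (some ⟨a, l⟩)).trans (by simp only [code])) (hM none) ρ v

/-- The machine that executes a program, with input on the stack `i` and output on the
stack `o`. -/
noncomputable abbrev machine [Fintype R] [Fintype A] (p : StackProg R A) (i o : R) : FinTM2 where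
  K := Option R
  k₀ := some i
  k₁ := some o
  Γ := fun _ => A
  Λ := Option p.Label
  main := p.start some none
  ΛFin := @Fintype.ofFinite _ (have := p.finite_label; inferInstance)
  σ := Option A
  initialState := none
  Γk₀Fin := ‹Fintype A›
  m l :=
    match l with
    | none => .load (fun _ => none) .halt
    | some l => p.code some none l

theorem reachesIn_machine [Fintype R] [Fintype A] {rank : R → ℕ} (p : StackProg R A)
    (hp : p.WellRanked rank) {i o : R} {s t : List A}
    (h : p.run (update (fun _ => []) i s) = update (fun _ => []) o t) :
    ReachesIn (p.machine i o).step (p.cost (update (fun _ => []) i s) + 1)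
      (initList (p.machine i o) s) (haltList (p.machine i o) t) := by
  rw [initList_eq, haltList_eq]
  obtain ⟨v, hv⟩ := reachesIn_code (M := (p.machine i o).m) (next := none) p hp some
    (fun _ => rfl) (update (fun _ => []) i s) none
  rw [h, store_nil_update, store_nil_update] at hv
  exact hv.trans (ReachesIn.single rfl)

theorem computableInPolyTime [Finite R] [Finite A] {rank : R → ℕ} (p : StackProg R A)
    (hp : p.WellRanked rank) (i o : R) {α β : Type} {ea : α → List A} {eb : β → List A}
    {f : α → β} (h : ∀ a, p.run (update (fun _ => []) i (ea a)) o = eb (f a)) :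
    Nonempty (TM2ComputableInPolyTime ea eb f) := by
  have := Fintype.ofFinite R
  have := Fintype.ofFinite A
  let q : StackProg R A := seq p (clear (Finset.univ.erase o).toList)
  have hq : q.WellRanked rank := ⟨hp, wellRanked_clear _ _⟩
  have hrun (a : α) : q.run (update (fun _ => []) i (ea a)) =
      update (fun _ => []) o (eb (f a)) := by
    rw [run, run_clear]
    funext r
    by_cases hr : r = o
    · subst hr; simp [h]
    · simp [hr]
  obtain ⟨C, hC⟩ := exists_cost_le q hq
  have htime (a : α) : ReachesIn (q.machine i o).step ((C + 1).eval (ea a).length)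
      (initList (q.machine i o) (ea a)) (haltList (q.machine i o) (eb (f a))) := by
    refine (reachesIn_machine q hq (hrun a)).mono ?_
    rw [Polynomial.eval_add, Polynomial.eval_one, ← size_update_nil i (ea a)]
    exact Nat.succ_le_succ (hC _)
  refine ⟨{ tm := q.machine i o, inputAlphabet := Equiv.refl A, outputAlphabet := Equiv.refl A,
            time := C + 1, outputsFun := fun a => Classical.choice ?_ }⟩
  simpa [TM2OutputsInTime, ReachesIn] using htime a

end StackProg

/-! ### Composition of polynomial-time computations -/

section Lift

variable {K K' Λ Λ' σ σ' : Type} {Γ : K' → Type} (ι : K → K') (get : σ' → σ) (put : σ → σ')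
  (label : Λ → Λ')

/-- Execution of a statement as a part of a larger machine: `ι` embeds the stacks, `get` and `put`
access the internal state, `label` embeds the labels, and instead of halting the machine goes on
with `fin`. -/
def liftStmt (fin : TM2.Stmt Γ Λ' σ') : TM2.Stmt (fun k => Γ (ι k)) Λ σ → TM2.Stmt Γ Λ' σ'
  | .push k f q => .push (ι k) (fun s => f (get s)) (liftStmt fin q)
  | .peek k f q => .peek (ι k) (fun s o => put (f (get s) o)) (liftStmt fin q)
  | .pop k f q => .pop (ι k) (fun s o => put (f (get s) o)) (liftStmt fin q)
  | .load f q => .load (fun s => put (f (get s))) (liftStmt fin q)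
  | .branch f q₁ q₂ => .branch (fun s => f (get s)) (liftStmt fin q₁) (liftStmt fin q₂)
  | .goto f => .goto fun s => label (f (get s))
  | .halt => fin

/-- The configuration of the larger machine during the execution of a part: `embed` completes the
stacks of the part, and `next` replaces the halting state. -/
def liftCfg (embed : (∀ k, List (Γ (ι k))) → ∀ k, List (Γ k)) (next : Option Λ')
    (c : TM2.Cfg (fun k => Γ (ι k)) Λ σ) : TM2.Cfg Γ Λ' σ' :=
  ⟨c.l.elim next fun l => some (label l), put c.var, embed c.stk⟩

variable [DecidableEq K] [DecidableEq K'] {ι get put label} {fin : TM2.Stmt Γ Λ' σ'}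
  {embed : (∀ k, List (Γ (ι k))) → ∀ k, List (Γ k)} {next : Option Λ'}
  (hget : ∀ v, get (put v) = v) (hembed : ∀ S k, embed S (ι k) = S k)
  (hupdate : ∀ S k l, update (embed S) (ι k) l = embed (update S k l))
  (hfin : ∀ v S, TM2.stepAux fin v S = ⟨next, v, S⟩)

include hget hembed hupdate hfin

theorem stepAux_liftStmt (q : TM2.Stmt (fun k => Γ (ι k)) Λ σ) (v : σ)
    (S : ∀ k, List (Γ (ι k))) :
    TM2.stepAux (liftStmt ι get put label fin q) (put v) (embed S) =
      liftCfg ι put label embed next (TM2.stepAux q v S) := by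
  induction q generalizing v S with
  | push k f q ih | peek k f q ih | pop k f q ih | load f q ih =>
    simp only [liftStmt, TM2.stepAux, hget, hembed, hupdate, ih]
  | branch f q₁ q₂ ih₁ ih₂ =>
    simp only [liftStmt, TM2.stepAux, hget]
    cases f v with
    | false => exact ih₂ v S
    | true => exact ih₁ v S
  | goto f => simp only [liftStmt, TM2.stepAux, hget, liftCfg, Option.elim_some]
  | halt => simp only [liftStmt, TM2.stepAux, hfin, liftCfg, Option.elim_none]

theorem ReachesIn.lift {M : Λ → TM2.Stmt (fun k => Γ (ι k)) Λ σ} {M' : Λ' → TM2.Stmt Γ Λ' σ'}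
    (hM : ∀ l, M' (label l) = liftStmt ι get put label fin (M l)) {n : ℕ}
    {c d : TM2.Cfg (fun k => Γ (ι k)) Λ σ} (h : ReachesIn (TM2.step M) n c d) :
    ReachesIn (TM2.step M') n (liftCfg ι put label embed next c)
      (liftCfg ι put label embed next d) := by
  refine h.map fun c d hcd => ?_
  obtain ⟨_ | l, v, S⟩ := c
  · cases hcd
  · obtain rfl : TM2.stepAux (M l) v S = d := Option.some.inj hcd
    exact (step_of_eq (hM l) _ _).trans
      (congrArg some (stepAux_liftStmt hget hembed hupdate hfin (M l) v S))

end Lift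

section StackGrowth

variable {K Λ σ : Type} [DecidableEq K] {Γ : K → Type}

/-- A bound for the number of letters that a statement pushes. -/
def pushCount : TM2.Stmt Γ Λ σ → ℕ
  | .push _ _ q => pushCount q + 1
  | .peek _ _ q => pushCount q
  | .pop _ _ q => pushCount q
  | .load _ q => pushCount q
  | .branch _ q₁ q₂ => pushCount q₁ + pushCount q₂
  | .goto _ => 0
  | .halt => 0

theorem length_stepAux_le (q : TM2.Stmt Γ Λ σ) (v : σ) (S : ∀ k, List (Γ k)) (k : K) :
    ((TM2.stepAux q v S).stk k).length ≤ (S k).length + pushCount q := by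
  induction q generalizing v S with
  | push j f q ih =>
    refine (ih _ _).trans ?_
    by_cases h : k = j
    · subst h; simp [pushCount, Nat.add_assoc, Nat.add_comm]
    · simp [h, pushCount, ← Nat.add_assoc]
  | pop j f q ih =>
    refine (ih _ _).trans ?_
    by_cases h : k = j
    · subst h; simp [pushCount]
    · simp [h, pushCount]
  | peek | load => rename_i ih; exact ih _ _
  | branch f q₁ q₂ ih₁ ih₂ =>
    have h₁ := ih₁ v S
    have h₂ := ih₂ v S
    simp only [TM2.stepAux, pushCount]
    cases f v <;> simp only [cond_true, cond_false] <;> omega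
  | goto | halt => simp [pushCount]

theorem ReachesIn.length_le {M : Λ → TM2.Stmt Γ Λ σ} {B n : ℕ} (hB : ∀ l, pushCount (M l) ≤ B)
    {c d : TM2.Cfg Γ Λ σ} (h : ReachesIn (TM2.step M) n c d) (k : K) :
    (d.stk k).length ≤ (c.stk k).length + n * B := by
  refine h.measure_le (μ := fun c => (c.stk k).length) fun c d hcd => ?_
  obtain ⟨_ | l, v, S⟩ := c
  · cases hcd
  · obtain rfl : TM2.stepAux (M l) v S = d := Option.some.inj hcd
    exact (length_stepAux_le (M l) v S k).trans (Nat.add_le_add_left (hB l) _)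

end StackGrowth

theorem reachesIn_move {K Λ σ : Type} [DecidableEq K] {Γ : K → Type} {M : Λ → TM2.Stmt Γ Λ σ}
    {a b : K} (hab : a ≠ b) (g : Γ a → Γ b) {get : σ → Option (Γ a)}
    {put : Option (Γ a) → σ → σ} (hget : ∀ o s, get (put o s) = o)
    (hput : ∀ o o' s, put o (put o' s) = put o s) {e : Option (Γ a) → Λ} {next : Λ}
    (hnone : M (e none) = .pop a (fun s o => put o s)
      (.goto fun s => (get s).elim next fun x => e (some x)))
    (hsome : ∀ x, M (e (some x)) = .push b (fun _ => g x) (.goto fun _ => e none))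
    (v : σ) (S : ∀ k, List (Γ k)) :
    ReachesIn (TM2.step M) (2 * (S a).length + 1) ⟨some (e none), v, S⟩
      ⟨some next, put none v, update (update S a []) b (((S a).map g).reverse ++ S b)⟩ := by
  induction h : S a generalizing v S with
  | nil =>
    refine ReachesIn.single ?_
    rw [step_of_eq hnone]
    simp [TM2.stepAux, h, hget, hab.symm]
  | cons x l ih =>
    have hmove := ih (put (some x) v) (update (update S a l) b (g x :: S b)) (by simp [hab])
    rw [update_comm (β := fun k => List (Γ k)) hab.symm (g x :: S b)] at hmove
    simp only [hput, update_idem, update_self] at hmove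
    refine ReachesIn.head (b := ⟨some (e (some x)), put (some x) v, update S a l⟩) ?_
      (ReachesIn.head (b := ⟨some (e none), put (some x) v,
        update (update S a l) b (g x :: S b)⟩) ?_ ?_)
    · rw [step_of_eq hnone]
      simp [TM2.stepAux, h, hget]
    · rw [step_of_eq (hsome x)]
      simp [TM2.stepAux, hab.symm]
    · simpa using hmove

/-- The stacks of the composition of two machines: the stacks of both machines and an auxiliary
stack, by way of which the output of the first machine is moved to the input stack of the second
one. -/
inductive CompStack (K₁ K₂ : Type) : Type
  | first (k : K₁)
  | buffer
  | second (k : K₂)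
  deriving DecidableEq, Fintype

/-- The labels of the composition of two machines. The label `unload (some x)` or `reload (some x)`
indicates that the letter `x` is being moved. -/
inductive CompLabel (Λ₁ Λ₂ A : Type) : Type
  | first (l : Λ₁)
  | unload (o : Option A)
  | reload (o : Option A)
  | second (l : Λ₂)
  deriving Fintype

section Comp

variable (M₁ M₂ : FinTM2) (g : M₁.Γ M₁.k₁ → M₂.Γ M₂.k₀)

/-- The alphabets of the stacks of the composite machine. -/
@[reducible] def CompAlphabet : CompStack M₁.K M₂.K → Type
  | .first k => M₁.Γ k
  | .buffer => M₁.Γ M₁.k₁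
  | .second k => M₂.Γ k

/-- The internal states of the composite machine. -/
abbrev CompState : Type := M₁.σ × Option (M₁.Γ M₁.k₁) × M₂.σ

/-- The statements of the composite machine: the first machine is run, its output is moved to the
input stack of the second machine by way of the buffer, and the second machine is run. -/
def compStmt : CompLabel M₁.Λ M₂.Λ (M₁.Γ M₁.k₁) →
    TM2.Stmt (CompAlphabet M₁ M₂) (CompLabel M₁.Λ M₂.Λ (M₁.Γ M₁.k₁)) (CompState M₁ M₂)
  | .first l => liftStmt (K := M₁.K) .first Prod.fst (fun v => (v, none, M₂.initialState)) .first
      (.goto fun _ => .unload none) (M₁.m l)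
  | .unload none => .pop (.first M₁.k₁) (fun s o => (s.1, o, s.2.2))
      (.goto fun s => s.2.1.elim (.reload none) fun x => .unload (some x))
  | .unload (some x) => .push .buffer (fun _ => x) (.goto fun _ => .unload none)
  | .reload none => .pop .buffer (fun s o => (s.1, o, s.2.2))
      (.goto fun s => s.2.1.elim (.second M₂.main) fun x => .reload (some x))
  | .reload (some x) => .push (.second M₂.k₀) (fun _ => g x) (.goto fun _ => .reload none)
  | .second l => liftStmt (K := M₂.K) .second (fun s => s.2.2)
      (fun v => (M₁.initialState, none, v)) .second .halt (M₂.m l)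

/-- The composite machine. -/
abbrev compMachine [Fintype (M₁.Γ M₁.k₁)] : FinTM2 where
  K := CompStack M₁.K M₂.K
  kDecidableEq := inferInstance
  kFin := have := M₁.kFin; have := M₂.kFin; inferInstance
  k₀ := .first M₁.k₀
  k₁ := .second M₂.k₁
  Γ := CompAlphabet M₁ M₂
  Λ := CompLabel M₁.Λ M₂.Λ (M₁.Γ M₁.k₁)
  main := .first M₁.main
  ΛFin := have := M₁.ΛFin; have := M₂.ΛFin; inferInstance
  σ := CompState M₁ M₂
  initialState := (M₁.initialState, none, M₂.initialState)
  σFin := have := M₁.σFin; have := M₂.σFin; inferInstance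
  Γk₀Fin := M₁.Γk₀Fin
  m := compStmt M₁ M₂ g

variable {M₁ M₂}

/-- The contents of the stacks of the composite machine. -/
def compStacks (S : ∀ k, List (M₁.Γ k)) (t : List (M₁.Γ M₁.k₁)) (T : ∀ k, List (M₂.Γ k)) :
    ∀ k, List (CompAlphabet M₁ M₂ k)
  | .first k => S k
  | .buffer => t
  | .second k => T k

section Stacks

variable (S : ∀ k, List (M₁.Γ k)) (t : List (M₁.Γ M₁.k₁)) (T : ∀ k, List (M₂.Γ k))

theorem update_compStacks_first (k : M₁.K) (l : List (M₁.Γ k)) :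
    update (compStacks S t T) (.first k) l = compStacks (update S k l) t T := by
  funext j
  match j with
  | .first j =>
    by_cases h : j = k
    · subst h; simp [compStacks]
    · simp [compStacks, h]
  | .buffer | .second j => simp [compStacks]

theorem update_compStacks_buffer (l : List (M₁.Γ M₁.k₁)) :
    update (compStacks S t T) .buffer l = compStacks S l T := by
  funext j
  cases j <;> simp [compStacks]

theorem update_compStacks_second (k : M₂.K) (l : List (M₂.Γ k)) :
    update (compStacks S t T) (.second k) l = compStacks S t (update T k l) := by
  funext j
  match j with
  | .second j =>
    by_cases h : j = k
    · subst h; simp [compStacks]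
    · simp [compStacks, h]
  | .buffer | .first j => simp [compStacks]

end Stacks

variable {x : List (M₁.Γ M₁.k₀)} {y : List (M₁.Γ M₁.k₁)} {z : List (M₂.Γ M₂.k₁)} {n : ℕ}

theorem reachesIn_compStmt_first (h : ReachesIn M₁.step n (initList M₁ x) (haltList M₁ y)) :
    ReachesIn (TM2.step (compStmt M₁ M₂ g)) n
      ⟨some (.first M₁.main), (M₁.initialState, none, M₂.initialState),
        compStacks (update (fun _ => []) M₁.k₀ x) [] fun _ => []⟩
      ⟨some (.unload none), (M₁.initialState, none, M₂.initialState),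
        compStacks (update (fun _ => []) M₁.k₁ y) [] fun _ => []⟩ := by
  rw [initList_eq, haltList_eq] at h
  exact ReachesIn.lift (K := M₁.K) (Λ := M₁.Λ) (Γ := CompAlphabet M₁ M₂) (M := M₁.m) (ι := .first)
    (label := CompLabel.first) (get := Prod.fst) (put := fun v => (v, none, M₂.initialState))
    (embed := fun S => compStacks S [] fun _ => []) (next := some (.unload none))
    (fun _ => rfl) (fun _ _ => rfl) (fun S k l => update_compStacks_first S _ _ k l)
    (fun _ _ => rfl) (fun _ => rfl) h

theorem reachesIn_compStmt_unload :
    ReachesIn (TM2.step (compStmt M₁ M₂ g)) (2 * y.length + 1)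
      ⟨some (.unload none), (M₁.initialState, none, M₂.initialState),
        compStacks (update (fun _ => []) M₁.k₁ y) [] fun _ => []⟩
      ⟨some (.reload none), (M₁.initialState, none, M₂.initialState),
        compStacks (fun _ => []) y.reverse fun _ => []⟩ := by
  have h := reachesIn_move (M := compStmt M₁ M₂ g) (a := .first M₁.k₁) (b := .buffer)
    (e := .unload) (next := .reload none) (get := fun s => s.2.1)
    (put := fun o s => (s.1, o, s.2.2)) nofun id (fun _ _ => rfl) (fun _ _ _ => rfl) rfl
    (fun _ => rfl) (M₁.initialState, none, M₂.initialState)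
    (compStacks (update (fun _ => []) M₁.k₁ y) [] fun _ => [])
  rw [update_compStacks_first, update_compStacks_buffer, update_idem, update_eq_self] at h
  simpa [compStacks] using h

theorem reachesIn_compStmt_reload :
    ReachesIn (TM2.step (compStmt M₁ M₂ g)) (2 * y.length + 1)
      ⟨some (.reload none), (M₁.initialState, none, M₂.initialState),
        compStacks (fun _ => []) y.reverse fun _ => []⟩
      ⟨some (.second M₂.main), (M₁.initialState, none, M₂.initialState),
        compStacks (fun _ => []) [] (update (fun _ => []) M₂.k₀ (y.map g))⟩ := by
  have h := reachesIn_move (M := compStmt M₁ M₂ g) (a := .buffer) (b := .second M₂.k₀)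
    (e := .reload) (next := .second M₂.main) (get := fun s => s.2.1)
    (put := fun o s => (s.1, o, s.2.2)) nofun g (fun _ _ => rfl) (fun _ _ _ => rfl) rfl
    (fun _ => rfl) (M₁.initialState, none, M₂.initialState)
    (compStacks (fun _ => []) y.reverse fun _ => [])
  rw [update_compStacks_buffer, update_compStacks_second] at h
  simpa [compStacks] using h

theorem reachesIn_compStmt_second
    (h : ReachesIn M₂.step n (initList M₂ (y.map g)) (haltList M₂ z)) :
    ReachesIn (TM2.step (compStmt M₁ M₂ g)) n
      ⟨some (.second M₂.main), (M₁.initialState, none, M₂.initialState),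
        compStacks (fun _ => []) [] (update (fun _ => []) M₂.k₀ (y.map g))⟩
      ⟨none, (M₁.initialState, none, M₂.initialState),
        compStacks (fun _ => []) [] (update (fun _ => []) M₂.k₁ z)⟩ := by
  rw [initList_eq, haltList_eq] at h
  exact ReachesIn.lift (K := M₂.K) (Λ := M₂.Λ) (Γ := CompAlphabet M₁ M₂) (M := M₂.m) (ι := .second)
    (label := CompLabel.second) (get := fun s => s.2.2) (put := fun v => (M₁.initialState, none, v))
    (embed := fun S => compStacks (fun _ => []) [] S) (next := none)
    (fun _ => rfl) (fun _ _ => rfl) (fun S k l => update_compStacks_second _ _ S k l)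
    (fun _ _ => rfl) (fun _ => rfl) h

theorem reachesIn_compMachine [Fintype (M₁.Γ M₁.k₁)] {m : ℕ}
    (h₁ : ReachesIn M₁.step m (initList M₁ x) (haltList M₁ y))
    (h₂ : ReachesIn M₂.step n (initList M₂ (y.map g)) (haltList M₂ z)) :
    ReachesIn (compMachine M₁ M₂ g).step (m + (4 * y.length + 2) + n)
      (initList (compMachine M₁ M₂ g) x) (haltList (compMachine M₁ M₂ g) z) := by
  have hempty : (fun _ => [] : ∀ k, List (CompAlphabet M₁ M₂ k)) =
      compStacks (fun _ => []) [] fun _ => [] := by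
    funext k
    cases k <;> rfl
  rw [initList_eq, haltList_eq, hempty, update_compStacks_first, update_compStacks_second]
  have hmove := (reachesIn_compStmt_unload g (y := y)).trans (reachesIn_compStmt_reload g)
  exact ((reachesIn_compStmt_first g h₁).trans (hmove.mono (by omega))).trans
    (reachesIn_compStmt_second g h₂)

end Comp

section PolynomialTime

variable {α β γ A B C : Type} {ea : α → List A} {eb : β → List B} {ec : γ → List C} {f : α → β}
  {f' : β → γ}

theorem exists_length_output_le (h : TM2ComputableInPolyTime ea eb f) :
    ∃ L : ℕ[X], ∀ a, (eb (f a)).length ≤ L.eval (ea a).length := by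
  have := h.tm.ΛFin
  let B := ∑ l, pushCount (h.tm.m l)
  have hB (l : h.tm.Λ) : pushCount (h.tm.m l) ≤ B :=
    Finset.single_le_sum_of_canonicallyOrdered (f := fun l => pushCount (h.tm.m l))
      (Finset.mem_univ l)
  refine ⟨Polynomial.X + h.time * Polynomial.C B, fun a => ?_⟩
  have hout := ReachesIn.length_le hB ⟨h.outputsFun a⟩ h.tm.k₁
  have hin (s : List (h.tm.Γ h.tm.k₀)) (k : h.tm.K) :
      (update (fun _ => []) h.tm.k₀ s k).length ≤ s.length := by
    by_cases hk : k = h.tm.k₀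
    · subst hk; simp
    · simp [hk]
  simp only [initList_eq, haltList_eq, update_self, List.length_map] at hout
  simp only [Polynomial.eval_add, Polynomial.eval_X, Polynomial.eval_mul, Polynomial.eval_C]
  refine hout.trans (Nat.add_le_add_right ((hin _ _).trans ?_) _)
  rw [List.length_map]

theorem computableInPolyTime_comp (h₁ : TM2ComputableInPolyTime ea eb f)
    (h₂ : TM2ComputableInPolyTime eb ec f') :
    Nonempty (TM2ComputableInPolyTime ea ec (f' ∘ f)) := by
  have := h₂.tm.Γk₀Fin
  have : Fintype (h₁.tm.Γ h₁.tm.k₁) :=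
    Fintype.ofEquiv _ (h₂.inputAlphabet.trans h₁.outputAlphabet.symm)
  let g (x : h₁.tm.Γ h₁.tm.k₁) : h₂.tm.Γ h₂.tm.k₀ := h₂.inputAlphabet.symm (h₁.outputAlphabet x)
  have hg (y : List B) : (y.map h₁.outputAlphabet.invFun).map g = 
      y.map h₂.inputAlphabet.invFun := by
    simp [g, Function.comp_def]
  obtain ⟨L, hL⟩ := exists_length_output_le h₁
  refine ⟨{ tm := compMachine h₁.tm h₂.tm g, inputAlphabet := h₁.inputAlphabet,
            outputAlphabet := h₂.outputAlphabet,
            time := h₁.time + (4 * L + 2) + h₂.time.comp L,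
            outputsFun := fun a => Classical.choice (ReachesIn.mono (reachesIn_compMachine g
              ⟨h₁.outputsFun a⟩ (by rw [hg]; exact ⟨h₂.outputsFun (f a)⟩)) ?_) }⟩
  have hlength := hL a
  have htime := monotone_eval h₂.time hlength
  simp only [Polynomial.eval_add, Polynomial.eval_mul, Polynomial.eval_comp, List.length_map,
    Polynomial.eval_ofNat] at htime ⊢
  omega

end PolynomialTime

theorem PolyReducible.trans {P Q S : DecisionProblem} (h₁ : PolyReducible P Q)
    (h₂ : PolyReducible Q S) : PolyReducible P S := by
  obtain ⟨f, ⟨hf⟩, hPQ⟩ := h₁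
  obtain ⟨g, ⟨hg⟩, hQS⟩ := h₂
  exact ⟨g ∘ f, computableInPolyTime_comp hf hg, fun x => (hPQ x).trans (hQS _)⟩

/-! ### Written polynomials in variables indexed by natural numbers -/

/-- A written polynomial, that is, a sum of monomials, in the variables `x_0, x_1, …`. -/
abbrev NatPoly : Type := List (ℤ × List (ℕ × ℕ))

/-- The encoding of a power `x_i ^ e` within a monomial. -/
def encodePower (q : ℕ × ℕ) : List Symbol := encodeUnary q.1 ++ encodeBinary q.2

/-- The encoding of a monomial, as in `encodeMono`. -/
def encodeNatMono (a : ℤ × List (ℕ × ℕ)) : List Symbol :=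
  encodeInt a.1 ++ encodeList encodePower a.2

/-- The encoding of a written polynomial, as in `encodePoly`. -/
def encodeNatPoly (p : NatPoly) : List Symbol := encodeList encodeNatMono p

/-- The value of a written polynomial at a real sequence. -/
noncomputable def NatPoly.eval (p : NatPoly) (y : ℕ → ℝ) : ℝ :=
  (p.map fun a => (a.1 : ℝ) * (a.2.map fun q => y q.1 ^ q.2).prod).sum

theorem NatPoly.eval_cons (a : ℤ × List (ℕ × ℕ)) (p : NatPoly) (y : ℕ → ℝ) :
    NatPoly.eval (a :: p) y = a.1 * (a.2.map fun q => y q.1 ^ q.2).prod + NatPoly.eval p y := by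
  simp [NatPoly.eval]

theorem NatPoly.eval_append (p q : NatPoly) (y : ℕ → ℝ) :
    NatPoly.eval (p ++ q) y = NatPoly.eval p y + NatPoly.eval q y := by
  simp [NatPoly.eval]

/-- The same written polynomial, with the bound on the indices of variables forgotten. -/
def Poly.toNatPoly {n : ℕ} (p : Poly n) : NatPoly :=
  p.map fun a => (a.1, a.2.map fun q => (q.1.val, q.2))

/-- The written polynomial in `n` variables given by a written polynomial whose variables have
indices below `n`. Other indices are reduced modulo `n`. -/
def NatPoly.toPoly (p : NatPoly) (n : ℕ) [NeZero n] : Poly n :=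
  p.map fun a => (a.1, a.2.map fun q => (Fin.ofNat n q.1, q.2))

theorem encodeList_map {α β : Type} (e : β → List Symbol) (f : α → β) (l : List α) :
    encodeList e (l.map f) = encodeList (fun a => e (f a)) l := by
  induction l with
  | nil => rfl
  | cons a l ih => simp [encodeList, ih]

theorem encodeList_eq_flatMap {α : Type} (e : α → List Symbol) (l : List α) :
    encodeList e l = l.flatMap (fun a => Symbol.item :: e a) ++ [Symbol.close] := by
  induction l with
  | nil => rfl
  | cons a l ih => simp [encodeList, ih]

theorem encodePoly_eq_encodeNatPoly {n : ℕ} (p : Poly n) :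
    encodePoly p = encodeNatPoly p.toNatPoly := by
  rw [encodePoly, encodeNatPoly, Poly.toNatPoly, encodeList_map]
  congr 1
  funext a
  rw [encodeMono, encodeNatMono, encodeList_map]
  rfl

theorem Poly.eval_cons {n : ℕ} (a : Mono n) (p : Poly n) (x : Fin n → ℝ) :
    Poly.eval (a :: p) x = a.1 * (a.2.map fun q => x q.1 ^ q.2).prod + Poly.eval p x := by
  simp [Poly.eval, Poly.toMvPolynomial, Mono.toMvPolynomial, map_list_prod, comp_def]

theorem Poly.eval_toNatPoly {n : ℕ} (p : Poly n) {x : Fin n → ℝ} {y : ℕ → ℝ}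
    (h : ∀ i : Fin n, y i = x i) : p.toNatPoly.eval y = p.eval x := by
  induction p with
  | nil => simp [Poly.toNatPoly, NatPoly.eval, Poly.eval, Poly.toMvPolynomial]
  | cons a p ih =>
    rw [Poly.eval_cons, ← ih, Poly.toNatPoly, List.map_cons, NatPoly.eval_cons, List.map_map]
    simp only [comp_def, h]
    rfl

theorem toNatPoly_toPoly {n : ℕ} [NeZero n] {p : NatPoly} (h : ∀ a ∈ p, ∀ q ∈ a.2, q.1 < n) :
    (p.toPoly n).toNatPoly = p := by
  rw [Poly.toNatPoly, NatPoly.toPoly, List.map_map]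
  refine (List.map_congr_left fun a ha => ?_).trans (List.map_id p)
  simp only [comp_apply, List.map_map, id]
  refine Prod.ext rfl ((List.map_congr_left fun q hq => ?_).trans (List.map_id a.2))
  exact Prod.ext (Nat.mod_eq_of_lt (h a ha q hq)) rfl

theorem NatPoly.eval_toPoly {n : ℕ} [NeZero n] {p : NatPoly}
    (h : ∀ a ∈ p, ∀ q ∈ a.2, q.1 < n) {x : Fin n → ℝ} {y : ℕ → ℝ}
    (hy : ∀ i : Fin n, y i = x i) : (p.toPoly n).eval x = p.eval y := by
  rw [← Poly.eval_toNatPoly _ hy, toNatPoly_toPoly h]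

theorem encodePoly_toPoly {n : ℕ} [NeZero n] {p : NatPoly}
    (h : ∀ a ∈ p, ∀ q ∈ a.2, q.1 < n) : encodePoly (p.toPoly n) = encodeNatPoly p := by
  rw [encodePoly_eq_encodeNatPoly, toNatPoly_toPoly h]

/-- The number with given binary digits, least significant digit first. -/
def ofBits : List Bool → ℕ
  | [] => 0
  | b :: l => b.toNat + 2 * ofBits l

theorem ofBits_encodePosNum (n : PosNum) : ofBits (Computability.encodePosNum n) = n := by
  induction n with
  | one => rfl
  | bit0 n ih =>
    rw [Computability.encodePosNum, ofBits, ih, PosNum.cast_bit0, Bool.toNat_false]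
    omega
  | bit1 n ih =>
    rw [Computability.encodePosNum, ofBits, ih, PosNum.cast_bit1, Bool.toNat_true]
    omega

theorem ofBits_encodeNat (n : ℕ) : ofBits (Computability.encodeNat n) = n := by
  conv_rhs => rw [← Num.to_of_nat n]
  rw [Computability.encodeNat]
  cases (n : Num) with
  | zero => rfl
  | pos m => exact ofBits_encodePosNum m

theorem encodeBinary_one : encodeBinary 1 = [Symbol.bit true, Symbol.close] := rfl

/-! ### Programs that write words -/

namespace StackProg

variable {R A : Type}

/-- The program that writes a word on the stack `o`; the word is composed of letters and of
contents of other stacks. -/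
def write (o : R) (t : List (A ⊕ R)) : StackProg R A :=
  t.foldr (fun x p => seq (x.elim (push o) fun r => copy r o) p) skip

/-- The word written by `write`. A stack contributes its contents from bottom to top, because
copying puts them on top of `o` in one piece and the word grows to the left. -/
def expand (ρ : Store R A) (t : List (A ⊕ R)) : List A :=
  t.flatMap fun x => x.elim (fun a => [a]) fun r => (ρ r).reverse

theorem expand_update_of_ne [DecidableEq R] {o : R} {t : List (A ⊕ R)}
    (h : ∀ r, .inr r ∈ t → r ≠ o) (ρ : Store R A) (l : List A) :
    expand (update ρ o l) t = expand ρ t := by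
  refine List.flatMap_congr fun y hy => ?_
  cases y with
  | inl a => rfl
  | inr r => simp [update_of_ne (h r hy)]

theorem run_write [DecidableEq R] {o : R} {t : List (A ⊕ R)} (h : ∀ r, .inr r ∈ t → r ≠ o)
    (ρ : Store R A) :
    (write o t).run ρ = update ρ o ((expand ρ t).reverse ++ ρ o) := by
  induction t generalizing ρ with
  | nil => simp [write, run, expand]
  | cons x t ih =>
    have ht (r : R) (hr : .inr r ∈ t) : r ≠ o := h r (List.mem_cons_of_mem _ hr)
    have hcons : write o (x :: t) = seq (x.elim (push o) fun r => copy r o) (write o t) := rfl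
    rw [hcons, run]
    cases x with
    | inl a | inr r =>
      simp only [Sum.elim_inl, Sum.elim_inr, run, ih ht, expand_update_of_ne ht]
      simp [expand]

theorem wellRanked_write {rank : R → ℕ} {o : R} {t : List (A ⊕ R)}
    (h : ∀ r, .inr r ∈ t → rank r < rank o) : (write o t).WellRanked rank := by
  induction t with
  | nil => trivial
  | cons x t ih =>
    refine ⟨?_, ih fun r hr => h r (List.mem_cons_of_mem _ hr)⟩
    cases x with
    | inl a => trivial
    | inr r => exact h r List.mem_cons_self

theorem writesAbove_write {rank : R → ℕ} {m : ℕ} {o : R} (h : m < rank o) (t : List (A ⊕ R)) :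
    (write o t).WritesAbove rank m := by
  induction t with
  | nil => trivial
  | cons x t ih =>
    refine ⟨?_, ih⟩
    cases x with
    | inl a | inr r => exact h

theorem run_loop_push [DecidableEq R] {r s : R} (hrs : r ≠ s) (ρ : Store R A) :
    (loop r (push s)).run ρ = update (update ρ r []) s ((ρ r).reverse ++ ρ s) := by
  induction h : ρ r generalizing ρ with
  | nil =>
    have hr : update ρ r [] = ρ := by rw [← h, update_eq_self]
    simp [run_loop_nil _ h, hr]
  | cons a l ih =>
    have hstep : (push s a).run (update ρ r l) = update (update ρ r l) s (a :: ρ s) := by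
      simp [run, hrs.symm]
    rw [run_loop_cons _ h (by simp [hstep, hrs]), hstep, ih _ (by simp [hrs]),
      update_comm hrs.symm]
    simp

end StackProg

/-! ### Reading encoded sentences symbol by symbol

An encoded sentence is read from left to right by a finite automaton, which determines the meaning
of every symbol. With this information, the truth value of the sentence is computed from right to
left with a stack of truth values and a few real registers. -/

/-- The states of the automaton that reads encoded sentences, named after the syntactic unit that
the next symbol belongs to. -/
inductive Lex
  | header
  | formula
  | terms
  | sign
  | coeff
  | factors
  | index
  | expo
  deriving DecidableEq

/-- The transition function of the automaton. -/
def Lex.next : Lex → Symbol → Lex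
  | header, .close => formula
  | formula, .eqZero | formula, .gtZero | formula, .geZero => terms
  | terms, .item => sign
  | terms, .close => formula
  | sign, _ => coeff
  | coeff, .close => factors
  | factors, .item => index
  | factors, .close => terms
  | index, .close => expo
  | expo, .close => factors
  | q, _ => q

/-- The index of the variable whose power is being read, after a further symbol. -/
def Lex.nextIndex : Lex → Symbol → ℕ → ℕ
  | factors, .item, _ => 0
  | index, .tally, j => j + 1
  | _, _, j => j

/-- The registers of the evaluation: truth values of subformulas, the values of a sum, a product
and a coefficient, and a power of a variable. -/
structure Registers where
  stack : List Bool
  sum : ℝ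
  prod : ℝ
  coeff : ℝ
  power : ℝ

open Classical in
/-- One step of the evaluation; `x` is the value of the variable whose power is being read. -/
noncomputable def evalStep (x : ℝ) : Lex → Symbol → Registers → Registers
  | .formula, .eqZero, r => { r with stack := decide (r.sum = 0) :: r.stack }
  | .formula, .gtZero, r => { r with stack := decide (0 < r.sum) :: r.stack }
  | .formula, .geZero, r => { r with stack := decide (0 ≤ r.sum) :: r.stack }
  | .formula, .neg, ⟨b :: l, S, M, V, P⟩ => ⟨(!b) :: l, S, M, V, P⟩
  | .formula, .conj, ⟨a :: b :: l, S, M, V, P⟩ => ⟨(a && b) :: l, S, M, V, P⟩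
  | .formula, .disj, ⟨a :: b :: l, S, M, V, P⟩ => ⟨(a || b) :: l, S, M, V, P⟩
  | .terms, .item, r => { r with sum := r.sum + r.prod }
  | .terms, .close, r => { r with sum := 0 }
  | .sign, .plus, r => { r with prod := r.coeff * r.prod }
  | .sign, .minus, r => { r with prod := -(r.coeff * r.prod) }
  | .coeff, .bit b, r => { r with coeff := b.toNat + 2 * r.coeff }
  | .coeff, .close, r => { r with coeff := 0 }
  | .factors, .item, r => { r with prod := r.power * r.prod }
  | .factors, .close, r => { r with prod := 1 }
  | .expo, .bit true, r => { r with power := r.power * r.power * x }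
  | .expo, .bit false, r => { r with power := r.power * r.power }
  | .expo, .close, r => { r with power := 1 }
  | _, _, r => r

/-- The symbol is admissible in the given state, and the stack is large enough. -/
def StepOK : Lex → Symbol → Registers → Prop
  | .formula, .neg, r => 1 ≤ r.stack.length
  | .formula, .conj, r | .formula, .disj, r => 2 ≤ r.stack.length
  | .formula, .eqZero, _ | .formula, .gtZero, _ | .formula, .geZero, _ => True
  | .terms, .item, _ | .terms, .close, _ => True
  | .sign, .plus, _ | .sign, .minus, _ => True
  | .coeff, .bit _, _ | .coeff, .close, _ => True
  | .factors, .item, _ | .factors, .close, _ => True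
  | .index, .tally, _ | .index, .close, _ => True
  | .expo, .bit _, _ | .expo, .close, _ => True
  | _, _, _ => False

/-- The evaluation of a word from right to left. The automaton starts in the given state, reading a
power of the variable of the given index. -/
noncomputable def evalWord (x : ℕ → ℝ) : Lex → ℕ → List Symbol → Registers
  | _, _, [] => ⟨[], 0, 0, 0, 0⟩
  | q, j, t :: w => evalStep (x j) q t (evalWord x (q.next t) (q.nextIndex t j) w)

/-- Every symbol of the word is admissible, and the word ends with a complete formula. -/
def WordOK (x : ℕ → ℝ) : Lex → ℕ → List Symbol → Prop
  | q, _, [] => q = .formula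
  | q, j, t :: w => StepOK q t (evalWord x (q.next t) (q.nextIndex t j) w) ∧
      WordOK x (q.next t) (q.nextIndex t j) w

/-- The word is admissible in state `q`, and its evaluation has the property `φ`. -/
def Evaluates (x : ℕ → ℝ) (q : Lex) (j : ℕ) (w : List Symbol) (φ : Registers → Prop) : Prop :=
  WordOK x q j w ∧ φ (evalWord x q j w)

theorem Evaluates.cons {x : ℕ → ℝ} {q q' : Lex} {j j' : ℕ} {t : Symbol} {w : List Symbol}
    {φ ψ : Registers → Prop} (h : Evaluates x q' j' w φ) (hq : q.next t = q')
    (hj : q.nextIndex t j = j') (hok : ∀ r, φ r → StepOK q t r)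
    (hψ : ∀ r, φ r → ψ (evalStep (x j) q t r)) : Evaluates x q j (t :: w) ψ := by
  subst hq hj
  exact ⟨⟨hok _ h.2, h.1⟩, hψ _ h.2⟩

section EvalEncodings

variable {x : ℕ → ℝ} {s : List Bool} {a m : ℝ} {w : List Symbol}

theorem evaluates_coeff (l : List Bool) {j : ℕ}
    (h : Evaluates x .factors j w fun r => r.stack = s ∧ r.sum = a ∧ r.prod = m) :
    Evaluates x .coeff j (l.map Symbol.bit ++ Symbol.close :: w)
      fun r => r.stack = s ∧ r.sum = a ∧ r.prod = m ∧ r.coeff = ofBits l := by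
  induction l with
  | nil =>
    refine h.cons rfl rfl (fun _ _ => trivial) ?_
    rintro r ⟨hs, ha, hm⟩
    exact ⟨hs, ha, hm, by simp [evalStep, ofBits]⟩
  | cons b l ih =>
    refine ih.cons rfl rfl (fun _ _ => trivial) ?_
    rintro r ⟨hs, ha, hm, hcoeff⟩
    exact ⟨hs, ha, hm, by simp [evalStep, ofBits, hcoeff]⟩

theorem evaluates_sign (c : ℤ) {j : ℕ}
    (h : Evaluates x .factors j w fun r => r.stack = s ∧ r.sum = a ∧ r.prod = m) :
    Evaluates x .sign j (encodeInt c ++ w)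
      fun r => r.stack = s ∧ r.sum = a ∧ r.prod = c * m := by
  have h' := evaluates_coeff (Computability.encodeNat c.natAbs) h
  rw [ofBits_encodeNat] at h'
  rw [encodeInt, encodeBinary, List.cons_append, List.append_assoc, List.singleton_append]
  split_ifs with hc
  · refine h'.cons rfl rfl (fun _ _ => trivial) ?_
    rintro r ⟨hs, ha, hm, hcoeff⟩
    refine ⟨hs, ha, ?_⟩
    have hnatAbs : ((c.natAbs : ℕ) : ℝ) = -(c : ℝ) := by
      rw [Nat.cast_natAbs, abs_of_neg hc, Int.cast_neg]
    simp [evalStep, hm, hcoeff, hnatAbs]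
  · refine h'.cons rfl rfl (fun _ _ => trivial) ?_
    rintro r ⟨hs, ha, hm, hcoeff⟩
    refine ⟨hs, ha, ?_⟩
    have hnatAbs : ((c.natAbs : ℕ) : ℝ) = (c : ℝ) := by
      rw [Nat.cast_natAbs, abs_of_nonneg (not_lt.1 hc)]
    simp [evalStep, hm, hcoeff, hnatAbs]

theorem evaluates_expo (l : List Bool) {j : ℕ}
    (h : Evaluates x .factors j w fun r => r.stack = s ∧ r.sum = a ∧ r.prod = m) :
    Evaluates x .expo j (l.map Symbol.bit ++ Symbol.close :: w)
      fun r => r.stack = s ∧ r.sum = a ∧ r.prod = m ∧ r.power = x j ^ ofBits l := by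
  induction l with
  | nil =>
    refine h.cons rfl rfl (fun _ _ => trivial) ?_
    rintro r ⟨hs, ha, hm⟩
    exact ⟨hs, ha, hm, by simp [evalStep, ofBits]⟩
  | cons b l ih =>
    refine ih.cons rfl rfl (fun _ _ => trivial) ?_
    rintro r ⟨hs, ha, hm, hpower⟩
    cases b with
    | false | true =>
      refine ⟨hs, ha, hm, ?_⟩
      simp only [evalStep, ofBits, hpower, Bool.toNat_false, Bool.toNat_true]
      ring

theorem evaluates_index (k : ℕ) (l : List Bool) {j : ℕ}
    (h : ∀ i, Evaluates x .factors i w fun r => r.stack = s ∧ r.sum = a ∧ r.prod = m) :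
    Evaluates x .index j (List.replicate k Symbol.tally ++
        Symbol.close :: (l.map Symbol.bit ++ Symbol.close :: w))
      fun r => r.stack = s ∧ r.sum = a ∧ r.prod = m ∧ r.power = x (j + k) ^ ofBits l := by
  induction k generalizing j with
  | zero => exact (evaluates_expo l (h j)).cons rfl rfl (fun _ _ => trivial) fun r h => h
  | succ k ih =>
    have htallies := ih (j := j + 1)
    rw [Nat.add_right_comm] at htallies
    exact htallies.cons rfl rfl (fun _ _ => trivial) fun r h => h

theorem evaluates_factors (l : List (ℕ × ℕ)) {j : ℕ}
    (h : ∀ i, Evaluates x .terms i w fun r => r.stack = s ∧ r.sum = a) :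
    Evaluates x .factors j (encodeList encodePower l ++ w)
      fun r => r.stack = s ∧ r.sum = a ∧ r.prod = (l.map fun q => x q.1 ^ q.2).prod := by
  induction l generalizing j with
  | nil =>
    exact (h j).cons rfl rfl (fun _ _ => trivial) fun r ⟨hs, ha⟩ => ⟨hs, ha, rfl⟩
  | cons q l ih =>
    have hpower := evaluates_index q.1 (Computability.encodeNat q.2) (j := 0) fun i => ih (j := i)
    rw [ofBits_encodeNat, Nat.zero_add] at hpower
    simp only [encodeList, encodePower, encodeUnary, encodeBinary, List.append_assoc,
      List.cons_append, List.nil_append]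
    refine hpower.cons rfl rfl (fun _ _ => trivial) fun r ⟨hs, ha, hm, hp⟩ => ?_
    exact ⟨hs, ha, by simp [evalStep, hm, hp]⟩

theorem evaluates_terms (p : NatPoly) {j : ℕ}
    (h : ∀ i, Evaluates x .formula i w fun r => r.stack = s) :
    Evaluates x .terms j (encodeNatPoly p ++ w) fun r => r.stack = s ∧ r.sum = p.eval x := by
  induction p generalizing j with
  | nil =>
    exact (h j).cons rfl rfl (fun _ _ => trivial) fun r hs => ⟨hs, rfl⟩
  | cons b p ih =>
    have hmono := evaluates_sign b.1 (j := j) (evaluates_factors b.2 (j := j) fun i => ih (j := i))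
    simp only [encodeNatPoly, encodeList, encodeNatMono, List.append_assoc, List.cons_append]
    refine hmono.cons rfl rfl (fun _ _ => trivial) fun r ⟨hs, ha, hm⟩ => ⟨hs, ?_⟩
    rw [NatPoly.eval_cons]
    simp [evalStep, ha, hm, add_comm]

open Classical in
theorem evaluates_formula {n : ℕ} {v : Fin n → ℝ} (hv : ∀ i : Fin n, x i = v i) (φ : Formula n)
    {s : List Bool} {w : List Symbol}
    (h : ∀ i, Evaluates x .formula i w fun r => r.stack = s) (j : ℕ) :
    Evaluates x .formula j (encodeFormula φ ++ w) fun r => r.stack = decide (φ.Holds v) :: s := by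
  induction φ generalizing s w j with
  | eqZero p | gtZero p | geZero p =>
    rw [encodeFormula, encodePoly_eq_encodeNatPoly]
    refine (evaluates_terms p.toNatPoly h).cons rfl rfl (fun _ _ => trivial) ?_
    rintro r ⟨hs, ha⟩
    simp [evalStep, hs, ha, Formula.Holds, ← Poly.eval_toNatPoly p hv]
  | neg φ ih =>
    refine (ih h j).cons rfl rfl (fun r hr => by simp [StepOK, hr]) ?_
    rintro ⟨l, S, M, V, P⟩ rfl
    by_cases hφ : φ.Holds v <;> simp [evalStep, Formula.Holds, hφ]
  | conj φ ψ ihφ ihψ | disj φ ψ ihφ ihψ =>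
    rw [encodeFormula, List.cons_append, List.append_assoc]
    refine (ihφ (fun i => ihψ h i) j).cons rfl rfl (fun r hr => by simp [StepOK, hr]) ?_
    rintro ⟨l, S, M, V, P⟩ rfl
    by_cases hφ : φ.Holds v <;> by_cases hψ : ψ.Holds v <;>
      simp [evalStep, Formula.Holds, hφ, hψ]

open Classical in
theorem evaluates_encodeFormula {n : ℕ} {v : Fin n → ℝ} (hv : ∀ i : Fin n, x i = v i)
    (φ : Formula n) (j : ℕ) :
    Evaluates x .formula j (encodeFormula φ) fun r => r.stack = [decide (φ.Holds v)] := by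
  have h := evaluates_formula hv φ (s := []) (w := []) (fun i => ⟨rfl, rfl⟩) j
  rwa [List.append_nil] at h

end EvalEncodings

/-! ### Polynomial constraints between the registers before and after a symbol -/

/-- The real variables that describe one step of the evaluation. The first five hold the registers;
the others bear witness to the correctness of the step: `top`, `rest`, `second` and `rest₂` result
from removing truth values from the stack, the squares of `low`, `high`, `low₂` and `high₂` show
that `rest` and `rest₂` lie between `0` and `1`, and `sign`, `root` and `rootInv` determine the sign
of the sum. -/
inductive Cell
  | stack | sum | prod | coeff | power
  | top | rest | low | high
  | second | rest₂ | low₂ | high₂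
  | sign | root | rootInv
  deriving Inhabited

/-- The variables of a local constraint: the cells before and after a symbol, and the variable
whose power is being read. Since evaluation proceeds from right to left, `nxt` is evaluated earlier
than `cur`. -/
inductive LocalVar
  | cur (c : Cell)
  | nxt (c : Cell)
  | look

/-- Polynomials in the variables of a local constraint. -/
abbrev LocalPoly : Type := List (ℤ × List LocalVar)

/-- The value of a local variable, if the cells have the contents `b` before and `b'` after the
symbol, and the variable whose power is being read has the value `x`. -/
def LocalVar.eval (b b' : Cell → ℝ) (x : ℝ) : LocalVar → ℝ
  | cur c => b c
  | nxt c => b' c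
  | look => x

/-- The value of a local polynomial under an assignment of values to the local variables. -/
noncomputable def LocalPoly.eval (e : LocalVar → ℝ) (p : LocalPoly) : ℝ :=
  (p.map fun a => (a.1 : ℝ) * (a.2.map e).prod).sum

open LocalVar Cell

/-- The value `src` is the code of a stack with top `z` and remainder `s`, where `a` and `b` bear
witness that `s` lies between `0` and `1`. -/
def popConstraints (src z s a b : LocalVar) : List LocalPoly :=
  [[(4, [src]), (-2, [z]), (-1, [s])], [(1, [z, z]), (-1, [z])], [(1, [s]), (-1, [a, a])],
    [(1, []), (-1, [s]), (-1, [b, b])]]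

/-- The constraints for the removal of one truth value from the stack. -/
def popOneConstraints : List LocalPoly :=
  popConstraints (nxt stack) (cur top) (cur rest) (cur low) (cur high)

/-- The constraints for the removal of two truth values from the stack. -/
def popTwoConstraints : List LocalPoly :=
  popOneConstraints ++ popConstraints (cur rest) (cur second) (cur rest₂) (cur low₂) (cur high₂)

/-- The sum is `sign * root ^ 2`, where `sign` is `-1`, `0` or `1`, and `root` is nonzero. -/
def signConstraints : List LocalPoly :=
  [[(1, [nxt sum]), (-1, [cur sign, cur root, cur root])],
    [(1, [cur sign, cur sign, cur sign]), (-1, [cur sign])],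
    [(1, [cur root, cur rootInv]), (-1, [])]]

/-- The given cells do not change. -/
def keep (l : List Cell) : List LocalPoly := l.map fun c => [(1, [cur c]), (-1, [nxt c])]

/-- The constraints that belong to a symbol. In terms of `sign`, the truth values of `= 0`, `> 0`
and `≥ 0` are `1 - sign ^ 2`, `(sign ^ 2 + sign) / 2` and `(2 + sign - sign ^ 2) / 2`. -/
def constraints : Lex → Symbol → List LocalPoly
  | .header, .close => [[(4, [nxt stack]), (-2, [])]]
  | .formula, .eqZero => signConstraints ++
      [[(4, [cur stack]), (-2, []), (2, [cur sign, cur sign]), (-1, [nxt stack])]]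
  | .formula, .gtZero => signConstraints ++
      [[(4, [cur stack]), (-1, [cur sign, cur sign]), (-1, [cur sign]), (-1, [nxt stack])]]
  | .formula, .geZero => signConstraints ++
      [[(4, [cur stack]), (-2, []), (-1, [cur sign]), (1, [cur sign, cur sign]),
        (-1, [nxt stack])]]
  | .formula, .neg => popOneConstraints ++
      [[(4, [cur stack]), (-2, []), (2, [cur top]), (-1, [cur rest])]]
  | .formula, .conj => popTwoConstraints ++
      [[(4, [cur stack]), (-2, [cur top, cur second]), (-1, [cur rest₂])]]
  | .formula, .disj => popTwoConstraints ++
      [[(4, [cur stack]), (-2, [cur top]), (-2, [cur second]), (2, [cur top, cur second]),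
        (-1, [cur rest₂])]]
  | .terms, .item => [(1, [cur sum]), (-1, [nxt sum]), (-1, [nxt prod])] :: keep [stack]
  | .terms, .close => [(1, [cur sum])] :: keep [stack]
  | .sign, .plus => [(1, [cur prod]), (-1, [nxt coeff, nxt prod])] :: keep [stack, sum]
  | .sign, .minus => [(1, [cur prod]), (1, [nxt coeff, nxt prod])] :: keep [stack, sum]
  | .coeff, .bit b =>
      [(1, [cur coeff]), (-b.toNat, []), (-2, [nxt coeff])] :: keep [stack, sum, prod]
  | .coeff, .close => [(1, [cur coeff])] :: keep [stack, sum, prod]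
  | .factors, .item => [(1, [cur prod]), (-1, [nxt power, nxt prod])] :: keep [stack, sum]
  | .factors, .close => [(1, [cur prod]), (-1, [])] :: keep [stack, sum]
  | .index, _ => keep [stack, sum, prod, power]
  | .expo, .bit true =>
      [(1, [cur power]), (-1, [nxt power, nxt power, look])] :: keep [stack, sum, prod]
  | .expo, .bit false => [(1, [cur power]), (-1, [nxt power, nxt power])] :: keep [stack, sum, prod]
  | .expo, .close => [(1, [cur power]), (-1, [])] :: keep [stack, sum, prod]
  | _, _ => []

/-- The code of a stack of truth values: a real number whose base-4 digits are `0` and `2`. Since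
the code of any remainder is at most `1`, the top can be read off. -/
noncomputable def stackCode : List Bool → ℝ
  | [] => 0
  | b :: l => (2 * b.toNat + stackCode l) / 4

theorem stackCode_mem_Icc (l : List Bool) : stackCode l ∈ Set.Icc (0 : ℝ) 1 := by
  induction l with
  | nil => simp [stackCode]
  | cons b l ih =>
    have hb : (b.toNat : ℝ) ≤ 1 := by exact_mod_cast b.toNat_le
    rw [stackCode]
    constructor <;> linarith [ih.1, ih.2, Nat.cast_nonneg (α := ℝ) b.toNat]

/-- The cells hold the contents of those registers that matter in the given state. -/
def Represents (r : Registers) (b : Cell → ℝ) : Lex → Prop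
  | .header => True
  | .formula => b stack = stackCode r.stack
  | .terms => b stack = stackCode r.stack ∧ b sum = r.sum
  | .sign | .factors => b stack = stackCode r.stack ∧ b sum = r.sum ∧ b prod = r.prod
  | .coeff => b stack = stackCode r.stack ∧ b sum = r.sum ∧ b prod = r.prod ∧ b coeff = r.coeff
  | .index | .expo =>
    b stack = stackCode r.stack ∧ b sum = r.sum ∧ b prod = r.prod ∧ b power = r.power

section Soundness

variable {e : LocalVar → ℝ}

theorem eq_of_popConstraints {c : Bool} {l : List Bool} {src z s a b : LocalVar}
    (hsrc : e src = stackCode (c :: l))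
    (h : ∀ p ∈ popConstraints src z s a b, LocalPoly.eval e p = 0) :
    e z = c.toNat ∧ e s = stackCode l := by
  simp only [popConstraints, LocalPoly.eval, List.forall_mem_cons, List.map_cons, List.map_nil,
    List.prod_cons, List.prod_nil, List.sum_cons, List.sum_nil, Int.cast_neg, Int.cast_ofNat,
    Int.cast_one, mul_one, one_mul, add_zero] at h
  obtain ⟨hcode, hbool, hlow, hhigh, -⟩ := h
  have hs0 : 0 ≤ e s := by nlinarith [mul_self_nonneg (e a)]
  have hs1 : e s ≤ 1 := by nlinarith [mul_self_nonneg (e b)]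
  obtain ⟨hl0, hl1⟩ := stackCode_mem_Icc l
  have hz : e z = 0 ∨ e z = 1 := by
    have hmul : e z * (e z - 1) = 0 := by linarith
    exact (mul_eq_zero.1 hmul).imp_right sub_eq_zero.1
  rw [stackCode] at hsrc
  rcases hz with hz | hz <;> cases c <;>
    simp [hz] at hsrc hcode ⊢ <;> linarith

theorem sign_eq_of_signConstraints (h : ∀ p ∈ signConstraints, LocalPoly.eval e p = 0) :
    e (cur sign) = Real.sign (e (nxt sum)) := by
  simp only [signConstraints, LocalPoly.eval, List.forall_mem_cons, List.map_cons, List.map_nil,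
    List.prod_cons, List.prod_nil, List.sum_cons, List.sum_nil, Int.cast_neg, Int.cast_one,
    mul_one, one_mul, add_zero] at h
  obtain ⟨hsum, hsign, hroot, -⟩ := h
  have hpos : 0 < e (cur root) * e (cur root) := by
    refine mul_self_pos.2 fun h0 => ?_
    rw [h0] at hroot
    linarith
  have hsum' : e (nxt sum) = e (cur sign) * (e (cur root) * e (cur root)) := by linarith
  have hcases : e (cur sign) = 0 ∨ e (cur sign) = 1 ∨ e (cur sign) = -1 := by
    have hmul : e (cur sign) * ((e (cur sign) - 1) * (e (cur sign) + 1)) = 0 := by linarith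
    exact (mul_eq_zero.1 hmul).imp_right fun h =>
      (mul_eq_zero.1 h).imp sub_eq_zero.1 eq_neg_of_add_eq_zero_left
  rcases hcases with h | h | h <;> rw [hsum', h]
  · simp
  · rw [one_mul, Real.sign_of_pos hpos]
  · rw [Real.sign_of_neg (by linarith)]

end Soundness

theorem represents_of_comparison {t : Symbol} {r : Registers} {b b' : Cell → ℝ} {x : ℝ}
    (ht : t = .eqZero ∨ t = .gtZero ∨ t = .geZero) (hr : Represents r b' .terms)
    (h : ∀ p ∈ constraints .formula t, LocalPoly.eval (LocalVar.eval b b' x) p = 0) :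
    Represents (evalStep x .formula t r) b .formula := by
  obtain ⟨hstack, hsum⟩ := hr
  rcases ht with rfl | rfl | rfl
  all_goals
    rw [constraints, List.forall_mem_append, List.forall_mem_singleton] at h
    have hsign : b sign = Real.sign (b' sum) := sign_eq_of_signConstraints h.1
    have hpush := h.2
    simp [LocalPoly.eval, LocalVar.eval, hstack, hsign, hsum] at hpush
    simp only [Represents, evalStep, stackCode]
    rcases lt_trichotomy r.sum 0 with hneg | hzero | hpos
    · simp [Real.sign_of_neg hneg, hneg.ne, hneg.not_gt, hneg.not_ge] at hpush ⊢
      linarith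
    · simp [hzero] at hpush ⊢
      linarith
    · simp [Real.sign_of_pos hpos, hpos, hpos.ne', hpos.le] at hpush ⊢
      linarith

theorem represents_of_constraints {q : Lex} {t : Symbol} {r : Registers} {b b' : Cell → ℝ} {x : ℝ}
    (hok : StepOK q t r) (hr : Represents r b' (q.next t))
    (h : ∀ p ∈ constraints q t, LocalPoly.eval (LocalVar.eval b b' x) p = 0) :
    Represents (evalStep x q t r) b q := by
  cases q <;> cases t <;> try exact hok.elim
  case formula.neg =>
    obtain ⟨_ | ⟨c, l⟩, S, M, V, P⟩ := r
    · simp [StepOK] at hok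
    rw [constraints, List.forall_mem_append, List.forall_mem_singleton] at h
    have hstack : LocalVar.eval b b' x (nxt stack) = stackCode (c :: l) := hr
    obtain ⟨htop, hrest⟩ := eq_of_popConstraints hstack h.1
    change b top = c.toNat at htop
    change b rest = stackCode l at hrest
    have hpush := h.2
    simp [LocalPoly.eval, LocalVar.eval, htop, hrest] at hpush
    cases c <;> simp [Represents, evalStep, stackCode] at hpush ⊢ <;> linarith
  case formula.conj | formula.disj =>
    obtain ⟨_ | ⟨c, _ | ⟨d, l⟩⟩, S, M, V, P⟩ := r
    · simp [StepOK] at hok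
    · simp [StepOK] at hok
    rw [constraints, popTwoConstraints, List.forall_mem_append, List.forall_mem_append,
      List.forall_mem_singleton] at h
    have hstack : LocalVar.eval b b' x (nxt stack) = stackCode (c :: d :: l) := hr
    obtain ⟨htop, hrest⟩ := eq_of_popConstraints hstack h.1.1
    obtain ⟨hsecond, hrest₂⟩ := eq_of_popConstraints hrest h.1.2
    change b top = c.toNat at htop
    change b second = d.toNat at hsecond
    change b rest₂ = stackCode l at hrest₂
    have hpush := h.2
    simp [LocalPoly.eval, LocalVar.eval, htop, hsecond, hrest₂] at hpush
    cases c <;> cases d <;> simp [Represents, evalStep, stackCode] at hpush ⊢ <;> linarith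
  case formula.eqZero => exact represents_of_comparison (.inl rfl) hr h
  case formula.gtZero => exact represents_of_comparison (.inr (.inl rfl)) hr h
  case formula.geZero => exact represents_of_comparison (.inr (.inr rfl)) hr h
  case expo.bit c =>
    cases c <;>
    simp [constraints, keep, LocalPoly.eval, LocalVar.eval, Lex.next, Represents, evalStep]
      at h hr ⊢ <;> grind
  all_goals
    simp [constraints, keep, LocalPoly.eval, LocalVar.eval, Lex.next, Represents, evalStep]
      at h hr ⊢
    grind

/-- The contents of the cells for a step from the registers `r` to the registers `r'`. -/
noncomputable def cellValue (r r' : Registers) : Cell → ℝ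
  | stack => stackCode r'.stack
  | sum => r'.sum
  | prod => r'.prod
  | coeff => r'.coeff
  | power => r'.power
  | top => (r.stack.headD false).toNat
  | rest => stackCode r.stack.tail
  | low => √(stackCode r.stack.tail)
  | high => √(1 - stackCode r.stack.tail)
  | second => (r.stack.tail.headD false).toNat
  | rest₂ => stackCode r.stack.tail.tail
  | low₂ => √(stackCode r.stack.tail.tail)
  | high₂ => √(1 - stackCode r.stack.tail.tail)
  | sign => Real.sign r.sum
  | root => if r.sum = 0 then 1 else √|r.sum|
  | rootInv => (if r.sum = 0 then 1 else √|r.sum|)⁻¹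

section Completeness

variable {e : LocalVar → ℝ}

theorem eval_popConstraints_eq_zero {c : Bool} {l : List Bool} {src z s a b : LocalVar}
    (hsrc : e src = stackCode (c :: l)) (hz : e z = c.toNat) (hs : e s = stackCode l)
    (ha : e a = √(stackCode l)) (hb : e b = √(1 - stackCode l)) :
    ∀ p ∈ popConstraints src z s a b, LocalPoly.eval e p = 0 := by
  obtain ⟨hl0, hl1⟩ := stackCode_mem_Icc l
  have hbool : (c.toNat : ℝ) * c.toNat = c.toNat := by cases c <;> simp
  simp [popConstraints, LocalPoly.eval, hsrc, hz, hs, ha, hb, stackCode, hbool,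
    Real.mul_self_sqrt hl0, Real.mul_self_sqrt (sub_nonneg.2 hl1)]
  constructor <;> ring

theorem eval_signConstraints_eq_zero {s : ℝ} (hsum : e (nxt sum) = s)
    (hsign : e (cur sign) = Real.sign s) (hroot : e (cur root) = if s = 0 then 1 else √|s|)
    (hrootInv : e (cur rootInv) = (e (cur root))⁻¹) :
    ∀ p ∈ signConstraints, LocalPoly.eval e p = 0 := by
  have hne : e (cur root) ≠ 0 := by
    rw [hroot]
    split_ifs with h
    · exact one_ne_zero
    · simpa using h
  have hsq : s ≠ 0 → e (cur root) * e (cur root) = |s| := fun h => by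
    rw [hroot, if_neg h, Real.mul_self_sqrt (abs_nonneg s)]
  simp only [signConstraints, LocalPoly.eval, List.forall_mem_cons, List.map_cons, List.map_nil,
    List.prod_cons, List.prod_nil, List.sum_cons, List.sum_nil, Int.cast_neg, Int.cast_one,
    mul_one, one_mul, add_zero, hrootInv, mul_inv_cancel₀ hne, hsum, hsign]
  rcases lt_trichotomy s 0 with h | rfl | h
  · simp [Real.sign_of_neg h, hsq h.ne, abs_of_neg h]
  · simp
  · simp [Real.sign_of_pos h, hsq h.ne', abs_of_pos h]

end Completeness

theorem eval_comparison_cellValue {t : Symbol} {r : Registers} {b' : Cell → ℝ} {x : ℝ}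
    (ht : t = .eqZero ∨ t = .gtZero ∨ t = .geZero) (hr : Represents r b' .terms) :
    ∀ p ∈ constraints .formula t,
      LocalPoly.eval (LocalVar.eval (cellValue r (evalStep x .formula t r)) b' x) p = 0 := by
  obtain ⟨hstack, hsum⟩ := hr
  rcases ht with rfl | rfl | rfl
  all_goals
    rw [constraints, List.forall_mem_append, List.forall_mem_singleton]
    refine ⟨eval_signConstraints_eq_zero hsum rfl rfl rfl, ?_⟩
    simp only [LocalPoly.eval, List.map_cons, List.map_nil, List.prod_cons, List.prod_nil,
      List.sum_cons, List.sum_nil, LocalVar.eval, cellValue, evalStep, stackCode, hstack]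
    rcases lt_trichotomy r.sum 0 with hneg | hzero | hpos
    · simp [Real.sign_of_neg hneg, hneg.ne, hneg.not_gt, hneg.not_ge]
      ring
    · simp [hzero]
      ring
    · simp [Real.sign_of_pos hpos, hpos, hpos.ne', hpos.le]
      ring

theorem eval_constraints_cellValue {q : Lex} {t : Symbol} {r : Registers} {b' : Cell → ℝ} {x : ℝ}
    (hok : StepOK q t r) (hr : Represents r b' (q.next t)) :
    ∀ p ∈ constraints q t,
      LocalPoly.eval (LocalVar.eval (cellValue r (evalStep x q t r)) b' x) p = 0 := by
  cases q <;> cases t <;> try exact hok.elim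
  case formula.neg =>
    obtain ⟨_ | ⟨c, l⟩, S, M, V, P⟩ := r
    · simp [StepOK] at hok
    rw [constraints, List.forall_mem_append, List.forall_mem_singleton]
    refine ⟨eval_popConstraints_eq_zero hr rfl rfl rfl rfl, ?_⟩
    cases c <;> simp [LocalPoly.eval, LocalVar.eval, cellValue, evalStep, stackCode] <;> ring
  case formula.conj | formula.disj =>
    obtain ⟨_ | ⟨c, _ | ⟨d, l⟩⟩, S, M, V, P⟩ := r
    · simp [StepOK] at hok
    · simp [StepOK] at hok
    rw [constraints, popTwoConstraints, List.forall_mem_append, List.forall_mem_append,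
      List.forall_mem_singleton]
    refine ⟨⟨eval_popConstraints_eq_zero hr rfl rfl rfl rfl,
      eval_popConstraints_eq_zero rfl rfl rfl rfl rfl⟩, ?_⟩
    cases c <;> cases d <;>
      simp [LocalPoly.eval, LocalVar.eval, cellValue, evalStep, stackCode] <;> ring
  case formula.eqZero => exact eval_comparison_cellValue (.inl rfl) hr
  case formula.gtZero => exact eval_comparison_cellValue (.inr (.inl rfl)) hr
  case formula.geZero => exact eval_comparison_cellValue (.inr (.inr rfl)) hr
  case expo.bit c =>
    cases c <;>
    simp [constraints, keep, LocalPoly.eval, LocalVar.eval, Lex.next, Represents, evalStep,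
      cellValue] at hr ⊢ <;> grind
  all_goals
    simp [constraints, keep, LocalPoly.eval, LocalVar.eval, Lex.next, Represents, evalStep,
      cellValue] at hr ⊢
    try grind

/-! ### The constraints for a word -/

/-- The cells `B 0, B 1, …` satisfy the constraints that belong to the symbols of a word, where
`B i` belongs to the `i`-th position. -/
def Satisfies (x : ℕ → ℝ) : Lex → ℕ → List Symbol → (ℕ → Cell → ℝ) → Prop
  | _, _, [], B => B 0 stack = 0
  | q, j, t :: w, B =>
    (∀ p ∈ constraints q t, LocalPoly.eval (LocalVar.eval (B 0) (B 1) (x j)) p = 0) ∧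
      Satisfies x (q.next t) (q.nextIndex t j) w fun i => B (i + 1)

section Satisfies

variable {x : ℕ → ℝ} {q : Lex} {j : ℕ} {w : List Symbol}

theorem represents_of_satisfies {B : ℕ → Cell → ℝ} (hok : WordOK x q j w)
    (h : Satisfies x q j w B) : Represents (evalWord x q j w) (B 0) q := by
  induction w generalizing q j B with
  | nil =>
    obtain rfl : q = .formula := hok
    exact h
  | cons t w ih => exact represents_of_constraints hok.1 (ih hok.2 h.2) h.1

theorem exists_satisfies (hok : WordOK x q j w) : ∃ B, Satisfies x q j w B := by
  induction w generalizing q j with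
  | nil => exact ⟨fun _ _ => 0, rfl⟩
  | cons t w ih =>
    obtain ⟨B, hB⟩ := ih hok.2
    let r := evalWord x (q.next t) (q.nextIndex t j) w
    exact ⟨fun i => i.casesOn (cellValue r (evalStep (x j) q t r)) B,
      eval_constraints_cellValue hok.1 (represents_of_satisfies hok.2 hB), hB⟩

end Satisfies

theorem satisfies_header {x : ℕ → ℝ} (n j : ℕ) (w : List Symbol) (B : ℕ → Cell → ℝ) :
    Satisfies x .header j (encodeUnary n ++ w) B ↔
      B (n + 1) stack = 1 / 2 ∧ Satisfies x .formula j w fun i => B (i + n + 1) := by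
  induction n generalizing B with
  | zero =>
    have hclose : LocalPoly.eval (LocalVar.eval (B 0) (B 1) (x j))
        [(4, [nxt stack]), (-2, [])] = 4 * B 1 stack - 2 := by
      simp [LocalPoly.eval, LocalVar.eval, sub_eq_add_neg]
    simp only [encodeUnary, List.replicate_zero, List.nil_append, List.singleton_append, Satisfies,
      Lex.next, Lex.nextIndex, constraints, List.forall_mem_singleton, hclose]
    refine and_congr_left' ?_
    constructor <;> intro h <;> linarith
  | succ n ih => exact (and_iff_right (by simp [constraints])).trans (ih fun i => B (i + 1))

theorem exists_satisfies_encodeSentence (S : ExistentialSentence) (x : ℕ → ℝ) :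
    (∃ B, Satisfies x .header 0 (encodeSentence S) B) ↔ S.formula.Holds fun i => x i := by
  classical
  obtain ⟨hok, hstack⟩ := evaluates_encodeFormula (x := x) (fun _ => rfl) S.formula 0
  have stack_eq_half_iff : ∀ B, Satisfies x .formula 0 (encodeFormula S.formula) B →
      (B 0 stack = 1 / 2 ↔ S.formula.Holds fun i => x i) := by
    intro B hB
    have h : B 0 stack = _ := represents_of_satisfies hok hB
    rw [h, hstack]
    by_cases hS : S.formula.Holds fun i => x i <;> simp [stackCode, hS]
    norm_num
  constructor
  · rintro ⟨B, hB⟩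
    obtain ⟨hhalf, hformula⟩ := (satisfies_header S.n 0 _ B).1 hB
    exact (stack_eq_half_iff _ hformula).1 (by simpa using hhalf)
  · intro hS
    obtain ⟨B, hB⟩ := exists_satisfies hok
    refine ⟨fun i => B (i - (S.n + 1)), (satisfies_header S.n 0 _ _).2 ⟨?_, ?_⟩⟩
    · simpa using (stack_eq_half_iff B hB).2 hS
    · simpa [Nat.add_assoc] using hB

/-! ### The sum of the squares of the constraints -/

namespace LocalPoly

theorem eval_append (e : LocalVar → ℝ) (p q : LocalPoly) :
    LocalPoly.eval e (p ++ q) = p.eval e + q.eval e := by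
  simp [LocalPoly.eval]

/-- The negative of the product of two polynomials. -/
def negMul (p q : LocalPoly) : LocalPoly :=
  p.flatMap fun a => q.map fun b => (-(a.1 * b.1), a.2 ++ b.2)

theorem eval_negMul (e : LocalVar → ℝ) (p q : LocalPoly) :
    (p.negMul q).eval e = -(p.eval e * q.eval e) := by
  have hmono : ∀ a : ℤ × List LocalVar,
      LocalPoly.eval e (q.map fun b => (-(a.1 * b.1), a.2 ++ b.2)) =
        -(a.1 * (a.2.map e).prod) * q.eval e := by
    intro a
    rw [LocalPoly.eval, LocalPoly.eval, List.map_map, ← List.sum_map_mul_left]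
    congr 1
    refine List.map_congr_left fun b _ => ?_
    simp only [comp_apply, Int.cast_neg, Int.cast_mul, List.map_append, List.prod_append]
    ring
  induction p with
  | nil => simp [negMul, LocalPoly.eval]
  | cons a p ih =>
    rw [negMul, List.flatMap_cons, eval_append, ← negMul, ih, hmono]
    simp only [LocalPoly.eval, List.map_cons, List.sum_cons]
    ring

end LocalPoly

/-- The negative of the sum of the squares of the constraints for a symbol. -/
def penalty (q : Lex) (t : Symbol) : LocalPoly :=
  (constraints q t).flatMap fun p => p.negMul p

section Penalty

variable (e : LocalVar → ℝ) (q : Lex) (t : Symbol)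

theorem eval_penalty : (penalty q t).eval e =
    -((constraints q t).map fun p => p.eval e ^ 2).sum := by
  rw [penalty]
  induction constraints q t with
  | nil => simp [LocalPoly.eval]
  | cons p l ih =>
    rw [List.flatMap_cons, LocalPoly.eval_append, LocalPoly.eval_negMul, ih, List.map_cons,
      List.sum_cons]
    ring

theorem eval_penalty_nonpos : (penalty q t).eval e ≤ 0 := by
  rw [eval_penalty, neg_nonpos]
  refine List.sum_nonneg fun s hs => ?_
  obtain ⟨p, -, rfl⟩ := List.mem_map.1 hs
  exact sq_nonneg _

theorem eval_penalty_eq_zero_iff :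
    (penalty q t).eval e = 0 ↔ ∀ p ∈ constraints q t, LocalPoly.eval e p = 0 := by
  rw [eval_penalty, neg_eq_zero]
  induction constraints q t with
  | nil => simp
  | cons p l ih =>
    have hl : 0 ≤ (l.map fun p => p.eval e ^ 2).sum := by
      refine List.sum_nonneg fun s hs => ?_
      obtain ⟨p, -, rfl⟩ := List.mem_map.1 hs
      exact sq_nonneg _
    rw [List.map_cons, List.sum_cons, add_eq_zero_iff_of_nonneg (sq_nonneg _) hl, ih,
      sq_eq_zero_iff, List.forall_mem_cons]

end Penalty

/-- The offset of the variable of a cell within the block of variables of its position. -/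
def Cell.index : Cell → ℕ
  | stack => 1
  | sum => 2
  | prod => 3
  | coeff => 4
  | power => 5
  | top => 6
  | rest => 7
  | low => 8
  | high => 9
  | second => 10
  | rest₂ => 11
  | low₂ => 12
  | high₂ => 13
  | sign => 14
  | root => 15
  | rootInv => 16

theorem Cell.index_injective : Injective Cell.index := by
  intro c d
  cases c <;> cases d <;> simp [Cell.index]

theorem Cell.index_pos (c : Cell) : 0 < c.index := by cases c <;> decide

theorem Cell.index_lt (c : Cell) : c.index < 17 := by cases c <;> decide

/-- The number of the variable that stands for a local variable at position `i`, if `j` is the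
index of the variable whose power is being read. Each position has a block of `17` variables, and
the first variable of the `j`-th block is the `j`-th variable of the sentence. -/
def LocalVar.toGlobal (i j : ℕ) : LocalVar → ℕ
  | cur c => 17 * i + c.index
  | nxt c => 17 * i + (17 + c.index)
  | look => 17 * j

theorem LocalVar.toGlobal_lt {i j : ℕ} (hj : j ≤ i) (v : LocalVar) :
    v.toGlobal i j < 17 * (i + 2) := by
  cases v with
  | cur c | nxt c =>
    have := c.index_lt
    simp only [LocalVar.toGlobal]
    omega
  | look =>
    simp only [LocalVar.toGlobal]
    omega

/-- The polynomial in the numbered variables that a local polynomial stands for. -/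
def LocalPoly.toGlobal (i j : ℕ) (p : LocalPoly) : NatPoly :=
  p.map fun a => (a.1, a.2.map fun v => (v.toGlobal i j, 1))

theorem LocalPoly.eval_toGlobal (i j : ℕ) (p : LocalPoly) (y : ℕ → ℝ) :
    (p.toGlobal i j).eval y = p.eval fun v => y (v.toGlobal i j) := by
  simp [LocalPoly.toGlobal, NatPoly.eval, LocalPoly.eval, Function.comp_def]

theorem LocalPoly.lt_of_mem_toGlobal {p : LocalPoly} {i j n : ℕ}
    (h : ∀ a ∈ p, ∀ v ∈ a.2, v.toGlobal i j < n) : ∀ a ∈ p.toGlobal i j, ∀ s ∈ a.2, s.1 < n := by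
  intro a ha s hs
  obtain ⟨b, hb, rfl⟩ := List.mem_map.1 ha
  obtain ⟨v, hv, rfl⟩ := List.mem_map.1 hs
  exact h b hb v hv

/-- The values of the cells of all positions. -/
def blocks (y : ℕ → ℝ) (i : ℕ) (c : Cell) : ℝ := y (17 * i + c.index)

/-- The values of the variables of the sentence. -/
def lookups (y : ℕ → ℝ) (j : ℕ) : ℝ := y (17 * j)

theorem apply_toGlobal (y : ℕ → ℝ) (i j : ℕ) (v : LocalVar) :
    y (v.toGlobal i j) = v.eval (blocks y i) (blocks y (i + 1)) (lookups y j) := by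
  cases v with
  | nxt c => exact congrArg y (by simp only [LocalVar.toGlobal]; ring)
  | _ => rfl

theorem exists_blocks_eq (x : ℕ → ℝ) (B : ℕ → Cell → ℝ) :
    ∃ y, lookups y = x ∧ blocks y = B := by
  refine ⟨fun m => if m % 17 = 0 then x (m / 17) else B (m / 17) (invFun Cell.index (m % 17)),
    funext fun j => ?_, funext fun i => funext fun c => ?_⟩
  · simp [lookups]
  · have hpos := c.index_pos
    have hlt := c.index_lt
    have hdiv : (17 * i + c.index) / 17 = i := by omega
    have hmod : (17 * i + c.index) % 17 = c.index := by omega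
    simp [blocks, hdiv, hmod, hpos.ne', leftInverse_invFun Cell.index_injective c]

/-- The constraint that the stack is empty, as a penalty. -/
def finalPenalty : LocalPoly := [(-1, [cur stack, cur stack])]

/-- The sum of the penalties for the symbols of a word that starts at position `i`. -/
def wordPenalty : Lex → ℕ → ℕ → List Symbol → NatPoly
  | _, i, j, [] => finalPenalty.toGlobal i j
  | q, i, j, t :: w =>
    (penalty q t).toGlobal i j ++ wordPenalty (q.next t) (i + 1) (q.nextIndex t j) w

section WordPenalty

variable (y : ℕ → ℝ) (q : Lex) (i j : ℕ) (w : List Symbol)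

theorem eval_wordPenalty_nil :
    (wordPenalty q i j []).eval y = -(blocks y i stack * blocks y i stack) := by
  simp [wordPenalty, LocalPoly.eval_toGlobal, finalPenalty, LocalPoly.eval, apply_toGlobal,
    LocalVar.eval]

theorem eval_wordPenalty_cons (t : Symbol) :
    (wordPenalty q i j (t :: w)).eval y =
      (penalty q t).eval (LocalVar.eval (blocks y i) (blocks y (i + 1)) (lookups y j)) +
        (wordPenalty (q.next t) (i + 1) (q.nextIndex t j) w).eval y := by
  rw [wordPenalty, NatPoly.eval_append, LocalPoly.eval_toGlobal]
  simp only [apply_toGlobal]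

theorem eval_wordPenalty_nonpos : (wordPenalty q i j w).eval y ≤ 0 := by
  induction w generalizing q i j with
  | nil =>
    rw [eval_wordPenalty_nil]
    exact neg_nonpos.2 (mul_self_nonneg _)
  | cons t w ih =>
    rw [eval_wordPenalty_cons]
    exact add_nonpos (eval_penalty_nonpos _ q t) (ih _ _ _)

theorem eval_wordPenalty_eq_zero_iff : (wordPenalty q i j w).eval y = 0 ↔
    Satisfies (lookups y) q j w fun k => blocks y (i + k) := by
  induction w generalizing q i j with
  | nil => simp [eval_wordPenalty_nil, Satisfies]
  | cons t w ih =>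
    have hshift : (fun k => blocks y (i + (k + 1))) = fun k => blocks y (i + 1 + k) := by
      funext k
      rw [add_right_comm, add_assoc]
    have hsymbol := eval_penalty_nonpos (LocalVar.eval (blocks y i) (blocks y (i + 1))
      (lookups y j)) q t
    have hword := eval_wordPenalty_nonpos y (q.next t) (i + 1) (q.nextIndex t j) w
    rw [Satisfies, hshift, ← ih, ← eval_penalty_eq_zero_iff, eval_wordPenalty_cons, add_zero]
    exact ⟨fun h => ⟨by linarith, by linarith⟩, fun h => by rw [h.1, h.2, add_zero]⟩

end WordPenalty

theorem Lex.nextIndex_le (q : Lex) (t : Symbol) (j : ℕ) : q.nextIndex t j ≤ j + 1 := by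
  unfold Lex.nextIndex
  split <;> omega

theorem lt_of_mem_wordPenalty {q : Lex} {i j n : ℕ} {w : List Symbol} (hj : j ≤ i)
    (hn : 17 * (i + w.length + 2) ≤ n) : ∀ a ∈ wordPenalty q i j w, ∀ s ∈ a.2, s.1 < n := by
  induction w generalizing q i j with
  | nil => exact LocalPoly.lt_of_mem_toGlobal fun _ _ v _ => (v.toGlobal_lt hj).trans_le hn
  | cons t w ih =>
    rw [List.length_cons] at hn
    refine List.forall_mem_append.2 ⟨LocalPoly.lt_of_mem_toGlobal fun _ _ v _ =>
      (v.toGlobal_lt hj).trans_le (by omega), ih ((q.nextIndex_le t j).trans (by omega)) (by omega)⟩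

/-! ### Existential sentences as clustering instances -/

/-- The polynomial that attains the value `1` if and only if the sentence with the given encoding
is true. -/
def rewardPoly (w : List Symbol) : NatPoly := (1, []) :: wordPenalty .header 0 0 w

theorem one_le_eval_rewardPoly_iff (y : ℕ → ℝ) (w : List Symbol) :
    1 ≤ (rewardPoly w).eval y ↔ Satisfies (lookups y) .header 0 w (blocks y) := by
  have hsat := eval_wordPenalty_eq_zero_iff y .header 0 0 w
  simp only [Nat.zero_add] at hsat
  rw [rewardPoly, NatPoly.eval_cons, ← hsat, ← (eval_wordPenalty_nonpos y .header 0 0 w).ge_iff_eq]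
  simp

theorem lt_of_mem_rewardPoly {w : List Symbol} {n : ℕ} (hn : 17 * (w.length + 2) ≤ n) :
    ∀ a ∈ rewardPoly w, ∀ s ∈ a.2, s.1 < n :=
  List.forall_mem_cons.2 ⟨by simp, lt_of_mem_wordPenalty le_rfl (by omega)⟩

theorem exists_one_le_eval_rewardPoly_iff (S : ExistentialSentence) :
    (∃ y, 1 ≤ (rewardPoly (encodeSentence S)).eval y) ↔ ETR.Yes S := by
  simp only [one_le_eval_rewardPoly_iff]
  constructor
  · rintro ⟨y, hy⟩
    exact ⟨_, (exists_satisfies_encodeSentence S _).1 ⟨_, hy⟩⟩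
  · rintro ⟨x, hx⟩
    obtain ⟨B, hB⟩ := (exists_satisfies_encodeSentence S
      fun i => if h : i < S.n then x ⟨i, h⟩ else 0).2 (by simpa using hx)
    obtain ⟨y, hlookups, hblocks⟩ := exists_blocks_eq _ B
    exact ⟨y, by rwa [hlookups, hblocks]⟩

theorem NatPoly.eval_congr {p : NatPoly} {y y' : ℕ → ℝ}
    (h : ∀ a ∈ p, ∀ s ∈ a.2, y s.1 = y' s.1) : p.eval y = p.eval y' := by
  unfold NatPoly.eval
  congr 1
  refine List.map_congr_left fun a ha => ?_
  congr 2
  exact List.map_congr_left fun s hs => by rw [h a ha s hs]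

/-- The two points `(y, 0)` and `(y, 1)` have distance `1`. -/
theorem exists_two_points_iff {p : NatPoly} {n : ℕ} (hp : ∀ a ∈ p, ∀ s ∈ a.2, s.1 < n) (θ : ℝ) :
    (∃ P : Fin 2 → EuclideanSpace ℝ (Fin (n + 1)),
      (∀ k, θ ≤ (p.toPoly (n + 1)).eval (P k).ofLp) ∧ ∀ k l, k ≠ l → 1 ≤ ‖P k - P l‖) ↔
        ∃ y, θ ≤ p.eval y := by
  have hp' : ∀ a ∈ p, ∀ s ∈ a.2, s.1 < n + 1 :=
    fun a ha s hs => (hp a ha s hs).trans n.lt_succ_self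
  constructor
  · rintro ⟨P, hP, -⟩
    refine ⟨fun i => if h : i < n + 1 then (P 0).ofLp ⟨i, h⟩ else 0, ?_⟩
    rw [← NatPoly.eval_toPoly hp' fun i => dif_pos i.2]
    exact hP 0
  · rintro ⟨y, hy⟩
    refine ⟨fun k => WithLp.toLp 2 fun i => update y n (k : ℕ) i, fun k => ?_, fun k l hkl => ?_⟩
    · rw [NatPoly.eval_toPoly hp' fun _ => rfl, NatPoly.eval_congr (y' := y)
        fun a ha s hs => update_of_ne (hp a ha s hs).ne _ _]
      exact hy
    · refine le_trans ?_ (PiLp.norm_apply_le _ (Fin.last n))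
      have hint : ((k : ℕ) : ℝ) - ((l : ℕ) : ℝ) = ((k : ℤ) - (l : ℤ) : ℤ) := by push_cast; rfl
      have hne : (k : ℤ) - (l : ℤ) ≠ 0 := fun h => hkl (Fin.ext (by omega))
      simp only [PiLp.sub_apply, Fin.val_last, update_self, Real.norm_eq_abs, hint, ← Int.cast_abs]
      exact_mod_cast Int.one_le_abs hne

/-- The clustering instance for a sentence. The last coordinate does not occur in the polynomial,
it serves to separate the two points. -/
def clusteringOfSentence (S : ExistentialSentence) : CMRCInstance where
  d := 17 * ((encodeSentence S).length + 2) + 1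
  k := 2
  θ := 1
  δ := 1
  f := (rewardPoly (encodeSentence S)).toPoly _
  one_le_k := by norm_num
  θ_pos := by norm_num
  δ_pos := by norm_num

theorem yes_clusteringOfSentence (S : ExistentialSentence) :
    ETR.Yes S ↔ CMRC.Yes (clusteringOfSentence S) := by
  rw [← exists_one_le_eval_rewardPoly_iff, ← exists_two_points_iff (lt_of_mem_rewardPoly le_rfl)]
  simp [CMRC, clusteringOfSentence]

theorem encode_clusteringOfSentence (S : ExistentialSentence) :
    encodeCMRC (clusteringOfSentence S) =
      encodeUnary (17 * ((encodeSentence S).length + 2) + 1) ++ (encodeUnary 2 ++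
        (encodeRat 1 ++ (encodeRat 1 ++ encodeNatPoly (rewardPoly (encodeSentence S))))) := by
  rw [← encodePoly_toPoly (n := 17 * ((encodeSentence S).length + 2) + 1)
    (lt_of_mem_rewardPoly (Nat.le_succ _))]
  rfl

namespace StackProg

variable {R A : Type} (ρ : Store R A)

theorem expand_nil : expand ρ ([] : List (A ⊕ R)) = [] := rfl

theorem expand_inl (a : A) (t : List (A ⊕ R)) : expand ρ (.inl a :: t) = a :: expand ρ t := rfl

theorem expand_inr (r : R) (t : List (A ⊕ R)) :
    expand ρ (.inr r :: t) = (ρ r).reverse ++ expand ρ t := rfl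

theorem expand_append (s t : List (A ⊕ R)) : expand ρ (s ++ t) = expand ρ s ++ expand ρ t :=
  List.flatMap_append

theorem expand_flatMap {α : Type} (l : List α) (f : α → List (A ⊕ R)) :
    expand ρ (l.flatMap f) = l.flatMap fun a => expand ρ (f a) :=
  List.flatMap_assoc

theorem expand_map_inl (l : List A) : expand ρ (l.map .inl) = l := by
  simp [expand, List.flatMap_map]

theorem expand_replicate_inl (n : ℕ) (a : A) :
    expand ρ (List.replicate n (.inl a)) = List.replicate n a := by
  rw [← List.map_replicate, expand_map_inl]

end StackProg

/-! ### A program for the reduction of the existential theory of the reals to clustering -/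

instance : Inhabited Symbol := ⟨.tally⟩

/-- The encoding of a polynomial without the final `close`. -/
def encodeMonomials (p : NatPoly) : List Symbol := p.flatMap fun a => Symbol.item :: encodeNatMono a

theorem encodeMonomials_append (p q : NatPoly) :
    encodeMonomials (p ++ q) = encodeMonomials p ++ encodeMonomials q :=
  List.flatMap_append

theorem encodeNatPoly_eq_encodeMonomials (p : NatPoly) :
    encodeNatPoly p = encodeMonomials p ++ [Symbol.close] :=
  encodeList_eq_flatMap _ _

/-- The stacks of the program that translates sentences. The stacks `pos` and `idx` hold, in unary,
the first variables of the blocks of the current position and of the variable whose power is being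
read; `acc` collects the monomials of the penalties. -/
inductive SentenceReg
  | input | state | pos | idx | acc | result | output
  deriving DecidableEq

namespace SentenceReg

instance : Finite SentenceReg :=
  .of_surjective (fun n : Fin 7 => ![input, state, pos, idx, acc, result, output] n) fun r => by
    cases r <;> decide

open StackProg

/-- Ranks of the stacks for which `translate` is well-ranked. -/
def rank : SentenceReg → ℕ
  | input => 0
  | state => 1
  | pos => 1
  | idx => 1
  | acc => 2
  | result => 3
  | output => 4

/-- States of the automaton are stored on the stack `state` as arbitrarily chosen symbols. -/
def code : Lex → Symbol
  | .header => .tally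
  | .formula => .plus
  | .terms => .minus
  | .sign => .item
  | .coeff => .close
  | .factors => .neg
  | .index => .conj
  | .expo => .disj

/-- The state that is stored on the stack `state`, which is nonempty at all times. -/
def decode : Option Symbol → Lex
  | some .plus => .formula
  | some .minus => .terms
  | some .item => .sign
  | some .close => .coeff
  | some .neg => .factors
  | some .conj => .index
  | some .disj => .expo
  | _ => .header

theorem decode_code (q : Lex) : decode (some (code q)) = q := by cases q <;> rfl

/-- The contents of the stacks while the remainder `w` of the sentence is read. -/
def contents (q : Lex) (i j : ℕ) (a w : List Symbol) : Store SentenceReg Symbol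
  | input => w
  | state => [code q]
  | pos => List.replicate (17 * i) .tally
  | idx => List.replicate (17 * j) .tally
  | acc => a
  | result => []
  | output => []

/-- The number of a variable in unary, as a word with references to the stacks `pos` and `idx`. -/
def indexTemplate : LocalVar → List (Symbol ⊕ SentenceReg)
  | .cur c => .inr pos :: List.replicate c.index (.inl .tally)
  | .nxt c => .inr pos :: List.replicate (17 + c.index) (.inl .tally)
  | .look => [.inr idx]

/-- The encodings of the monomials of a polynomial, as a word with references to the stacks `pos`
and `idx`. -/
def template (p : LocalPoly) : List (Symbol ⊕ SentenceReg) :=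
  p.flatMap fun a => .inl .item :: ((encodeInt a.1).map .inl ++
    (a.2.flatMap (fun v => .inl .item :: (indexTemplate v ++
      [.inl .close, .inl (.bit true), .inl .close])) ++ [.inl .close]))

theorem eq_of_mem_template {p : LocalPoly} {r : SentenceReg} (h : .inr r ∈ template p) :
    r = pos ∨ r = idx := by
  simp only [template, List.mem_flatMap, List.mem_cons, List.mem_append, List.mem_map, reduceCtorEq,
    false_or, or_false, and_false, exists_const, List.not_mem_nil] at h
  obtain ⟨a, -, v, -, h⟩ := h
  cases v <;> simp [indexTemplate, List.mem_replicate] at h <;> simp [h]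

section Run

variable (p : LocalPoly) (q : Lex) (i j : ℕ) (a w : List Symbol)

theorem expand_indexTemplate (v : LocalVar) : expand (contents q i j a w) (indexTemplate v) =
    List.replicate (v.toGlobal i j) .tally := by
  cases v <;> simp only [indexTemplate, expand_inr, expand_nil, expand_replicate_inl, contents,
    LocalVar.toGlobal, List.reverse_replicate, ← List.replicate_add, List.append_nil]

theorem expand_template :
    expand (contents q i j a w) (template p) = encodeMonomials (p.toGlobal i j) := by
  simp [template, expand_flatMap, expand_append, expand_inl, expand_nil, expand_map_inl,
    expand_indexTemplate, encodeMonomials, LocalPoly.toGlobal, encodeNatMono, encodeList_eq_flatMap,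
    encodePower, List.flatMap_map, encodeUnary, encodeBinary_one]

theorem run_write_template : (write acc (template p)).run (contents q i j a w) =
    contents q i j ((encodeMonomials (p.toGlobal i j)).reverse ++ a) w := by
  rw [run_write, expand_template]
  · funext r
    cases r <;> simp [contents]
  · intro r hr
    rcases eq_of_mem_template hr with rfl | rfl <;> decide

theorem run_write_pos :
    (write pos (List.replicate 17 (.inl .tally))).run (contents q i j a w) =
      contents q (i + 1) j a w := by
  rw [run_write (by simp), expand_replicate_inl, List.reverse_replicate]
  funext r
  cases r <;> simp only [contents, ← List.replicate_add, update_self, ne_eq, reduceCtorEq,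
    not_false_eq_true, update_of_ne, mul_add, mul_one, add_comm]

theorem run_write_idx :
    (write idx (List.replicate 17 (.inl .tally))).run (contents q i j a w) =
      contents q i (j + 1) a w := by
  rw [run_write (by simp), expand_replicate_inl, List.reverse_replicate]
  funext r
  cases r <;> simp only [contents, ← List.replicate_add, update_self, ne_eq, reduceCtorEq,
    not_false_eq_true, update_of_ne, mul_add, mul_one, add_comm]

end Run

/-- Updates the stack `idx`, for a symbol read in the given state. -/
def indexStep : Lex → Symbol → StackProg SentenceReg Symbol
  | .factors, .item => .loop idx fun _ => .skip
  | .index, .tally => write idx (List.replicate 17 (.inl .tally))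
  | _, _ => .skip

/-- Processes a symbol that is read in state `q`. -/
def step (t : Symbol) (q : Lex) : StackProg SentenceReg Symbol :=
  .seq (write acc (template (penalty q t))) <|
  .seq (.pop state) <|
  .seq (.push state (code (q.next t))) <|
  .seq (write pos (List.replicate 17 (.inl .tally))) (indexStep q t)

theorem run_indexStep (q' : Lex) (t : Symbol) (q : Lex) (i j : ℕ) (a w : List Symbol) :
    (indexStep q t).run (contents q' i j a w) = contents q' i (q.nextIndex t j) a w := by
  unfold indexStep
  split
  · rw [run_loop_skip]
    funext r
    cases r <;> simp [contents, Lex.nextIndex]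
  · exact run_write_idx _ _ _ _ _
  · rename_i hreset hcount
    cases q <;> cases t <;> simp_all [Lex.nextIndex, run]

theorem run_step (t : Symbol) (q : Lex) (i j : ℕ) (a w : List Symbol) :
    (step t q).run (contents q i j a w) = contents (q.next t) (i + 1) (q.nextIndex t j)
      ((encodeMonomials ((penalty q t).toGlobal i j)).reverse ++ a) w := by
  have hstate (q' : Lex) (a : List Symbol) :
      (push state (code q')).run ((pop state).run (contents q i j a w)) =
        contents q' i j a w := by
    funext r
    cases r <;> simp [run, contents]
  rw [step, run_seq, run_seq, run_seq, run_seq, run_write_template, hstate, run_write_pos,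
    run_indexStep]

/-- Reads the sentence and writes the monomials of its penalties. -/
def translateSymbols : StackProg SentenceReg Symbol :=
  .seq (.loop input fun t => .cases state fun o => step t (decode o)) <|
  write acc (template finalPenalty)

theorem run_translateSymbols (w : List Symbol) (q : Lex) (i j : ℕ) (a : List Symbol) :
    ∃ q' j', translateSymbols.run (contents q i j a w) = contents q' (i + w.length) j'
      ((encodeMonomials (wordPenalty q i j w)).reverse ++ a) [] := by
  induction w generalizing q i j a with
  | nil =>
    exact ⟨q, j, by rw [translateSymbols, run_seq, run_loop_nil _ rfl, run_write_template]; rfl⟩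
  | cons t w ih =>
    obtain ⟨q', j', h⟩ := ih (q.next t) (i + 1) (q.nextIndex t j)
      ((encodeMonomials ((penalty q t).toGlobal i j)).reverse ++ a)
    have hread : update (contents q i j a (t :: w)) input w = contents q i j a w := by
      funext r
      cases r <;> simp [contents]
    have hstep : (StackProg.cases state fun o => step t (decode o)).run (contents q i j a w) =
        contents (q.next t) (i + 1) (q.nextIndex t j)
          ((encodeMonomials ((penalty q t).toGlobal i j)).reverse ++ a) w := by
      change (step t (decode (some (code q)))).run _ = _
      rw [decode_code, run_step]
    refine ⟨q', j', ?_⟩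
    rw [translateSymbols, run_seq,
      run_loop_cons (r := input) (ρ := contents q i j a (t :: w)) _ rfl
        (by rw [hread, hstep]; rfl),
      hread, hstep, ← run_seq, ← translateSymbols, h, wordPenalty, encodeMonomials_append,
      List.length_cons, List.reverse_append, List.append_assoc, add_right_comm, add_assoc]

/-- The encoding of the instance up to the penalties. The last block starts at `pos`, and all
variables that occur in the penalties belong to this block or the next one or precede them. -/
def instanceHeader : List (Symbol ⊕ SentenceReg) :=
  .inr pos :: (encodeUnary 35 ++ (encodeUnary 2 ++ (encodeRat 1 ++ (encodeRat 1 ++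
    Symbol.item :: encodeNatMono (1, []))))).map .inl

/-- The program that computes `clusteringOfSentence`. -/
def translate : StackProg SentenceReg Symbol :=
  .seq (.push state (code .header)) <|
  .seq translateSymbols <|
  .seq (write result (instanceHeader ++ [.inr acc, .inl .close])) <|
  .loop result (.push output)

theorem run_translate (S : ExistentialSentence) :
    translate.run (update (fun _ => []) input (encodeSentence S)) output =
      encodeCMRC (clusteringOfSentence S) := by
  have hinit : (StackProg.push state (code .header)).run
      (update (fun _ => []) input (encodeSentence S)) =
      contents .header 0 0 [] (encodeSentence S) := by
    funext r
    cases r <;> simp [run, contents]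
  obtain ⟨q', j', hsymbols⟩ := run_translateSymbols (encodeSentence S) .header 0 0 []
  have hdim : 17 * ((encodeSentence S).length + 2) + 1 = 17 * (encodeSentence S).length + 35 := by
    ring
  rw [translate, run_seq, hinit, run_seq, hsymbols, run_seq, run_write (by simp [instanceHeader]),
    run_loop_push (by decide), encode_clusteringOfSentence, rewardPoly,
    encodeNatPoly_eq_encodeMonomials, hdim]
  simp [instanceHeader, expand_inr, expand_append, expand_map_inl, expand_inl, expand_nil, contents,
    encodeMonomials, encodeUnary, List.replicate_add]

theorem writesAbove_step (t : Symbol) (q : Lex) : (step t q).WritesAbove rank 0 := by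
  refine ⟨writesAbove_write (by decide) _, one_pos, one_pos, writesAbove_write (by decide) _, ?_⟩
  unfold indexStep
  split
  · exact ⟨by decide, fun _ => trivial⟩
  · exact writesAbove_write (by decide) _
  · trivial

theorem rank_lt_of_mem_template {p : LocalPoly} {r : SentenceReg} (h : .inr r ∈ template p) :
    rank r < rank acc := by
  rcases eq_of_mem_template h with rfl | rfl <;> decide

theorem wellRanked_step (t : Symbol) (q : Lex) : (step t q).WellRanked rank := by
  refine ⟨wellRanked_write fun _ => rank_lt_of_mem_template, trivial, trivial,
    wellRanked_write (by simp), ?_⟩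
  unfold indexStep
  split
  · exact fun _ => ⟨trivial, trivial⟩
  · exact wellRanked_write (by simp)
  · trivial

theorem wellRanked_translate : translate.WellRanked rank := by
  refine ⟨trivial, ⟨fun t => ⟨fun o => wellRanked_step t _, fun o => writesAbove_step t _⟩,
    wellRanked_write fun _ => rank_lt_of_mem_template⟩, wellRanked_write fun r hr => ?_,
    fun _ => ⟨trivial, show rank result < rank output by decide⟩⟩
  obtain rfl | rfl : r = pos ∨ r = acc := by simpa [instanceHeader] using hr
  all_goals decide

end SentenceReg

theorem etr_polyReducible_cmrcTwo : PolyReducible ETR CMRCTwo :=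
  ⟨fun S => ⟨clusteringOfSentence S, rfl, rfl, rfl⟩,
    StackProg.computableInPolyTime SentenceReg.translate SentenceReg.wellRanked_translate
      .input .output SentenceReg.run_translate, yes_clusteringOfSentence⟩

/-! ### Hardness -/

theorem existsRealHard_cmrcTwo : ExistsRealHard CMRCTwo := fun _ hQ =>
  PolyReducible.trans hQ etr_polyReducible_cmrcTwo

theorem polyReducible_restrict (P : DecisionProblem) (S : P.Instance → Prop) :
    PolyReducible (P.restrict S) P := by
  let _ := P.alphabetFintype
  let c := idComputableInPolyTime P.encode
  exact ⟨Subtype.val, ⟨{ c with outputsFun := fun a => c.outputsFun a.1 }⟩, fun _ => Iff.rfl⟩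

theorem existsRealHard_cmrc : ExistsRealHard CMRC := fun Q hQ =>
  (existsRealHard_cmrcTwo Q hQ).trans (polyReducible_restrict CMRC _)

/-! ### The reduction of Feas to the existential theory of the reals -/

/-- The stacks of the program that translates instances of Feas. The stack `flag` is nonempty once
the list of variables has been read. -/
inductive FeasReg
  | input | flag | result | output
  deriving DecidableEq

namespace FeasReg

open StackProg

instance : Finite FeasReg :=
  .of_surjective (fun n : Fin 4 => ![input, flag, result, output] n) fun r => by
    cases r <;> decide

/-- Ranks of the stacks for which `translate` is well-ranked. -/
def rank : FeasReg → ℕ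
  | input => 0
  | flag => 1
  | result => 1
  | output => 2

/-- Copies a symbol. The symbol `eqZero`, which turns a polynomial into an equation, is inserted
after the first `close`, the end of the list of variables. -/
def step (t : Symbol) : StackProg FeasReg Symbol :=
  .cases flag fun o => match o, t with
    | none, .close => .seq (write result [.inl .close, .inl .eqZero]) (.push flag .tally)
    | _, t => .push result t

/-- The program that turns a polynomial `r` into the sentence `∃ y, r(y) = 0`. -/
def translate : StackProg FeasReg Symbol :=
  .seq (.loop input step) (.loop result (.push output))

/-- The contents of the stacks while the remainder `w` of the instance is read. -/
def contents (b a w : List Symbol) : Store FeasReg Symbol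
  | input => w
  | flag => b
  | result => a
  | output => []

theorem run_step_of_flag (b t : Symbol) (a w w' : List Symbol) :
    (step t).run (update (contents [b] a w') input w) = contents [b] (t :: a) w := by
  funext r
  cases r <;> simp [step, run, contents]

theorem run_step_tally (a w w' : List Symbol) :
    (step .tally).run (update (contents [] a w') input w) = contents [] (.tally :: a) w := by
  funext r
  cases r <;> simp [step, run, contents]

theorem run_step_close (a w w' : List Symbol) :
    (step .close).run (update (contents [] a w') input w) =
      contents [.tally] (.eqZero :: .close :: a) w := by
  funext r
  cases r <;> simp [step, run, contents, write]

theorem run_loop_step_of_flag (b : Symbol) (a w : List Symbol) :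
    (loop input step).run (contents [b] a w) = contents [b] (w.reverse ++ a) [] := by
  induction w generalizing a with
  | nil => exact run_loop_nil _ rfl
  | cons t w ih =>
    rw [run_loop_cons (r := input) (ρ := contents [b] a (t :: w)) _ rfl
      (by rw [run_step_of_flag]; rfl), run_step_of_flag, ih]
    simp

theorem run_loop_step (n : ℕ) (a w : List Symbol) :
    (loop input step).run (contents [] a (encodeUnary n ++ w)) =
      contents [.tally] ((encodeUnary n ++ .eqZero :: w).reverse ++ a) [] := by
  induction n generalizing a with
  | zero =>
    change (loop input step).run (contents [] a (.close :: w)) = _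
    rw [run_loop_cons (r := input) (ρ := contents [] a (.close :: w)) _ rfl
      (by rw [run_step_close]; rfl), run_step_close, run_loop_step_of_flag]
    simp [encodeUnary]
  | succ n ih =>
    change (loop input step).run (contents [] a (.tally :: (encodeUnary n ++ w))) = _
    rw [run_loop_cons (r := input) (ρ := contents [] a (.tally :: (encodeUnary n ++ w))) _ rfl
      (by rw [run_step_tally]; rfl), run_step_tally, ih]
    simp [encodeUnary, List.replicate_succ]

theorem run_translate (I : FeasInstance) :
    translate.run (update (fun _ => []) input (encodeFeas I)) output =
      encodeSentence ⟨I.m, .eqZero I.r⟩ := by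
  have hinit : update (fun _ => []) input (encodeFeas I) =
      contents [] [] (encodeUnary I.m ++ encodePoly I.r) := by
    funext r
    cases r <;> simp [contents, encodeFeas]
  rw [translate, run_seq, hinit, run_loop_step, run_loop_push (by decide)]
  simp [contents, encodeSentence, encodeFormula]

theorem wellRanked_translate : translate.WellRanked rank := by
  refine ⟨fun t => ⟨fun o => ?_, fun o => ?_⟩, fun _ => ⟨trivial, Nat.one_lt_two⟩⟩ <;>
    dsimp only <;> split
  · exact ⟨wellRanked_write (by simp), trivial⟩
  · trivial
  · exact ⟨writesAbove_write (by decide) _, one_pos⟩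
  · exact one_pos

end FeasReg

theorem feas_polyReducible_etr : PolyReducible Feas ETR :=
  ⟨fun I => ⟨I.m, .eqZero I.r⟩, StackProg.computableInPolyTime FeasReg.translate
    FeasReg.wellRanked_translate .input .output FeasReg.run_translate, fun _ => Iff.rfl⟩

theorem feas_polyReducible_cmrcTwo : PolyReducible Feas CMRCTwo :=
  feas_polyReducible_etr.trans etr_polyReducible_cmrcTwo

/-! ### Clustering instances as existential sentences -/

section Conjunction

variable {n : ℕ} (l : List (Formula n))

/-- The conjunction of a list of formulas, which ends with the true equation `0 = 0`. -/
def conjAll : Formula n := l.foldr .conj (.eqZero [])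

theorem holds_conjAll (x : Fin n → ℝ) : (conjAll l).Holds x ↔ ∀ φ ∈ l, φ.Holds x := by
  induction l with
  | nil => simp [conjAll, Formula.Holds, Poly.eval, Poly.toMvPolynomial]
  | cons φ l ih =>
    rw [List.forall_mem_cons, ← ih]
    rfl

theorem encodeFormula_conjAll :
    encodeFormula (conjAll l) =
      l.flatMap (fun φ => Symbol.conj :: encodeFormula φ) ++ [Symbol.eqZero, Symbol.close] := by
  induction l with
  | nil => rfl
  | cons φ l ih =>
    change Symbol.conj :: (encodeFormula φ ++ encodeFormula (conjAll l)) = _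
    simp [ih]

end Conjunction

/-- An equation `p = 0` or a weak inequality `p ≥ 0` with a polynomial `p`. -/
inductive Clause
  | eqZero (p : NatPoly)
  | geZero (p : NatPoly)

namespace Clause

/-- The polynomial of a clause. -/
def poly : Clause → NatPoly
  | eqZero p => p
  | geZero p => p

/-- Truth of a clause under an assignment of values to the variables `x_0, x_1, …`. -/
def Holds (y : ℕ → ℝ) : Clause → Prop
  | eqZero p => p.eval y = 0
  | geZero p => 0 ≤ p.eval y

/-- The formula in `n` variables that a clause in the variables `x_0, …, x_{n-1}` stands for. -/
def toFormula (n : ℕ) [NeZero n] : Clause → Formula n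
  | eqZero p => .eqZero (p.toPoly n)
  | geZero p => .geZero (p.toPoly n)

/-- The contribution of a clause to the encoding of a conjunction. -/
def encode : Clause → List Symbol
  | eqZero p => .conj :: .eqZero :: encodeNatPoly p
  | geZero p => .conj :: .geZero :: encodeNatPoly p

/-- All variables of the clause have indices less than `n`. -/
def IsBelow (n : ℕ) (c : Clause) : Prop := ∀ a ∈ c.poly, ∀ q ∈ a.2, q.1 < n

variable {n : ℕ} [NeZero n] {c : Clause}

theorem holds_toFormula (h : c.IsBelow n) {x : Fin n → ℝ} {y : ℕ → ℝ}
    (hy : ∀ i : Fin n, y i = x i) : (c.toFormula n).Holds x ↔ c.Holds y := by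
  have heval := NatPoly.eval_toPoly h hy
  cases c <;> simp only [poly] at heval <;> simp only [toFormula, Formula.Holds, Holds, heval]

theorem encode_toFormula (h : c.IsBelow n) :
    Symbol.conj :: encodeFormula (c.toFormula n) = c.encode := by
  have hpoly := encodePoly_toPoly h
  cases c <;> simp only [poly] at hpoly <;> simp only [toFormula, encodeFormula, encode, hpoly]

end Clause

/-- The polynomial with all indices of variables raised by `b`. -/
def NatPoly.shift (b : ℕ) (p : NatPoly) : NatPoly :=
  p.map fun a => (a.1, a.2.map fun q => (b + q.1, q.2))

theorem NatPoly.eval_shift (b : ℕ) (p : NatPoly) (y : ℕ → ℝ) :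
    (p.shift b).eval y = p.eval fun i => y (b + i) := by
  simp [NatPoly.shift, NatPoly.eval, comp_def]

section Clauses

variable (y : ℕ → ℝ)

/-- The clause `x_v = q`, with denominators cleared. -/
def valueClause (v : ℕ) (q : ℚ) : Clause := .eqZero [(-q.num, []), (q.den, [(v, 1)])]

theorem holds_valueClause (v : ℕ) (q : ℚ) : (valueClause v q).Holds y ↔ y v = q := by
  have hden : (q.den : ℝ) ≠ 0 := by exact_mod_cast q.den_nz
  calc (valueClause v q).Holds y ↔ -(q.num : ℝ) + q.den * y v = 0 := by
        simp [valueClause, Clause.Holds, NatPoly.eval]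
    _ ↔ y v * q.den = q.num := by rw [neg_add_eq_zero, eq_comm, mul_comm]
    _ ↔ y v = q := by rw [Rat.cast_def q, eq_div_iff hden]

/-- The clause `x_0 ≤ p(x_b, x_{b+1}, …)`. -/
def thresholdClause (p : NatPoly) (b : ℕ) : Clause := .geZero ((-1, [(0, 1)]) :: p.shift b)

theorem holds_thresholdClause (p : NatPoly) (b : ℕ) :
    (thresholdClause p b).Holds y ↔ y 0 ≤ p.eval fun i => y (b + i) := by
  simp [thresholdClause, Clause.Holds, NatPoly.eval_cons, NatPoly.eval_shift]

/-- The polynomial `(x_a - x_b)²`, expanded. -/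
def sqDiff (a b : ℕ) : NatPoly := [(1, [(a, 2)]), (-2, [(a, 1), (b, 1)]), (1, [(b, 2)])]

theorem eval_sqDiff (a b : ℕ) : (sqDiff a b).eval y = (y a - y b) ^ 2 := by
  simp only [sqDiff, NatPoly.eval, List.map_cons, List.map_nil, List.prod_cons, List.prod_nil,
    List.sum_cons, List.sum_nil]
  push_cast
  ring

theorem NatPoly.eval_flatMap {α : Type} (l : List α) (f : α → NatPoly) :
    NatPoly.eval (l.flatMap f) y = (l.map fun a => (f a).eval y).sum := by
  induction l with
  | nil => rfl
  | cons a l ih => rw [List.flatMap_cons, NatPoly.eval_append, ih, List.map_cons, List.sum_cons]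

/-- The squared distance of the points with coordinates `x_b, x_{b+1}, …` and
`x_{b'}, x_{b'+1}, …` in dimension `d` is at least the square of the variable `x_1`. -/
def distanceClause (d b b' : ℕ) : Clause :=
  .geZero ((-1, [(1, 2)]) :: (List.range d).flatMap fun a => sqDiff (b + a) (b' + a))

theorem holds_distanceClause (d b b' : ℕ) :
    (distanceClause d b b').Holds y ↔
      y 1 ^ 2 ≤ ∑ a : Fin d, (y (b + a) - y (b' + a)) ^ 2 := by
  rw [distanceClause, Clause.Holds, NatPoly.eval_cons, NatPoly.eval_flatMap,
    ← Finset.sum_range fun a => (y (b + a) - y (b' + a)) ^ 2,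
    ← List.sum_toFinset _ List.nodup_range, List.toFinset_range]
  simp [eval_sqDiff]

end Clauses

/-- The number of the first coordinate of the `i`-th point. The variables `x_0` and `x_1` hold the
threshold and the minimal distance. -/
def pointIndex (d i : ℕ) : ℕ := 2 + i * d

theorem pointIndex_add_lt {d i k a : ℕ} (hi : i < k) (ha : a < d) :
    pointIndex d i + a < pointIndex d k := by
  have : (i + 1) * d ≤ k * d := Nat.mul_le_mul_right d hi
  rw [Nat.add_mul] at this
  unfold pointIndex
  omega

instance (d k : ℕ) : NeZero (pointIndex d k) := ⟨by unfold pointIndex; omega⟩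

theorem isBelow_valueClause {n v : ℕ} (h : v < n) (q : ℚ) : (valueClause v q).IsBelow n := by
  simpa [Clause.IsBelow, valueClause, Clause.poly] using h

theorem isBelow_thresholdClause {n b d : ℕ} (p : Poly d) (hn : 0 < n)
    (h : ∀ a < d, b + a < n) : (thresholdClause p.toNatPoly b).IsBelow n := by
  intro a ha q hq
  rcases List.mem_cons.1 ha with rfl | ha
  · obtain rfl : q = (0, 1) := by simpa using hq
    exact hn
  · obtain ⟨_, hb, rfl⟩ := List.mem_map.1 ha
    obtain ⟨_, hs, rfl⟩ := List.mem_map.1 hq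
    obtain ⟨_, -, rfl⟩ := List.mem_map.1 hb
    obtain ⟨v, -, rfl⟩ := List.mem_map.1 hs
    exact h _ v.1.2

theorem isBelow_distanceClause {n b b' d : ℕ} (hn : 1 < n) (h : ∀ a < d, b + a < n)
    (h' : ∀ a < d, b' + a < n) : (distanceClause d b b').IsBelow n := by
  intro a ha q hq
  simp only [distanceClause, Clause.poly, sqDiff, List.mem_cons, List.mem_flatMap, List.mem_range,
    List.not_mem_nil, or_false] at ha
  rcases ha with rfl | ⟨s, hs, rfl | rfl | rfl⟩ <;>
    simp only [List.mem_cons, List.not_mem_nil, or_false] at hq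
  · exact hq ▸ hn
  · exact hq ▸ h s hs
  · rcases hq with rfl | rfl
    exacts [h s hs, h' s hs]
  · exact hq ▸ h' s hs

/-- The clauses on the `i`-th point of a clustering instance and its distances to the earlier
points. -/
def pointClauses (I : CMRCInstance) (i : ℕ) : List Clause :=
  thresholdClause I.f.toNatPoly (pointIndex I.d i) ::
    (List.range i).map fun j => distanceClause I.d (pointIndex I.d i) (pointIndex I.d j)

/-- The clauses whose conjunction asserts that a clustering instance has a solution. -/
def clusteringClauses (I : CMRCInstance) : List Clause :=
  valueClause 0 I.θ :: valueClause 1 I.δ :: (List.range I.k).flatMap (pointClauses I)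

theorem isBelow_of_mem_clusteringClauses {I : CMRCInstance} {c : Clause}
    (hc : c ∈ clusteringClauses I) : c.IsBelow (pointIndex I.d I.k) := by
  have hone : 1 < pointIndex I.d I.k := by unfold pointIndex; omega
  simp only [clusteringClauses, pointClauses, List.mem_cons, List.mem_flatMap, List.mem_range,
    List.mem_map] at hc
  rcases hc with rfl | rfl | ⟨i, hi, rfl | ⟨j, hj, rfl⟩⟩
  · exact isBelow_valueClause (Nat.zero_lt_of_lt hone) _
  · exact isBelow_valueClause hone _
  · exact isBelow_thresholdClause _ (Nat.zero_lt_of_lt hone) fun _ => pointIndex_add_lt hi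
  · exact isBelow_distanceClause hone (fun _ => pointIndex_add_lt hi)
      fun _ => pointIndex_add_lt (hj.trans hi)

/-- The sentence that asserts that a clustering instance has a solution. -/
def sentenceOfClustering (I : CMRCInstance) : ExistentialSentence where
  n := pointIndex I.d I.k
  formula := conjAll ((clusteringClauses I).map (Clause.toFormula _))

theorem encode_sentenceOfClustering (I : CMRCInstance) :
    encodeSentence (sentenceOfClustering I) = encodeUnary (pointIndex I.d I.k) ++
      ((clusteringClauses I).flatMap Clause.encode ++ [Symbol.eqZero, Symbol.close]) := by
  rw [encodeSentence, sentenceOfClustering, encodeFormula_conjAll, List.flatMap_map]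
  congr 2
  exact List.flatMap_congr fun c hc =>
    Clause.encode_toFormula (isBelow_of_mem_clusteringClauses hc)

theorem yes_sentenceOfClustering_iff (I : CMRCInstance) :
    ETR.Yes (sentenceOfClustering I) ↔ ∃ y : ℕ → ℝ, ∀ c ∈ clusteringClauses I, c.Holds y := by
  have holds_iff {x : Fin (pointIndex I.d I.k) → ℝ} {y : ℕ → ℝ} (h : ∀ i : Fin _, y i = x i) :
      (sentenceOfClustering I).formula.Holds x ↔ ∀ c ∈ clusteringClauses I, c.Holds y := by
    refine (holds_conjAll _ x).trans (List.forall_mem_map.trans ?_)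
    exact forall₂_congr fun c hc => Clause.holds_toFormula (isBelow_of_mem_clusteringClauses hc) h
  constructor
  · rintro ⟨x, hx⟩
    exact ⟨fun i => if h : i < pointIndex I.d I.k then x ⟨i, h⟩ else 0,
      (holds_iff fun i => dif_pos i.2).1 hx⟩
  · rintro ⟨y, hy⟩
    exact ⟨fun i => y i, (holds_iff fun _ => rfl).2 hy⟩

theorem le_norm_sub_iff {d : ℕ} {δ : ℝ} (hδ : 0 ≤ δ) (p q : EuclideanSpace ℝ (Fin d)) :
    δ ≤ ‖p - q‖ ↔ δ ^ 2 ≤ ∑ a, (p a - q a) ^ 2 := by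
  rw [← pow_le_pow_iff_left₀ hδ (norm_nonneg _) two_ne_zero, EuclideanSpace.norm_sq_eq]
  simp

/-- The points and constants of a clustering instance are the values of the variables of its
sentence. -/
structure IsCoordinates (I : CMRCInstance) (p : Fin I.k → EuclideanSpace ℝ (Fin I.d))
    (y : ℕ → ℝ) : Prop where
  threshold : y 0 = I.θ
  distance : y 1 = I.δ
  coordinate : ∀ (i : Fin I.k) (a : Fin I.d), y (pointIndex I.d i + a) = p i a

theorem IsCoordinates.holds_clusteringClauses_iff {I : CMRCInstance}
    {p : Fin I.k → EuclideanSpace ℝ (Fin I.d)} {y : ℕ → ℝ} (h : IsCoordinates I p y) :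
    (∀ c ∈ clusteringClauses I, c.Holds y) ↔
      (∀ i, (I.θ : ℝ) ≤ I.f.eval (p i).ofLp) ∧ ∀ i j, i ≠ j → (I.δ : ℝ) ≤ ‖p i - p j‖ := by
  have hδ : (0 : ℝ) ≤ (I.δ : ℝ) := by exact_mod_cast I.δ_pos.le
  have holds_threshold (i : Fin I.k) :
      (thresholdClause I.f.toNatPoly (pointIndex I.d i)).Holds y ↔
        (I.θ : ℝ) ≤ I.f.eval (p i).ofLp := by
    rw [holds_thresholdClause, h.threshold, Poly.eval_toNatPoly I.f (h.coordinate i)]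
  have holds_distance (i j : Fin I.k) :
      (distanceClause I.d (pointIndex I.d i) (pointIndex I.d j)).Holds y ↔
        (I.δ : ℝ) ≤ ‖p i - p j‖ := by
    simp only [holds_distanceClause, h.distance, le_norm_sub_iff hδ, h.coordinate]
  rw [clusteringClauses, List.forall_mem_cons, List.forall_mem_cons, holds_valueClause,
    holds_valueClause, and_iff_right h.threshold, and_iff_right h.distance]
  simp only [pointClauses, List.mem_flatMap, List.mem_range, List.mem_cons, List.mem_map]
  constructor
  · intro hc
    refine ⟨fun i => (holds_threshold i).1 (hc _ ⟨i, i.2, .inl rfl⟩), fun i j hij => ?_⟩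
    rcases lt_or_gt_of_ne hij with hlt | hlt
    · rw [norm_sub_rev]
      exact (holds_distance j i).1 (hc _ ⟨j, j.2, .inr ⟨i, hlt, rfl⟩⟩)
    · exact (holds_distance i j).1 (hc _ ⟨i, i.2, .inr ⟨j, hlt, rfl⟩⟩)
  · rintro ⟨hthreshold, hdistance⟩ c ⟨i, hi, rfl | ⟨j, hj, rfl⟩⟩
    · exact (holds_threshold ⟨i, hi⟩).2 (hthreshold _)
    · exact (holds_distance ⟨i, hi⟩ ⟨j, hj.trans hi⟩).2 (hdistance _ _ (Fin.ne_of_val_ne hj.ne'))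

theorem exists_isCoordinates (I : CMRCInstance) (p : Fin I.k → EuclideanSpace ℝ (Fin I.d)) :
    ∃ y, IsCoordinates I p y := by
  let coordinates (m : ℕ) : ℝ :=
    if h : m / I.d < I.k ∧ m % I.d < I.d then p ⟨m / I.d, h.1⟩ ⟨m % I.d, h.2⟩ else 0
  let y : ℕ → ℝ
    | 0 => I.θ
    | 1 => I.δ
    | m + 2 => coordinates m
  refine ⟨y, rfl, rfl, fun i a => ?_⟩
  have hdiv : (i * I.d + a) / I.d = i := by
    rw [Nat.add_comm, Nat.add_mul_div_right _ _ a.pos, Nat.div_eq_of_lt a.2, Nat.zero_add]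
  have hmod : (i * I.d + a) % I.d = a := by
    rw [Nat.add_comm, Nat.add_mul_mod_self_right, Nat.mod_eq_of_lt a.2]
  rw [pointIndex, add_assoc, Nat.add_comm 2]
  change coordinates (i * I.d + a) = _
  simp [coordinates, hdiv, hmod]

theorem yes_sentenceOfClustering (I : CMRCInstance) :
    CMRC.Yes I ↔ ETR.Yes (sentenceOfClustering I) := by
  rw [yes_sentenceOfClustering_iff]
  constructor
  · rintro ⟨p, hp⟩
    obtain ⟨y, hy⟩ := exists_isCoordinates I p
    exact ⟨y, hy.holds_clusteringClauses_iff.2 hp⟩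
  · rintro ⟨y, hy⟩
    have hcoord : IsCoordinates I (fun i => WithLp.toLp 2 fun a => y (pointIndex I.d i + a)) y :=
      ⟨(holds_valueClause y 0 _).1 (hy _ (by simp [clusteringClauses])),
        (holds_valueClause y 1 _).1 (hy _ (by simp [clusteringClauses])), fun _ _ => rfl⟩
    exact ⟨_, hcoord.holds_clusteringClauses_iff.1 hy⟩

/-! ### A program for the reduction of clustering to the existential theory of the reals -/

/-- The stacks of the program that translates clustering instances. Numbers are stored in unary:
`base` is the index of the first coordinate of the current point, `base'` the index of the current
coordinate of an earlier point, `done` the number of earlier points, and `off` the number of the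
current coordinate. The clauses are collected on `acc`. -/
inductive ClusterReg
  | input | state | dim | count | poly | polyRev | polyCopy | base | done | doneCopy | base'
  | dimCopy | off | acc | result | output
  deriving DecidableEq

instance : Finite ClusterReg :=
  .of_surjective (fun n : Fin 16 => ![.input, .state, .dim, .count, .poly, .polyRev, .polyCopy,
    .base, .done, .doneCopy, .base', .dimCopy, .off, .acc, .result, .output] n) fun r => by
    cases r <;> decide

/-- The states of the automaton that reads clustering instances: the dimension, the number of
points, the two rational numbers (the second one if the argument is `true`), and the parts of the
polynomial. -/
inductive ClusterLex
  | dim | count | num (second : Bool) | den (second : Bool)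
  | terms | sign | coeff | factors | index | expo
  deriving DecidableEq

namespace ClusterLex

/-- The transition function of the automaton. -/
def next : ClusterLex → Symbol → ClusterLex
  | dim, .close => count
  | count, .close => num false
  | num b, .close => den b
  | den b, .close => if b then terms else num true
  | terms, .item => sign
  | sign, _ => coeff
  | coeff, .close => factors
  | factors, .item => index
  | factors, .close => terms
  | index, .close => expo
  | expo, .close => factors
  | q, _ => q

/-- The stack to which the automaton writes. -/
def target : ClusterLex → Symbol → ClusterReg
  | dim, .tally => .dim
  | count, .tally => .count
  | terms, _ | sign, _ | coeff, _ | factors, _ | index, _ | expo, _ => .poly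
  | _, _ => .acc

/-- The word that the automaton writes. Numerators and denominators are completed to the encodings
of value clauses, and the mark `disj` is inserted before the indices of variables. -/
def emit : ClusterLex → Symbol → List Symbol
  | dim, .close => []
  | count, .close => []
  | num _, .plus => [.conj, .eqZero, .item, .minus]
  | num _, .close => [.close, .close, .item, .plus]
  | den b, .close => .close :: .item :: (encodeUnary b.toNat ++ [.bit true, .close, .close, .close])
  | factors, .item => [.item, .disj]
  | _, t => [t]

/-- States of the automaton are stored on the stack `state` as arbitrarily chosen symbols. -/
def code : ClusterLex → Symbol
  | dim => .tally
  | count => .plus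
  | num false => .minus
  | den false => .item
  | num true => .close
  | den true => .neg
  | terms => .conj
  | sign => .disj
  | coeff => .eqZero
  | factors => .gtZero
  | index => .geZero
  | expo => .bit true

/-- The state that is stored on the stack `state`, which is nonempty at all times. -/
def decode : Option Symbol → ClusterLex
  | some .plus => count
  | some .minus => num false
  | some .item => den false
  | some .close => num true
  | some .neg => den true
  | some .conj => terms
  | some .disj => sign
  | some .eqZero => coeff
  | some .gtZero => factors
  | some .geZero => index
  | some (.bit true) => expo
  | _ => dim

theorem decode_code (q : ClusterLex) : decode (some (code q)) = q := by
  rcases q with _ | _ | (_ | _) | (_ | _) | _ | _ | _ | _ | _ | _ <;> rfl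

/-- The word that is written to the stack `r` while a word is read. -/
def written (r : ClusterReg) : ClusterLex → List Symbol → List Symbol
  | _, [] => []
  | q, t :: w => (if r = q.target t then q.emit t else []) ++ written r (q.next t) w

/-- In state `q`, the symbol `t` is copied to the stack `r` and the state is kept. -/
def Copies (q : ClusterLex) (r : ClusterReg) (t : Symbol) : Prop :=
  q.next t = q ∧ q.target t = r ∧ q.emit t = [t]

variable {r : ClusterReg} {w : List Symbol}

theorem written_cons (q : ClusterLex) (t : Symbol) : written r q (t :: w) =
    (if r = q.target t then q.emit t else []) ++ written r (q.next t) w := rfl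

theorem written_append {r' : ClusterReg} {q : ClusterLex} {l : List Symbol}
    (h : ∀ t ∈ l, q.Copies r' t) :
    written r q (l ++ w) = (if r = r' then l else []) ++ written r q w := by
  induction l with
  | nil => simp
  | cons t l ih =>
    obtain ⟨⟨hnext, htarget, hemit⟩, h⟩ := List.forall_mem_cons.1 h
    rw [List.cons_append, written_cons, hnext, htarget, hemit, ih h]
    split_ifs <;> rfl

theorem written_encodeUnary {r' : ClusterReg} {q : ClusterLex} (h : q.Copies r' .tally) (n : ℕ) :
    written r q (encodeUnary n ++ w) = (if r = r' then List.replicate n .tally else []) ++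
      ((if r = q.target .close then q.emit .close else []) ++ written r (q.next .close) w) := by
  rw [encodeUnary, List.append_assoc, written_append fun _ ht => List.eq_of_mem_replicate ht ▸ h]
  rfl

theorem written_encodeBinary {r' : ClusterReg} {q : ClusterLex} (h : ∀ b, q.Copies r' (.bit b))
    (n : ℕ) : written r q (encodeBinary n ++ w) =
      (if r = r' then (Computability.encodeNat n).map .bit else []) ++
      ((if r = q.target .close then q.emit .close else []) ++ written r (q.next .close) w) := by
  rw [encodeBinary, List.append_assoc, written_append (List.forall_mem_map.2 fun b _ => h b)]
  rfl

theorem written_dim (n : ℕ) : written r dim (encodeUnary n ++ w) =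
    (if r = .dim then List.replicate n .tally else []) ++ written r count w := by
  simp [written_encodeUnary (q := dim) (r' := .dim) ⟨rfl, rfl, rfl⟩, emit, next]

theorem written_count (n : ℕ) : written r count (encodeUnary n ++ w) =
    (if r = .count then List.replicate n .tally else []) ++ written r (num false) w := by
  simp [written_encodeUnary (q := count) (r' := .count) ⟨rfl, rfl, rfl⟩, emit, next]

theorem written_num (b : Bool) {q : ℚ} (hq : 0 < q) :
    written r (num b) (encodeRat q ++ w) =
      (if r = .acc then (valueClause b.toNat q).encode else []) ++
        written r (if b then terms else num true) w := by
  have hnum : 0 < q.num := Rat.num_pos.2 hq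
  have hsign (w : List Symbol) : written r (num b) (.plus :: w) =
      (if r = .acc then [.conj, .eqZero, .item, .minus] else []) ++ written r (num b) w := rfl
  rw [encodeRat, encodeInt, if_neg hnum.not_gt, List.append_assoc, List.cons_append, hsign,
    written_encodeBinary (r' := .acc) fun _ => ⟨rfl, rfl, rfl⟩, next,
    written_encodeBinary (r' := .acc) fun _ => ⟨rfl, rfl, rfl⟩, next]
  by_cases hr : r = .acc <;>
    simp [hr, target, emit, valueClause, Clause.encode, encodeNatPoly, encodeList, encodeNatMono,
      encodeInt, encodePower, encodeUnary, encodeBinary, hnum,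
      show Computability.encodeNat 1 = [true] from rfl]

/-- The encoding of a power of a variable, with the mark `disj` before its index. -/
def markPower (q : ℕ × ℕ) : List Symbol := .disj :: encodePower q

/-- The encoding of a polynomial, with the mark `disj` before the index of every variable. -/
def markPoly (p : NatPoly) : List Symbol :=
  encodeList (fun a => encodeInt a.1 ++ encodeList markPower a.2) p

theorem written_factors (l : List (ℕ × ℕ)) : written r factors (encodeList encodePower l ++ w) =
    (if r = .poly then encodeList markPower l else []) ++ written r terms w := by
  induction l with
  | nil => rfl
  | cons q l ih =>
    have hitem (w : List Symbol) : written r factors (.item :: w) =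
        (if r = .poly then [.item, .disj] else []) ++ written r index w := rfl
    rw [encodeList, encodePower, List.cons_append, hitem, List.append_assoc, List.append_assoc,
      written_encodeUnary (q := index) (r' := .poly) ⟨rfl, rfl, rfl⟩, next,
      written_encodeBinary (q := expo) (r' := .poly) fun _ => ⟨rfl, rfl, rfl⟩, next, ih]
    by_cases hr : r = .poly <;>
      simp [hr, target, emit, encodeList, markPower, encodePower, encodeUnary, encodeBinary]

theorem written_sign (c : ℤ) : written r sign (encodeInt c ++ w) =
    (if r = .poly then encodeInt c else []) ++ written r factors w := by
  rw [encodeInt, List.cons_append, written_cons, next,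
    written_encodeBinary (q := coeff) (r' := .poly) fun _ => ⟨rfl, rfl, rfl⟩, next]
  by_cases hr : r = .poly <;> by_cases hc : c < 0 <;> simp [hr, hc, target, emit, encodeBinary]

theorem written_terms (p : NatPoly) : written r terms (encodeNatPoly p) =
    if r = .poly then markPoly p else [] := by
  induction p with
  | nil => exact List.append_nil _
  | cons a p ih =>
    rw [encodeNatPoly] at ih
    rw [encodeNatPoly, encodeList, encodeNatMono, List.append_assoc,
      written_cons, next, written_sign, written_factors, ih]
    by_cases hr : r = .poly <;> simp [hr, target, emit, markPoly, encodeList]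

theorem written_encodeCMRC (r : ClusterReg) (I : CMRCInstance) :
    written r dim (encodeCMRC I) =
      (if r = .dim then List.replicate I.d .tally else []) ++
      ((if r = .count then List.replicate I.k .tally else []) ++
      ((if r = .acc then (valueClause 0 I.θ).encode else []) ++
      ((if r = .acc then (valueClause 1 I.δ).encode else []) ++
      (if r = .poly then markPoly I.f.toNatPoly else [])))) := by
  rw [encodeCMRC, written_dim, written_count, written_num false I.θ_pos, if_neg Bool.false_ne_true,
    written_num true I.δ_pos, if_pos rfl, encodePoly_eq_encodeNatPoly, written_terms]
  rfl

end ClusterLex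

/-- The word in which every mark `disj` is replaced by the number `b` in unary. -/
def fill (b : ℕ) (l : List Symbol) : List Symbol :=
  l.flatMap fun s => if s = .disj then List.replicate b .tally else [s]

section Fill

variable (b : ℕ)

theorem fill_of_notMem {l : List Symbol} (h : .disj ∉ l) : fill b l = l := by
  rw [fill, List.flatMap_congr (g := fun s => [s]) fun s hs => if_neg (ne_of_mem_of_not_mem hs h)]
  simp

theorem fill_append (l m : List Symbol) : fill b (l ++ m) = fill b l ++ fill b m :=
  List.flatMap_append

theorem fill_cons (s : Symbol) (l : List Symbol) :
    fill b (s :: l) = (if s = .disj then List.replicate b .tally else [s]) ++ fill b l := rfl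

theorem fill_encodeList {α : Type} (e : α → List Symbol) (l : List α) :
    fill b (encodeList e l) = encodeList (fun a => fill b (e a)) l := by
  induction l with
  | nil => rfl
  | cons a l ih => simp [encodeList, fill_cons, fill_append, ih]

theorem fill_encodeInt (c : ℤ) : fill b (encodeInt c) = encodeInt c := by
  refine fill_of_notMem b ?_
  by_cases hc : c < 0 <;> simp [encodeInt, encodeBinary, hc]

theorem fill_markPower (q : ℕ × ℕ) :
    fill b (ClusterLex.markPower q) = encodePower (b + q.1, q.2) := by
  have hmem : Symbol.disj ∉ encodePower q := by
    simp [encodePower, encodeUnary, encodeBinary, List.mem_replicate]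
  rw [ClusterLex.markPower, fill_cons, fill_of_notMem b hmem]
  simp only [encodePower, encodeUnary, List.replicate_add, if_true, List.append_assoc]

theorem fill_markPoly (p : NatPoly) :
    fill b (ClusterLex.markPoly p) = encodeNatPoly (p.shift b) := by
  rw [ClusterLex.markPoly, fill_encodeList, encodeNatPoly, NatPoly.shift, encodeList_map]
  simp only [fill_append, fill_encodeInt, fill_encodeList, fill_markPower, encodeNatMono,
    encodeList_map]

end Fill

theorem StackProg.run_loop_of_invariant {R A : Type} [DecidableEq R] {r : R} {f : A → StackProg R A}
    (S : List A → Store R A)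
    (hS : ∀ m a l, (f a).run (update (S m) r l) = update (S (m ++ [a])) r l) (l : List A) :
    (loop r f).run (update (S []) r l) = update (S l) r [] := by
  suffices h : ∀ m, (loop r f).run (update (S m) r l) = update (S (m ++ l)) r [] from h []
  induction l with
  | nil => exact fun m => (run_loop_nil _ (update_self ..)).trans (by rw [List.append_nil])
  | cons a l ih =>
    intro m
    rw [run_loop_cons (r := r) _ (update_self ..) (by rw [update_idem, hS, update_self]),
      update_idem, hS, ih, List.append_assoc, List.singleton_append]

namespace ClusterReg

open StackProg

/-- Ranks of the stacks for which `translate` is well-ranked. -/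
def rank : ClusterReg → ℕ
  | input => 0
  | state | dim | count | poly => 1
  | polyRev | base | done => 2
  | polyCopy | doneCopy => 3
  | dimCopy => 4
  | base' | off => 5
  | acc => 6
  | result => 7
  | output => 8

/-- Processes one symbol of the instance. -/
def scanStep (t : Symbol) : StackProg ClusterReg Symbol :=
  .cases state fun o =>
    let q := ClusterLex.decode o
    .seq (write (q.target t) ((q.emit t).map .inl)) <|
    .seq (.pop state) (.push state (q.next t).code)

/-- The encoding of the power `x_i ^ e`, where the index `i` is the sum of the numbers on the stacks
`v`. -/
def powerTemplate (v : List ClusterReg) (e : ℕ) : List (Symbol ⊕ ClusterReg) :=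
  v.map .inr ++ .inl .close :: (encodeBinary e).map .inl

/-- The encoding of a monomial, preceded by `item`; the powers are given as for `powerTemplate`. -/
def monomialTemplate (c : ℤ) (l : List (List ClusterReg × ℕ)) : List (Symbol ⊕ ClusterReg) :=
  .inl .item :: ((encodeInt c).map .inl ++
    (l.flatMap (fun v => .inl .item :: powerTemplate v.1 v.2) ++ [.inl .close]))

/-- The monomials of the squared difference of the current coordinates, `sqDiff (base + off) base'`,
with stacks in place of numbers. -/
def sqDiffTemplate : List (Symbol ⊕ ClusterReg) :=
  monomialTemplate 1 [([base, off], 2)] ++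
    (monomialTemplate (-2) [([base, off], 1), ([base'], 1)] ++ monomialTemplate 1 [([base'], 2)])

/-- Writes the monomials for one coordinate of a pair of points. -/
def coordStep : StackProg ClusterReg Symbol :=
  .seq (write acc sqDiffTemplate) (.seq (.push off .tally) (.push base' .tally))

/-- Writes the distance clause of a pair of points. -/
def pairStep : StackProg ClusterReg Symbol :=
  .seq (write acc ((.conj :: .geZero :: .item :: encodeNatMono (-1, [(1, 2)])).map .inl)) <|
  .seq (.copy dim dimCopy) <|
  .seq (.loop dimCopy fun _ => coordStep) <|
  .seq (.loop off fun _ => .skip) (.push acc .close)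

/-- Writes one symbol of the marked polynomial, with the number `base` in place of marks. -/
def fillStep (s : Symbol) : StackProg ClusterReg Symbol :=
  write acc [if s = .disj then .inr base else .inl s]

/-- Writes the clauses on one point. -/
def pointStep : StackProg ClusterReg Symbol :=
  .seq (write acc ((.conj :: .geZero :: .item :: encodeNatMono (-1, [(0, 1)])).map .inl)) <|
  .seq (.copy polyRev polyCopy) <|
  .seq (.loop polyCopy fillStep) <|
  .seq (write base' [.inl .tally, .inl .tally]) <|
  .seq (.copy done doneCopy) <|
  .seq (.loop doneCopy fun _ => pairStep) <|
  .seq (.loop base' fun _ => .skip) <|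
  .seq (.push done .tally) (.copy dim base)

/-- The program that computes `sentenceOfClustering`. -/
def translate : StackProg ClusterReg Symbol :=
  .seq (.push state (ClusterLex.code .dim)) <|
  .seq (.loop input scanStep) <|
  .seq (.loop poly (.push polyRev)) <|
  .seq (write base [.inl .tally, .inl .tally]) <|
  .seq (.loop count fun _ => pointStep) <|
  .seq (write result [.inr base, .inl .close, .inr acc, .inl .eqZero, .inl .close]) <|
  .loop result (.push output)

section Scanning

/-- The contents of the stacks while the remainder `w` of the instance is read in state `q`. -/
def reading (q : ClusterLex) (ρ : Store ClusterReg Symbol) (w : List Symbol) :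
    Store ClusterReg Symbol :=
  update (update ρ state [q.code]) input w

theorem target_mem (q : ClusterLex) (t : Symbol) : q.target t ∈ [dim, count, poly, acc] := by
  cases q <;> cases t <;> simp [ClusterLex.target]

theorem run_scanStep (q : ClusterLex) (t : Symbol) (ρ : Store ClusterReg Symbol) (w : List Symbol) :
    (scanStep t).run (reading q ρ w) =
      reading (q.next t) (fun r => (if r = q.target t then q.emit t else []).reverse ++ ρ r) w := by
  have hq : ClusterLex.decode (reading q ρ w state).head? = q := ClusterLex.decode_code q
  have htarget := target_mem q t
  rw [scanStep, run, hq, run_seq, run_write (by simp), expand_map_inl]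
  generalize q.target t = s at htarget
  funext r
  fin_cases htarget <;> cases r <;> simp [run, reading]

theorem run_loop_scanStep (q : ClusterLex) (ρ : Store ClusterReg Symbol) (w : List Symbol) :
    (loop input scanStep).run (reading q ρ w) =
      reading (w.foldl .next q) (fun r => (q.written r w).reverse ++ ρ r) [] := by
  induction w generalizing q ρ with
  | nil => exact run_loop_nil _ rfl
  | cons t w ih =>
    have hpop : update (reading q ρ (t :: w)) input w = reading q ρ w := update_idem ..
    rw [run_loop_cons (r := input) (ρ := reading q ρ (t :: w)) (l := w) _ rfl
      (by rw [hpop, run_scanStep]; rfl), hpop, run_scanStep, ih]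
    simp [ClusterLex.written_cons]

end Scanning

/-- The contents of a stack that holds the number `n`. -/
def tallies (n : ℕ) : List Symbol := List.replicate n .tally

theorem length_tallies (n : ℕ) : (tallies n).length = n := List.length_replicate

/-- The values that are stored on the stacks after the instance has been read. -/
structure Config where
  lex : ClusterLex
  dim : ℕ
  count : List Symbol
  polyRev : List Symbol
  polyCopy : List Symbol := []
  base : ℕ
  done : ℕ
  doneCopy : List Symbol := []
  base' : ℕ := 0
  dimCopy : List Symbol := []
  off : ℕ := 0
  acc : List Symbol

/-- The contents of the stacks in a configuration. -/
def contents (s : Config) : Store ClusterReg Symbol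
  | input | poly | result | output => []
  | state => [s.lex.code]
  | dim => tallies s.dim
  | count => s.count
  | polyRev => s.polyRev
  | polyCopy => s.polyCopy
  | base => tallies s.base
  | done => tallies s.done
  | doneCopy => s.doneCopy
  | base' => tallies s.base'
  | dimCopy => s.dimCopy
  | off => tallies s.off
  | acc => s.acc

section Configurations

variable (s : Config)

theorem update_contents_count (l : List Symbol) :
    update (contents s) count l = contents { s with count := l } :=
  funext fun r => by cases r <;> rfl

theorem update_contents_polyCopy (l : List Symbol) :
    update (contents s) polyCopy l = contents { s with polyCopy := l } :=
  funext fun r => by cases r <;> rfl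

theorem update_contents_doneCopy (l : List Symbol) :
    update (contents s) doneCopy l = contents { s with doneCopy := l } :=
  funext fun r => by cases r <;> rfl

theorem update_contents_dimCopy (l : List Symbol) :
    update (contents s) dimCopy l = contents { s with dimCopy := l } :=
  funext fun r => by cases r <;> rfl

theorem update_contents_acc (l : List Symbol) :
    update (contents s) acc l = contents { s with acc := l } :=
  funext fun r => by cases r <;> rfl

theorem update_contents_base (n : ℕ) :
    update (contents s) base (tallies n) = contents { s with base := n } :=
  funext fun r => by cases r <;> rfl

theorem update_contents_done (n : ℕ) :
    update (contents s) done (tallies n) = contents { s with done := n } :=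
  funext fun r => by cases r <;> rfl

theorem update_contents_base' (n : ℕ) :
    update (contents s) base' (tallies n) = contents { s with base' := n } :=
  funext fun r => by cases r <;> rfl

theorem update_contents_off (n : ℕ) :
    update (contents s) off (tallies n) = contents { s with off := n } :=
  funext fun r => by cases r <;> rfl

theorem expand_sqDiffTemplate : expand (contents s) sqDiffTemplate =
    encodeMonomials (sqDiff (s.base + s.off) s.base') := by
  simp [sqDiffTemplate, monomialTemplate, powerTemplate, expand_append, expand_inl, expand_inr,
    expand_nil, expand_map_inl, encodeMonomials, sqDiff, encodeNatMono, encodeList, encodePower,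
    encodeUnary, contents, tallies, List.replicate_add, -List.replicate_append_replicate]

theorem run_write_acc {t : List (Symbol ⊕ ClusterReg)} (ht : .inr acc ∉ t) :
    (write acc t).run (contents s) =
      contents { s with acc := (expand (contents s) t).reverse ++ s.acc } := by
  rw [run_write fun r hr => by rintro rfl; exact ht hr]
  exact update_contents_acc _ _

theorem run_coordStep : coordStep.run (contents s) = contents { s with
    acc := (encodeMonomials (sqDiff (s.base + s.off) s.base')).reverse ++ s.acc
    base' := s.base' + 1
    off := s.off + 1 } := by
  have hoff (s : Config) : (push off .tally).run (contents s) =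
    contents { s with off := s.off + 1 } := update_contents_off s (s.off + 1)
  have hbase (s : Config) : (push base' .tally).run (contents s) =
    contents { s with base' := s.base' + 1 } := update_contents_base' s (s.base' + 1)
  rw [coordStep, run_seq, run_write_acc _ (by simp [sqDiffTemplate, monomialTemplate,
    powerTemplate]), expand_sqDiffTemplate, run_seq, hoff, hbase]

theorem run_loop_coordStep : (loop dimCopy fun _ => coordStep).run (contents s) = contents { s with
    dimCopy := []
    acc := (encodeMonomials ((List.range s.dimCopy.length).flatMap fun a =>
      sqDiff (s.base + (s.off + a)) (s.base' + a))).reverse ++ s.acc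
    base' := s.base' + s.dimCopy.length
    off := s.off + s.dimCopy.length } := by
  let S (m : List Symbol) : Config := { s with
    acc := (encodeMonomials ((List.range m.length).flatMap fun a =>
      sqDiff (s.base + (s.off + a)) (s.base' + a))).reverse ++ s.acc
    base' := s.base' + m.length
    off := s.off + m.length }
  have hS := run_loop_of_invariant (r := dimCopy) (f := fun _ => coordStep)
    (fun m => contents (S m)) (fun m a l => ?_) s.dimCopy
  · simpa [update_contents_dimCopy, S, encodeMonomials] using hS
  · rw [update_contents_dimCopy, update_contents_dimCopy, run_coordStep]
    simp [S, List.range_succ, encodeMonomials_append, add_assoc]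

theorem run_pairStep (hdim : s.dimCopy = []) (hoff : s.off = 0) :
    pairStep.run (contents s) = contents { s with
      acc := (distanceClause s.dim s.base s.base').encode.reverse ++ s.acc
      base' := s.base' + s.dim } := by
  have hcopy (s : Config) : (copy dim dimCopy).run (contents s) =
    contents { s with dimCopy := tallies s.dim ++ s.dimCopy } := update_contents_dimCopy _ _
  have hreset (s : Config) : (loop off fun _ => .skip).run (contents s) =
    contents { s with off := 0 } := (run_loop_skip _ _).trans (update_contents_off s 0)
  have hclose (s : Config) : (push acc .close).run (contents s) =
    contents { s with acc := .close :: s.acc } := update_contents_acc _ _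
  rw [pairStep, run_seq, run_write_acc _ (by simp), expand_map_inl, run_seq, hcopy, run_seq,
    run_loop_coordStep, run_seq, hreset, hclose]
  simp [hdim, hoff, length_tallies, distanceClause, Clause.encode, encodeNatPoly_eq_encodeMonomials,
    encodeMonomials]

theorem run_loop_pairStep (hdim : s.dimCopy = []) (hoff : s.off = 0) :
    (loop doneCopy fun _ => pairStep).run (contents s) = contents { s with
      doneCopy := []
      acc := ((List.range s.doneCopy.length).flatMap fun j =>
        (distanceClause s.dim s.base (s.base' + j * s.dim)).encode).reverse ++ s.acc
      base' := s.base' + s.doneCopy.length * s.dim } := by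
  let S (m : List Symbol) : Config := { s with
    acc := ((List.range m.length).flatMap fun j =>
      (distanceClause s.dim s.base (s.base' + j * s.dim)).encode).reverse ++ s.acc
    base' := s.base' + m.length * s.dim }
  have hS := run_loop_of_invariant (r := doneCopy) (f := fun _ => pairStep)
    (fun m => contents (S m)) (fun m a l => ?_) s.doneCopy
  · simpa [update_contents_doneCopy, S] using hS
  · rw [update_contents_doneCopy, update_contents_doneCopy, run_pairStep]
    · simp [S, List.range_succ, add_assoc, add_mul]
    · exact hdim
    · exact hoff

theorem run_fillStep (t : Symbol) : (fillStep t).run (contents s) =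
    contents { s with acc := (fill s.base [t]).reverse ++ s.acc } := by
  rw [fillStep, run_write_acc _ (by split_ifs <;> simp)]
  by_cases ht : t = .disj <;>
    simp [ht, fill, expand_inr, expand_inl, expand_nil, contents, tallies]

theorem run_loop_fillStep : (loop polyCopy fillStep).run (contents s) = contents { s with
    polyCopy := []
    acc := (fill s.base s.polyCopy).reverse ++ s.acc } := by
  let S (m : List Symbol) : Config := { s with acc := (fill s.base m).reverse ++ s.acc }
  have hS := run_loop_of_invariant (r := polyCopy) (f := fillStep)
    (fun m => contents (S m)) (fun m a l => ?_) s.polyCopy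
  · simpa [update_contents_polyCopy, S, fill] using hS
  · rw [update_contents_polyCopy, update_contents_polyCopy, run_fillStep]
    simp [S, fill_append]

end Configurations

section Translation

variable (q : ClusterLex) (I : CMRCInstance)

/-- The configuration after `m` points of the instance have been processed; the stack `count`
contains the word `l`. -/
def pointConfig (m : ℕ) (l : List Symbol) : Config where
  lex := q
  dim := I.d
  count := l
  polyRev := ClusterLex.markPoly I.f.toNatPoly
  base := pointIndex I.d m
  done := m
  acc := ((valueClause 0 I.θ :: valueClause 1 I.δ ::
    (List.range m).flatMap (pointClauses I)).flatMap Clause.encode).reverse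

theorem run_pointStep (m : ℕ) (l : List Symbol) :
    pointStep.run (contents (pointConfig q I m l)) = contents (pointConfig q I (m + 1) l) := by
  have hpoly (s : Config) : (copy polyRev polyCopy).run (contents s) =
    contents { s with polyCopy := s.polyRev ++ s.polyCopy } := update_contents_polyCopy _ _
  have hfirst (s : Config) : (write base' [.inl .tally, .inl .tally]).run (contents s) =
      contents { s with base' := s.base' + 2 } := by
    rw [run_write (by simp)]
    exact update_contents_base' s (s.base' + 2)
  have hdone (s : Config) : (copy done doneCopy).run (contents s) =
    contents { s with doneCopy := tallies s.done ++ s.doneCopy } := update_contents_doneCopy _ _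
  have hreset (s : Config) : (loop base' fun _ => .skip).run (contents s) =
    contents { s with base' := 0 } := (run_loop_skip _ _).trans (update_contents_base' s 0)
  have hcount (s : Config) : (push done .tally).run (contents s) =
    contents { s with done := s.done + 1 } := update_contents_done s (s.done + 1)
  have hnext (s : Config) : (copy dim base).run (contents s) =
      contents { s with base := s.dim + s.base } := by
    rw [← update_contents_base s (s.dim + s.base), tallies, List.replicate_add]
    rfl
  have hbase : I.d + pointIndex I.d m = pointIndex I.d (m + 1) := by
    unfold pointIndex
    ring
  rw [pointStep, run_seq, run_write_acc _ (by simp), expand_map_inl, run_seq, hpoly, run_seq,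
    run_loop_fillStep, run_seq, hfirst, run_seq, hdone, run_seq, run_loop_pairStep _ rfl rfl,
    run_seq, hreset, run_seq, hcount, hnext]
  have hindex (j : ℕ) : 2 + j * I.d = pointIndex I.d j := rfl
  simp [pointConfig, length_tallies, fill_markPoly, pointClauses, hbase, hindex, thresholdClause,
    Clause.encode, encodeNatPoly, encodeList, List.range_succ, List.flatMap_map]

theorem run_loop_pointStep : (loop count fun _ => pointStep).run
      (contents (pointConfig q I 0 (tallies I.k))) = contents (pointConfig q I I.k []) := by
  have hcount (m : ℕ) (l : List Symbol) : update (contents (pointConfig q I m [])) count l =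
    contents (pointConfig q I m l) := update_contents_count _ l
  have hS := run_loop_of_invariant (r := count) (f := fun _ => pointStep)
    (fun m => contents (pointConfig q I m.length [])) (fun m a l => ?_) (tallies I.k)
  · simpa only [hcount, length_tallies, List.length_nil] using hS
  · rw [hcount, hcount, List.length_append]
    exact run_pointStep q I m.length l

theorem run_read :
    (seq (push state (ClusterLex.code .dim)) <| seq (loop input scanStep) <|
      seq (loop poly (push polyRev)) <| write base [.inl .tally, .inl .tally]).run
        (update (fun _ => []) input (encodeCMRC I)) =
      contents (pointConfig ((encodeCMRC I).foldl .next .dim) I 0 (tallies I.k)) := by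
  have hstart : (push state (ClusterLex.code .dim)).run
      (update (fun _ => []) input (encodeCMRC I)) = reading .dim (fun _ => []) (encodeCMRC I) := by
    funext r
    cases r <;> rfl
  rw [run_seq, hstart, run_seq, run_loop_scanStep, run_seq, run_loop_push (by decide),
    run_write (by simp)]
  funext r
  cases r <;> simp [reading, contents, pointConfig, pointIndex, ClusterLex.written_encodeCMRC,
    tallies, expand_inl, expand_nil, List.replicate_succ]

theorem run_translate :
    translate.run (update (fun _ => []) input (encodeCMRC I)) output =
      encodeSentence (sentenceOfClustering I) := by
  have hread := run_read I
  simp only [run_seq] at hread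
  simp only [translate, run_seq]
  rw [hread, run_loop_pointStep, run_write (by simp), run_loop_push (by decide),
    encode_sentenceOfClustering]
  simp [contents, pointConfig, expand_inr, expand_inl, expand_nil, encodeUnary, tallies,
    clusteringClauses]

end Translation

section Ranks

theorem wellRanked_write_sqDiffTemplate : (write acc sqDiffTemplate).WellRanked rank := by
  refine wellRanked_write fun r hr => ?_
  have hr : r = base ∨ r = off ∨ r = base' := by
    simp [sqDiffTemplate, monomialTemplate, powerTemplate] at hr
    tauto
  rcases hr with rfl | rfl | rfl <;> decide

theorem wellRanked_coordStep : coordStep.WellRanked rank :=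
  ⟨wellRanked_write_sqDiffTemplate, trivial, trivial⟩

theorem writesAbove_coordStep {m : ℕ} (hm : m < 5) : coordStep.WritesAbove rank m :=
  ⟨writesAbove_write (hm.trans (by decide)) _, hm, hm⟩

theorem wellRanked_pairStep : pairStep.WellRanked rank :=
  ⟨wellRanked_write (by simp), show 1 < 4 by decide,
    fun _ => ⟨wellRanked_coordStep, writesAbove_coordStep (by decide)⟩,
    fun _ => ⟨trivial, trivial⟩, trivial⟩

theorem writesAbove_pairStep {m : ℕ} (hm : m < 4) : pairStep.WritesAbove rank m :=
  ⟨writesAbove_write (hm.trans (by decide)) _, hm,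
    ⟨hm, fun _ => writesAbove_coordStep (hm.trans (by decide))⟩,
    ⟨hm.trans (by decide), fun _ => trivial⟩, hm.trans (by decide)⟩

theorem wellRanked_fillStep (t : Symbol) : (fillStep t).WellRanked rank := by
  refine wellRanked_write fun r hr => ?_
  obtain rfl : r = base := by split_ifs at hr <;> simp_all
  decide

theorem wellRanked_pointStep : pointStep.WellRanked rank :=
  ⟨wellRanked_write (by simp), show 2 < 3 by decide,
    fun t => ⟨wellRanked_fillStep t, writesAbove_write (by decide) _⟩,
    wellRanked_write (by simp), show 2 < 3 by decide,
    fun _ => ⟨wellRanked_pairStep, writesAbove_pairStep (by decide)⟩,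
    fun _ => ⟨trivial, trivial⟩, trivial, Nat.one_lt_two⟩

theorem writesAbove_pointStep : pointStep.WritesAbove rank 1 :=
  ⟨writesAbove_write (by decide) _, show 1 < 3 by decide,
    ⟨by decide, fun _ => writesAbove_write (by decide) _⟩,
    writesAbove_write (by decide) _, show 1 < 3 by decide,
    ⟨by decide, fun _ => writesAbove_pairStep (by decide)⟩,
    ⟨by decide, fun _ => trivial⟩, Nat.one_lt_two, Nat.one_lt_two⟩

theorem writesAbove_scanStep (t : Symbol) : (scanStep t).WritesAbove rank 0 := by
  refine fun o => ⟨writesAbove_write ?_ _, one_pos, one_pos⟩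
  have htarget := target_mem (ClusterLex.decode o) t
  generalize (ClusterLex.decode o).target t = s at htarget
  fin_cases htarget <;> decide

theorem wellRanked_translate : translate.WellRanked rank := by
  refine ⟨trivial,
    fun t => ⟨fun _ => ⟨wellRanked_write (by simp), trivial, trivial⟩, writesAbove_scanStep t⟩,
    fun _ => ⟨trivial, Nat.one_lt_two⟩, wellRanked_write (by simp),
    fun _ => ⟨wellRanked_pointStep, writesAbove_pointStep⟩, wellRanked_write fun r hr => ?_,
    fun _ => ⟨trivial, show 7 < 8 by decide⟩⟩
  obtain rfl | rfl : r = base ∨ r = acc := by simpa using hr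
  all_goals decide

end Ranks

end ClusterReg

theorem cmrc_mem_existsReal : CMRC ∈ ExistsReal :=
  ⟨sentenceOfClustering, StackProg.computableInPolyTime ClusterReg.translate
    ClusterReg.wellRanked_translate .input .output ClusterReg.run_translate,
    yes_sentenceOfClustering⟩

end RealComplexity

theorem mainTheorem1 :
    RealComplexity.ExistsRealComplete RealComplexity.CMRC ∧
      RealComplexity.PolyReducible RealComplexity.Feas RealComplexity.CMRCTwo ∧
      RealComplexity.ExistsRealHard RealComplexity.CMRCTwo :=
  ⟨⟨RealComplexity.cmrc_mem_existsReal, RealComplexity.existsRealHard_cmrc⟩,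
    RealComplexity.feas_polyReducible_cmrcTwo, RealComplexity.existsRealHard_cmrcTwo⟩
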